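/- Setting. Let $\nu$ be a probability measure on $\mathbb R$ with finite second moment and $Y\sim\nu$; let $\psi:\mathbb R\to\mathbb R_+$ be $L$-Lipschitz and $b:\mathbb R\to\mathbb R_+$ Borel with $\mathbb E[b(Y)]<\infty$. Let $T>0$, let $h$ be a Borel function with $h\in L^1([0,T])$, let $M\ge 1$ be an integer, $\Delta=T/M$ and $(t)_\Delta=\lfloor t/\Delta\rfloor\Delta$. Let $P$ be a Poisson random measure on $\mathbb R_+\times\mathbb R_+\times\mathbb R$ with intensity $dt\,d\theta\,\nu(dy)$ (a random point configuration with finitely many points in each $[0,t]\times[0,c]\times\mathbb R$), and let $\mathcal F_t=\sigma(P(A\times S):A\in\mathcal B((0,t]),\,S\in\mathcal B(\mathbb R_+\times\mathbb R))$. The continuous-time marked Hawkes risk $R$ and its intensity $\lambda$ are a solution on $[0,T]$, with $R$ adapted, $\lambda$ predictable and almost surely finitely many accepted points ($\theta\le\lambda_s$, $s\le T$), of $$R_t=\int_{(0,t]\times\mathbb R_+\times\mathbb R}y\,\mathbf 1_{\theta\le\lambda_s}P(ds,d\theta,dy),\qquad \lambda_t=\psi\Big(\int_{[0,t)\times\mathbb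 R_+\times\mathbb R}h(t-s)\mathbf 1_{\theta\le\lambda_s}b(y)P(ds,d\theta,dy)\Big).$$ The discrete-time risk $R^\Delta$ and intensity $\lambda^\Delta$ are built from the same $P$ by $$l_n=\psi\Big(\sum_{k=1}^{n-1}h((n-k)\Delta)X_k\Big),\qquad X_n=\int_{((n-1)\Delta,n\Delta]\times\mathbb R_+\times\mathbb R}b(y)\mathbf 1_{\theta\le l_n}P(ds,d\theta,dy),$$ $$\lambda^\Delta_t=l_{\lfloor t/\Delta\rfloor},\qquad R^\Delta_t=\sum_{k=1}^{\lfloor t/\Delta\rfloor}\int_{((k-1)\Delta,k\Delta]\times\mathbb R_+\times\mathbb R}y\,\mathbf 1_{\theta\le\lambda^\Delta_{k\Delta}}P(ds,d\theta,dy).$$ Put $$\rho_h=L\,\mathbb E[b(Y)]\int_0^T|h(t)|\,dt,\qquad \rho_{h,\Delta}=L\,\mathbb E[b(Y)]\sum_{k=1}^M|h(k\Delta)|\Delta,$$ $$C_R(h,\Delta)=\int_0^\Delta|h(y)|dy+\sup_{\epsilon\in[0,\Delta]}\int_0^{T-\Delta}|h(y+\epsilon)-h(y)|dy+\int_0^{T-\Delta}|h(y)-h((y)_\Delta+\Delta)|dy,$$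 $$\Xi_k=R_{k\Delta}-\mathbb E[Y]\int_0^{k\Delta}\lambda_s\,ds,\qquad \Xi^\Delta_k=R^\Delta_{k\Delta}-\mathbb E[Y]\sum_{i=1}^k\lambda^\Delta_{i\Delta}\Delta .$$ Proposition. Let $\nu,\psi,L,b$ be as above and let $r<1$. There is a constant $K>0$, depending only on $\nu,\psi,L,b,r$ (in particular neither on $T$ nor on $\Delta$), such that for all $T>0$ and all $h$ with $\rho_h\le r$ the following holds. (a) For every $M\ge1$, $(\Xi_k)_{k=0,\dots,M}$ and $(\Xi^\Delta_k)_{k=0,\dots,M}$ are martingales with respect to $(\mathcal F_{k\Delta})_{k=0,\dots,M}$. (b) For every $M\ge 1$ with $\rho_{h,\Delta}\le r$, $$\mathbb E\Big[\max_{k=1,\dots,M}|\Xi_k-\Xi^\Delta_k|\Big]\le K\sqrt{T\,C_R(h,\Delta)}.$$ (c) If, instead, $\int_0^{T-\Delta}|h(t)-h((t)_\Delta+\Delta)|\,dt\to0$ as $\Delta=T/M\to0$, then there is $\Delta_0>0$, depending only on $\nu,\psi,L,b,r,T,h$, such that the bound of (b), with the same $K$, holds for every $M\ge 1$ with $\Delta=T/M\le\Delta_0$.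 -/

import Mathlib

open MeasureTheory ProbabilityTheory Set Filter Topology
open scoped NNReal ENNReal

namespace HawkesRisk

noncomputable section

/-- The intensity `dt × dθ × ν(dy)` on `ℝ₊ × ℝ₊ × ℝ`, seen as a measure on `ℝ × ℝ × ℝ`.
A point is `p = (t, θ, y)`: time `p.1`, level `p.2.1`, mark `p.2.2`. -/
def pointIntensity (ν : Measure ℝ) : Measure (ℝ × ℝ × ℝ) :=
  (volume.restrict (Ici (0 : ℝ))).prod ((volume.restrict (Ici (0 : ℝ))).prod ν)

/-- `P` is a Poisson random measure with intensity `dt × dθ × ν(dy)`: each realisation is a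
point configuration (a countable sum of Dirac masses) with finitely many points in
`[0,t] × [0,c] × ℝ`, the number of points in a set of finite intensity has the Poisson law, and
the numbers of points in disjoint sets are independent. -/
structure IsPoissonRandomMeasure {Ω : Type*} [MeasurableSpace Ω] (ν : Measure ℝ)
    (P : Ω → Measure (ℝ × ℝ × ℝ)) (μ : Measure Ω) : Prop where
  measurable : Measurable P
  configuration : ∀ ω, ∃ (s : Set ℕ) (x : ℕ → ℝ × ℝ × ℝ),
    P ω = Measure.sum fun i : s => Measure.dirac (x i)
  locallyFinite : ∀ ω (t c : ℝ), P ω (Icc 0 t ×ˢ (Icc 0 c ×ˢ univ)) < ∞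
  law : ∀ A : Set (ℝ × ℝ × ℝ), MeasurableSet A → pointIntensity ν A < ∞ →
    μ.map (fun ω => P ω A)
      = (poissonMeasure (pointIntensity ν A).toNNReal).map (fun n : ℕ => (n : ℝ≥0∞))
  indep : ∀ (n : ℕ) (A : Fin n → Set (ℝ × ℝ × ℝ)), (∀ i, MeasurableSet (A i)) →
    Pairwise (fun i j => Disjoint (A i) (A j)) → iIndepFun (fun i ω => P ω (A i)) μ

/-- The filtration of `P`: `ℱ_t = σ(P(A × S) : A ∈ ℬ((0,t]), S ∈ ℬ(ℝ₊ × ℝ))`. -/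
def poissonFiltration {Ω : Type*} {m : MeasurableSpace Ω} (P : Ω → Measure (ℝ × ℝ × ℝ))
    (hP : Measurable P) : Filtration ℝ≥0 m where
  seq t := MeasurableSpace.generateFrom
    {B | ∃ (A : Set ℝ) (S : Set (ℝ × ℝ)) (U : Set ℝ≥0∞), MeasurableSet A ∧ A ⊆ Ioc 0 (t : ℝ) ∧
      MeasurableSet S ∧ S ⊆ Ici 0 ×ˢ univ ∧ MeasurableSet U ∧
      B = (fun ω => P ω (A ×ˢ S)) ⁻¹' U}
  mono' := by
    intro s t hst
    refine MeasurableSpace.generateFrom_mono ?_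
    rintro B ⟨A, S, U, hA, hAs, hS, hS', hU, rfl⟩
    exact ⟨A, S, U, hA, hAs.trans (Ioc_subset_Ioc_right (by exact_mod_cast hst)), hS, hS', hU, rfl⟩
  le' := by
    intro t
    refine MeasurableSpace.generateFrom_le ?_
    rintro B ⟨A, S, U, hA, -, hS, -, hU, rfl⟩
    exact ((Measure.measurable_coe (hA.prod hS)).comp hP) hU

/-- The discrete filtration `(ℱ_{kΔ})_{k = 0, …, M}`. -/
def gridFiltration {Ω : Type*} {m : MeasurableSpace Ω} (ℱ : Filtration ℝ≥0 m) (Δ : ℝ) (M : ℕ) :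
    Filtration (Fin (M + 1)) m where
  seq k := ℱ (((k : ℕ) : ℝ≥0) * Δ.toNNReal)
  mono' := by
    intro i j hij
    refine ℱ.mono (mul_le_mul_left ?_ _)
    exact_mod_cast hij
  le' := fun k => ℱ.le _

/-- The set of points `(s, θ, y)` with `s ∈ I` accepted by the intensity `ℓ`, that is, with
`0 ≤ θ ≤ ℓ s`. -/
def accepted (I : Set ℝ) (ℓ : ℝ → ℝ) : Set (ℝ × ℝ × ℝ) :=
  {p | p.1 ∈ I ∧ 0 ≤ p.2.1 ∧ p.2.1 ≤ ℓ p.1}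

/-- `∫_{I × ℝ₊ × ℝ} f(s, y) 1_{θ ≤ ℓ_s} π(ds, dθ, dy)`. -/
def thinnedIntegral (π : Measure (ℝ × ℝ × ℝ)) (I : Set ℝ) (ℓ : ℝ → ℝ) (f : ℝ → ℝ → ℝ) : ℝ :=
  ∫ p in accepted I ℓ, f p.1 p.2.2 ∂π

/-- `(R, lam)` is a solution on `[0,T]` of the system defining the marked Hawkes risk `R` and
its intensity `lam`, with kernel `h`, jump rate `ψ` and marks modulation function `b`, driven by
the Poisson measure `P`. The counting process `N_T` of accepted points is finite. -/
structure IsHawkesSolution {Ω : Type*} [MeasurableSpace Ω] (μ : Measure Ω)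
    (P : Ω → Measure (ℝ × ℝ × ℝ)) (hP : Measurable P) (T : ℝ) (h ψ b : ℝ → ℝ)
    (R lam : ℝ → Ω → ℝ) : Prop where
  predictable : IsStronglyPredictable (poissonFiltration P hP) (fun (t : ℝ≥0) => lam (t : ℝ))
  adapted : ∀ t : ℝ≥0, (t : ℝ) ≤ T → StronglyMeasurable[poissonFiltration P hP t] (R (t : ℝ))
  finite_count : ∀ᵐ ω ∂μ, P ω (accepted (Ioc 0 T) fun s => lam s ω) < ∞
  risk_eq : ∀ᵐ ω ∂μ, ∀ t ∈ Icc 0 T,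
    R t ω = thinnedIntegral (P ω) (Ioc 0 t) (fun s => lam s ω) fun _ y => y
  intensity_eq : ∀ᵐ ω ∂μ, ∀ t ∈ Icc 0 T,
    lam t ω = ψ (thinnedIntegral (P ω) (Ico 0 t) (fun s => lam s ω) fun s y => h (t - s) * b y)

/-- `∫_{((n-1)Δ, nΔ] × ℝ₊ × ℝ} g(y) 1_{θ ≤ ℓ} π(ds, dθ, dy)`: the sum of `g(y)` over the points
of the `n`-th time bin accepted at the constant level `ℓ`. -/
def binSum (π : Measure (ℝ × ℝ × ℝ)) (Δ : ℝ) (n : ℕ) (ℓ : ℝ) (g : ℝ → ℝ) : ℝ :=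
  thinnedIntegral π (Ioc (((n : ℝ) - 1) * Δ) (n * Δ)) (fun _ => ℓ) fun _ y => g y

/-- The discrete intensity `l_n = ψ (∑_{k=1}^{n-1} h((n-k)Δ) X_k)`, where
`X_k = ∫_{((k-1)Δ, kΔ] × ℝ₊ × ℝ} b(y) 1_{θ ≤ l_k} π(ds, dθ, dy)`; in the sum, `k = j + 1`. -/
def discreteLevel (π : Measure (ℝ × ℝ × ℝ)) (Δ : ℝ) (h ψ b : ℝ → ℝ) (n : ℕ) : ℝ :=
  ψ (∑ j : Fin (n - 1), h (((n : ℝ) - ((j : ℕ) + 1 : ℕ)) * Δ) *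
    binSum π Δ ((j : ℕ) + 1) (discreteLevel π Δ h ψ b ((j : ℕ) + 1)) b)
termination_by n
decreasing_by omega

theorem discreteLevel_eq (π : Measure (ℝ × ℝ × ℝ)) (Δ : ℝ) (h ψ b : ℝ → ℝ) (n : ℕ) :
    discreteLevel π Δ h ψ b n = ψ (∑ k ∈ Finset.Ico 1 n, h (((n : ℝ) - k) * Δ) *
      binSum π Δ k (discreteLevel π Δ h ψ b k) b) := by
  rw [discreteLevel, Finset.sum_Ico_eq_sum_range, ← Fin.sum_univ_eq_sum_range
    (fun j => h (((n : ℝ) - ((1 + j : ℕ) : ℝ)) * Δ) *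
      binSum π Δ (1 + j) (discreteLevel π Δ h ψ b (1 + j)) b)]
  simp only [Nat.add_comm 1]

/-- The discrete-time Hawkes intensity `λ^Δ_t = l_{⌊t/Δ⌋}`. -/
def discreteIntensity (π : Measure (ℝ × ℝ × ℝ)) (Δ : ℝ) (h ψ b : ℝ → ℝ) (t : ℝ) : ℝ :=
  discreteLevel π Δ h ψ b ⌊t / Δ⌋₊

/-- The discrete-time Hawkes risk
`R^Δ_t = ∑_{k=1}^{⌊t/Δ⌋} ∫_{((k-1)Δ, kΔ] × ℝ₊ × ℝ} y 1_{θ ≤ λ^Δ_{kΔ}} π(ds, dθ, dy)`. -/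
def discreteRisk (π : Measure (ℝ × ℝ × ℝ)) (Δ : ℝ) (h ψ b : ℝ → ℝ) (t : ℝ) : ℝ :=
  ∑ k ∈ Finset.Icc 1 ⌊t / Δ⌋₊, binSum π Δ k (discreteIntensity π Δ h ψ b (k * Δ)) fun y => y

/-- `ρ_h = L ‖h‖_{L¹([0,T])} E[b(Y)]` with `Y ∼ ν`. -/
def rho (L : ℝ≥0) (ν : Measure ℝ) (h b : ℝ → ℝ) (T : ℝ) : ℝ :=
  L * (∫ t in (0 : ℝ)..T, |h t|) * ∫ y, b y ∂ν

/-- `ρ_{h,Δ} = L ∑_{k=1}^M |h(kΔ)| Δ E[b(Y)]` with `Y ∼ ν`. -/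
def rhoDisc (L : ℝ≥0) (ν : Measure ℝ) (h b : ℝ → ℝ) (Δ : ℝ) (M : ℕ) : ℝ :=
  L * (∑ k ∈ Finset.Icc 1 M, |h (k * Δ)| * Δ) * ∫ y, b y ∂ν

/-- The projection `(t)_Δ = ⌊t/Δ⌋ Δ` on the time grid. -/
def gridFloor (Δ t : ℝ) : ℝ := ⌊t / Δ⌋ * Δ

/-- `∫_0^{T-Δ} |h(t) - h((t)_Δ + Δ)| dt → 0` along the steps `Δ = T/M`, `M → ∞`. -/
def LimitAssumption (h : ℝ → ℝ) (T : ℝ) : Prop :=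
  Tendsto (fun M : ℕ => ∫ t in (0 : ℝ)..(T - T / M), |h t - h (gridFloor (T / M) t + T / M)|)
    atTop (𝓝 0)

/-- The regularity constant `C_R(h,Δ)`. -/
def regularityConst (h : ℝ → ℝ) (T Δ : ℝ) : ℝ :=
  (∫ y in (0 : ℝ)..Δ, |h y|)
    + (⨆ ε : Icc (0 : ℝ) Δ, ∫ y in (0 : ℝ)..(T - Δ), |h (y + ε) - h y|)
    + ∫ y in (0 : ℝ)..(T - Δ), |h y - h (gridFloor Δ y + Δ)|

/-- `Ξ_k = R_{kΔ} - E[Y] ∫_0^{kΔ} λ_s ds`. -/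
def compensatedRisk {Ω : Type*} (ν : Measure ℝ) (Δ : ℝ) (R lam : ℝ → Ω → ℝ) (k : ℕ) (ω : Ω) : ℝ :=
  R (k * Δ) ω - (∫ y, y ∂ν) * ∫ s in (0 : ℝ)..(k * Δ), lam s ω

/-- `Ξ^Δ_k = R^Δ_{kΔ} - E[Y] ∑_{i=1}^k λ^Δ_{iΔ} Δ`. -/
def compensatedDiscreteRisk {Ω : Type*} (ν : Measure ℝ) (P : Ω → Measure (ℝ × ℝ × ℝ)) (Δ : ℝ)
    (h ψ b : ℝ → ℝ) (k : ℕ) (ω : Ω) : ℝ :=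
  discreteRisk (P ω) Δ h ψ b (k * Δ)
    - (∫ y, y ∂ν) * ∑ i ∈ Finset.Icc 1 k, discreteIntensity (P ω) Δ h ψ b (i * Δ) * Δ

end

end HawkesRisk

/-! Both risks sum the marks of points of one Poisson measure, thinned by two predictable
intensities. The level `l_n` depends only on the bins before the `n`-th, so the step process equal
to `l_n` on ((n-1)Δ, nΔ] is predictable (`measurable_stepIntensity`). It solves the fixed-point
equation of λ with h(s-u) replaced by `gridKernel` (`IsPoissonRandomMeasure.path_step_eq`). The
bound thus becomes a stability estimate for one equation under a change of kernel, followed by a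
martingale argument.

The tool throughout is the compensation formula
(`IsPoissonRandomMeasure.lintegral_kernel_predPoint`). Independence of ℱ_t and the points after t
gives it on sets (t,∞) × F × S with F in ℱ_t, and the sets (t,∞) × F generate the predictable
σ-algebra away from time 0. The same argument for pairs of points
(`IsPoissonRandomMeasure.secondMoment_eq_crossMoment`) gives the L² isometry, and from it
`IsPoissonRandomMeasure.lintegral_sq_le`.

Intensities: since ψ(x) ≤ ψ(0) + L|x|, compensation yields E∫λ ≤ ψ(0)T + ρ_h E∫λ, hence E∫λ ≤
ψ(0)T/(1-r) once finiteness is secured by a predictable cutoff at accumulated mass n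
(`IsPoissonRandomMeasure.lintegral_intensity_le`). Let e be the expected L¹ distance on (0,T]
between λ and the step process. It has two sources: the change of kernel, whose time integral after
any point is at most C_R(h,Δ) (`setLIntegral_sub_gridKernel_le`), and the points accepted by only
one intensity, whose expected b-sum is at most e·E[b(Y)]. With q = (1+r)/2 bounding the branching
ratio of the grid kernel, e ≤ L E[b(Y)] C_R E∫λ + q e
(`IsPoissonRandomMeasure.lintegral_path_sub_le`), so e is at most a constant times T·C_R. In case
(c) the grid ratio exceeds ρ_h by at most a multiple of the discretisation error of h, which is
eventually at most (1-r)/2.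

Risks: compensation on events of ℱ_s gives the martingale property. Ξ - Ξ^Δ is the compensated
integral of y times a difference of two acceptance indicators. Such a difference has square equal to
its absolute value, so the second moment is at most V = E[Y²]·(bound on e). Doob's weak inequality
gives tails V/t² for the maximum; integrating them gives c + V/c for every c > 0, and c = √(T·C_R)
concludes. -/

namespace HawkesRisk

/-! ### Moments of Poisson counts and independence of past and future -/

/-- The size-bias identity `E[N f(N)] = r E[f(N + 1)]` for a Poisson variable `N`. -/
theorem lintegral_natCast_mul_poissonMeasure (r : ℝ≥0) (f : ℕ → ℝ≥0∞) :
    ∫⁻ n, (n : ℝ≥0∞) * f n ∂(poissonMeasure r) = r * ∫⁻ n, f (n + 1) ∂(poissonMeasure r) := by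
  rw [poissonMeasure, lintegral_sum_measure, lintegral_sum_measure]
  simp only [lintegral_smul_measure, lintegral_dirac]
  rw [tsum_eq_zero_add' ENNReal.summable, ← ENNReal.tsum_mul_left]
  simp only [Nat.cast_zero, zero_mul, smul_zero, zero_add]
  refine tsum_congr fun n => ?_
  have h1 : ENNReal.ofReal (Real.exp (-r) * r ^ (n + 1) / ((n + 1).factorial : ℝ)) * ((n + 1 : ℕ) : ℝ≥0∞)
      = r * ENNReal.ofReal (Real.exp (-r) * r ^ n / (n.factorial : ℝ)) := by
    have h2 : ((n + 1 : ℕ) : ℝ≥0∞) = ENNReal.ofReal ((n + 1 : ℕ) : ℝ) := by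
      rw [ENNReal.ofReal_natCast]
    have h3 : (r : ℝ≥0∞) = ENNReal.ofReal (r : ℝ) := by rw [ENNReal.ofReal_coe_nnreal]
    rw [h2, h3, ← ENNReal.ofReal_mul (by positivity), ← ENNReal.ofReal_mul (by positivity)]
    congr 1
    rw [Nat.factorial_succ]
    push_cast
    field_simp
    ring
  simp only [smul_eq_mul]
  rw [← mul_assoc, h1, mul_assoc]

theorem lintegral_natCast_poissonMeasure (r : ℝ≥0) :
    ∫⁻ n, (n : ℝ≥0∞) ∂(poissonMeasure r) = r := by
  simpa using lintegral_natCast_mul_poissonMeasure r fun _ => 1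

theorem lintegral_natCast_sq_poissonMeasure (r : ℝ≥0) :
    ∫⁻ n, (n : ℝ≥0∞) * n ∂(poissonMeasure r) = r * r + r := by
  rw [lintegral_natCast_mul_poissonMeasure r fun n => (n : ℝ≥0∞)]
  simp only [Nat.cast_add, Nat.cast_one]
  rw [lintegral_add_right _ measurable_const, lintegral_natCast_poissonMeasure, lintegral_const,
    measure_univ, mul_one, mul_add, mul_one]

variable {Ω : Type*} {mΩ : MeasurableSpace Ω} {μ : Measure Ω} {ν : Measure ℝ}
  {P : Ω → Measure (ℝ × ℝ × ℝ)}

theorem IsPoissonRandomMeasure.measurable_apply (hP : IsPoissonRandomMeasure ν P μ)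
    {A : Set (ℝ × ℝ × ℝ)} (hA : MeasurableSet A) : Measurable fun ω => P ω A :=
  (Measure.measurable_coe hA).comp hP.measurable

theorem IsPoissonRandomMeasure.lintegral_comp (hP : IsPoissonRandomMeasure ν P μ)
    {A : Set (ℝ × ℝ × ℝ)} (hA : MeasurableSet A) (hA' : pointIntensity ν A < ∞)
    {f : ℝ≥0∞ → ℝ≥0∞} (hf : Measurable f) :
    ∫⁻ ω, f (P ω A) ∂μ = ∫⁻ n, f n ∂(poissonMeasure (pointIntensity ν A).toNNReal) := by
  rw [← lintegral_map hf (hP.measurable_apply hA), hP.law A hA hA', lintegral_map hf (by fun_prop)]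

theorem IsPoissonRandomMeasure.lintegral_apply (hP : IsPoissonRandomMeasure ν P μ)
    {A : Set (ℝ × ℝ × ℝ)} (hA : MeasurableSet A) (hA' : pointIntensity ν A < ∞) :
    ∫⁻ ω, P ω A ∂μ = pointIntensity ν A := by
  rw [hP.lintegral_comp (f := fun x => x) hA hA' measurable_id,
    lintegral_natCast_poissonMeasure, ENNReal.coe_toNNReal hA'.ne]

theorem IsPoissonRandomMeasure.lintegral_apply_sq (hP : IsPoissonRandomMeasure ν P μ)
    {A : Set (ℝ × ℝ × ℝ)} (hA : MeasurableSet A) (hA' : pointIntensity ν A < ∞) :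
    ∫⁻ ω, P ω A * P ω A ∂μ
      = pointIntensity ν A * pointIntensity ν A + pointIntensity ν A := by
  rw [hP.lintegral_comp (f := fun x => x * x) hA hA' (by fun_prop),
    lintegral_natCast_sq_poissonMeasure, ENNReal.coe_toNNReal hA'.ne]

/-- The counts over the sets contained in `D` and the counts over the sets contained in a disjoint
set `D'` are independent. -/
theorem IsPoissonRandomMeasure.indepFun_process [IsProbabilityMeasure μ]
    (hP : IsPoissonRandomMeasure ν P μ) {D D' : Set (ℝ × ℝ × ℝ)} (hD : Disjoint D D') :
    IndepFun (fun ω (A : {A : Set (ℝ × ℝ × ℝ) // MeasurableSet A ∧ A ⊆ D}) => P ω A)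
      (fun ω (A : {A : Set (ℝ × ℝ × ℝ) // MeasurableSet A ∧ A ⊆ D'}) => P ω A) μ := by
  classical
  refine IndepFun.process_indepFun_process (fun A => hP.measurable_apply A.2.1)
    (fun A => hP.measurable_apply A.2.1) fun I J => ?_
  let E : I ⊕ J → Set (ℝ × ℝ × ℝ) := Sum.elim (fun i => i.1.1) (fun j => j.1.1)
  have hE : ∀ i, MeasurableSet (E i) := by
    rintro (i | j)
    · exact i.1.2.1
    · exact j.1.2.1
  -- The cells of the Boolean algebra generated by the finitely many sets. They are pairwise
  -- disjoint, so the independence axiom applies to them, and each original count is a sum of cell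
  -- counts.
  let C : (I ⊕ J → Bool) → Set (ℝ × ℝ × ℝ) := fun σ => {z | ∀ i, z ∈ E i ↔ σ i = true}
  have hCE : ∀ σ, C σ = ⋂ i, if σ i = true then E i else (E i)ᶜ := by
    intro σ
    ext z
    simp only [C, mem_iInter, mem_ofPred_eq]
    refine forall_congr' fun i => ?_
    split_ifs with h <;> simp [h]
  have hC : ∀ σ, MeasurableSet (C σ) := by
    intro σ
    rw [hCE]
    refine MeasurableSet.iInter fun i => ?_
    split_ifs
    · exact hE i
    · exact (hE i).compl
  have hdisj : Pairwise fun σ τ => Disjoint (C σ) (C τ) := by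
    intro σ τ hst
    refine Set.disjoint_left.2 fun z hz hz' => hst ?_
    funext i
    have := (hz i).symm.trans (hz' i)
    exact Bool.eq_iff_iff.2 this
  let e := Fintype.equivFin (I ⊕ J → Bool)
  have hind : iIndepFun (fun σ ω => P ω (C σ)) μ := by
    have h := hP.indep _ (fun k => C (e.symm k)) (fun k => hC _)
      (fun k l hkl => hdisj (e.symm.injective.ne hkl))
    have h2 := h.precomp (g := e) e.injective
    simpa [Function.comp_def] using h2
  -- The cells inside some set of the first family. The complementary cells suffice for the second
  -- family, because a cell lying in sets of both families is empty.
  let S : Finset (I ⊕ J → Bool) := Finset.univ.filter fun σ => ∃ i, σ (Sum.inl i) = true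
  have hkey := hind.indepFun_finset S Sᶜ disjoint_compl_right fun σ => hP.measurable_apply (hC σ)
  have hsum : ∀ (ω : Ω) (i : I ⊕ J), P ω (E i) = ∑ σ ∈ Finset.univ.filter (fun σ => σ i = true),
      P ω (C σ) := by
    intro ω i
    rw [← measure_biUnion_finset (fun σ _ τ _ h => hdisj h) fun σ _ => hC σ]
    congr 1
    ext z
    simp only [Finset.mem_filter, Finset.mem_univ, true_and, mem_iUnion, exists_prop]
    constructor
    · intro hz
      refine ⟨fun j => decide (z ∈ E j), by simpa using hz, fun j => by simp⟩
    · rintro ⟨σ, hσ, hz⟩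
      exact (hz i).2 hσ
  have h1 : ∀ (ω : Ω) (i : I), P ω (i.1 : Set (ℝ × ℝ × ℝ))
      = ∑ σ : S, if σ.1 (Sum.inl i) = true then P ω (C σ) else 0 := by
    intro ω i
    rw [Finset.sum_coe_sort S (fun σ => if σ (Sum.inl i) = true then P ω (C σ) else 0),
      ← Finset.sum_filter, show P ω (i.1 : Set (ℝ × ℝ × ℝ)) = _ from hsum ω (Sum.inl i)]
    refine Finset.sum_congr ?_ fun _ _ => rfl
    ext σ
    simp only [S, Finset.mem_filter, Finset.mem_univ, true_and]
    exact ⟨fun h => ⟨⟨i, h⟩, h⟩, fun h => h.2⟩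
  have h2 : ∀ (ω : Ω) (j : J), P ω (j.1 : Set (ℝ × ℝ × ℝ))
      = ∑ σ : (Sᶜ : Finset _), if σ.1 (Sum.inr j) = true then P ω (C σ) else 0 := by
    intro ω j
    rw [Finset.sum_coe_sort Sᶜ (fun σ => if σ (Sum.inr j) = true then P ω (C σ) else 0),
      show P ω (j.1 : Set (ℝ × ℝ × ℝ)) = _ from hsum ω (Sum.inr j), Finset.sum_filter,
      ← Finset.sum_add_sum_compl S]
    convert! zero_add _
    refine Finset.sum_eq_zero fun σ hσ => ?_
    split_ifs with h
    · obtain ⟨i, hi⟩ : ∃ i, σ (Sum.inl i) = true := by simpa [S] using hσ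
      have : C σ = ∅ := by
        refine Set.eq_empty_of_forall_notMem fun z hz => ?_
        exact Set.disjoint_left.1 hD (i.1.2.2 ((hz (Sum.inl i)).2 hi))
          (j.1.2.2 ((hz (Sum.inr j)).2 h))
      simp [this]
    · rfl
  have h3 := hkey.comp
    (φ := fun (x : S → ℝ≥0∞) (i : I) => ∑ σ : S, if σ.1 (Sum.inl i) = true then x σ else 0)
    (ψ := fun (x : (Sᶜ : Finset _) → ℝ≥0∞) (j : J) =>
      ∑ σ : (Sᶜ : Finset _), if σ.1 (Sum.inr j) = true then x σ else 0)
    (by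
      refine measurable_pi_lambda _ fun i => Finset.measurable_sum _ fun σ _ => ?_
      split_ifs <;> fun_prop)
    (by
      refine measurable_pi_lambda _ fun i => Finset.measurable_sum _ fun σ _ => ?_
      split_ifs <;> fun_prop)
  convert! h3 using 1
  · funext ω i
    exact h1 ω i
  · funext ω j
    exact h2 ω j

/-- Split A and B along A ∩ B. Products of counts over disjoint pieces factor by independence; the
square of the count over A ∩ B contributes the extra first-order term of a Poisson second moment. -/
theorem IsPoissonRandomMeasure.lintegral_mul [IsProbabilityMeasure μ]
    (hP : IsPoissonRandomMeasure ν P μ)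
    {A B : Set (ℝ × ℝ × ℝ)} (hA : MeasurableSet A) (hB : MeasurableSet B)
    (hA' : pointIntensity ν A < ∞) (hB' : pointIntensity ν B < ∞) :
    ∫⁻ ω, P ω A * P ω B ∂μ
      = pointIntensity ν A * pointIntensity ν B + pointIntensity ν (A ∩ B) := by
  have hdis : ∀ {A B : Set (ℝ × ℝ × ℝ)}, MeasurableSet A → MeasurableSet B →
      pointIntensity ν A < ∞ → pointIntensity ν B < ∞ → Disjoint A B →
      ∫⁻ ω, P ω A * P ω B ∂μ = pointIntensity ν A * pointIntensity ν B := by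
    intro A B hA hB hA' hB' hAB
    have eval : ∀ C : Set (ℝ × ℝ × ℝ), (hC : MeasurableSet C) → Measurable
        fun x : {E : Set (ℝ × ℝ × ℝ) // MeasurableSet E ∧ E ⊆ C} → ℝ≥0∞ => x ⟨C, hC, subset_rfl⟩ :=
      fun C hC => measurable_pi_apply _
    have h := (hP.indepFun_process hAB).comp (eval A hA) (eval B hB)
    rw [← hP.lintegral_apply hA hA', ← hP.lintegral_apply hB hB']
    exact lintegral_mul_eq_lintegral_mul_lintegral_of_indepFun (hP.measurable_apply hA)
      (hP.measurable_apply hB) h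
  set m := pointIntensity ν
  have hI : m (A ∩ B) < ∞ := (measure_mono inter_subset_left).trans_lt hA'
  have hAd : m (A \ B) < ∞ := (measure_mono sdiff_subset).trans_lt hA'
  have hBd : m (B \ A) < ∞ := (measure_mono sdiff_subset).trans_lt hB'
  have hAs : ∀ π : Measure (ℝ × ℝ × ℝ), π A = π (A ∩ B) + π (A \ B) :=
    fun π => (measure_inter_add_sdiff A hB).symm
  have hBs : ∀ π : Measure (ℝ × ℝ × ℝ), π B = π (A ∩ B) + π (B \ A) := fun π => by
    rw [inter_comm]; exact (measure_inter_add_sdiff B hA).symm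
  have hexp : ∀ π : Measure (ℝ × ℝ × ℝ), π A * π B = π (A ∩ B) * π (A ∩ B)
      + π (A ∩ B) * π (B \ A) + π (A \ B) * π (A ∩ B) + π (A \ B) * π (B \ A) := fun π => by
    rw [hAs π, hBs π]; ring
  have mI := hP.measurable_apply (hA.inter hB)
  have mA := hP.measurable_apply (hA.diff hB)
  have mB := hP.measurable_apply (hB.diff hA)
  simp only [hexp]
  rw [lintegral_add_left (by fun_prop), lintegral_add_left (by fun_prop),
    lintegral_add_left (by fun_prop), hP.lintegral_apply_sq (hA.inter hB) hI,
    hdis (hA.inter hB) (hB.diff hA) hI hBd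
      (Set.disjoint_left.2 fun z hz hz' => hz'.2 hz.1),
    hdis (hA.diff hB) (hA.inter hB) hAd hI
      (Set.disjoint_left.2 fun z hz hz' => hz.2 hz'.2),
    hdis (hA.diff hB) (hB.diff hA) hAd hBd
      (Set.disjoint_left.2 fun z hz hz' => hz'.2 hz.1)]
  ring

/-- A functional of the counts over sets of points later than `t` is independent of `ℱ_t`. -/
theorem IsPoissonRandomMeasure.lintegral_mul_of_future [IsProbabilityMeasure μ]
    (hP : IsPoissonRandomMeasure ν P μ) (t : ℝ≥0) {f : Ω → ℝ≥0∞}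
    (hf : Measurable[poissonFiltration P hP.measurable t] f)
    {A B : Set (ℝ × ℝ × ℝ)} (hA : MeasurableSet A) (hB : MeasurableSet B)
    (hA' : A ⊆ Ioi (t : ℝ) ×ˢ univ) (hB' : B ⊆ Ioi (t : ℝ) ×ˢ univ)
    {g : ℝ≥0∞ × ℝ≥0∞ → ℝ≥0∞} (hg : Measurable g) :
    ∫⁻ ω, f ω * g (P ω A, P ω B) ∂μ = (∫⁻ ω, f ω ∂μ) * ∫⁻ ω, g (P ω A, P ω B) ∂μ := by
  have hdis : Disjoint (Ioc 0 (t : ℝ) ×ˢ (univ : Set (ℝ × ℝ))) (Ioi (t : ℝ) ×ˢ univ) :=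
    Set.disjoint_left.2 fun z hz hz' => not_lt.2 hz.1.2 hz'.1
  have hind := hP.indepFun_process hdis
  -- Every generator of ℱ_t is a count over a subset of (0,t] × ℝ × ℝ, so ℱ_t lies in the σ-algebra
  -- of the counts over past sets.
  have hle : poissonFiltration P hP.measurable t ≤ MeasurableSpace.comap
      (fun ω (A : {A : Set (ℝ × ℝ × ℝ) // MeasurableSet A ∧ A ⊆ Ioc 0 (t : ℝ) ×ˢ univ}) => P ω A)
      inferInstance := by
    refine MeasurableSpace.generateFrom_le ?_
    rintro _ ⟨C, S, U, hC, hCt, hS, -, hU, rfl⟩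
    exact ⟨(fun x => x ⟨C ×ˢ S, hC.prod hS, prod_mono hCt (subset_univ _)⟩) ⁻¹' U,
      measurable_pi_apply _ hU, rfl⟩
  refine lintegral_mul_eq_lintegral_mul_lintegral_of_independent_measurableSpace
    (measurable_pi_lambda _ fun A => hP.measurable_apply A.2.1).comap_le
    (measurable_pi_lambda _ fun A => hP.measurable_apply A.2.1).comap_le hind
    (hf.mono hle le_rfl) ?_
  have hAB : Measurable
      fun x : {C : Set (ℝ × ℝ × ℝ) // MeasurableSet C ∧ C ⊆ Ioi (t : ℝ) ×ˢ univ} → ℝ≥0∞ =>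
        (x ⟨A, hA, hA'⟩, x ⟨B, hB, hB'⟩) := (measurable_pi_apply _).prodMk (measurable_pi_apply _)
  exact (hg.comp hAB).comp (comap_measurable _)

end HawkesRisk

/-! ### S-finite kernels, and windows exhausting positive times and nonnegative levels -/

namespace HawkesRisk

/-- A kernel which is finite on each set of a countable measurable cover is s-finite. -/
theorem isSFiniteKernel_of_cover {α β : Type*} {mα : MeasurableSpace α} {mβ : MeasurableSpace β}
    (κ : Kernel α β) (W : ℕ → Set β) (hW : ∀ n, MeasurableSet (W n))
    (hcover : ∀ a, κ a (⋃ n, W n)ᶜ = 0) (hfin : ∀ a n, κ a (W n) < ∞) : IsSFiniteKernel κ := by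
  classical
  have hD : ∀ n, MeasurableSet (disjointed W n) := fun n => MeasurableSet.disjointed hW n
  have hDfin : ∀ a n, κ a (disjointed W n) < ∞ := fun a n =>
    (measure_mono (disjointed_subset W n)).trans_lt (hfin a n)
  -- A finite kernel needs a bound uniform in a, while κ a (W n) is only finite for each a. Cutting
  -- the parameter space by the integer part of the mass makes each piece bounded by j + 1.
  let S : ℕ → ℕ → Set α := fun n j => {a | κ a (disjointed W n) ∈ Ico (j : ℝ≥0∞) (j + 1)}
  have hS : ∀ n j, MeasurableSet (S n j) := fun n j =>
    Kernel.measurable_coe κ (hD n) measurableSet_Ico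
  let η : ℕ → ℕ → Kernel α β := fun n j => Kernel.piecewise (hS n j) (κ.restrict (hD n)) 0
  have hη : ∀ n j, IsFiniteKernel (η n j) := fun n j => by
    refine ⟨(j : ℝ≥0∞) + 1, by simp, fun a => ?_⟩
    simp only [η, Kernel.piecewise_apply]
    split_ifs with h
    · rw [Kernel.restrict_apply, Measure.restrict_apply_univ]
      exact h.2.le
    · simp
  have : κ = Kernel.sum fun n => Kernel.sum (η n) := by
    ext a s hs
    simp only [Kernel.sum_apply' _ _ hs]
    have h1 : ∀ n, ∑' j, η n j a s = κ a (s ∩ disjointed W n) := by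
      intro n
      have hex : ∃ j : ℕ, a ∈ S n j := by
        refine ⟨⌊(κ a (disjointed W n)).toReal⌋₊, ?_, ?_⟩
        · rw [← ENNReal.ofReal_toReal (hDfin a n).ne, ← ENNReal.ofReal_natCast]
          rw [ENNReal.toReal_ofReal ENNReal.toReal_nonneg]
          exact ENNReal.ofReal_le_ofReal (Nat.floor_le ENNReal.toReal_nonneg)
        · rw [← ENNReal.toReal_lt_toReal (hDfin a n).ne (by simp)]
          rw [ENNReal.toReal_add (by simp) (by simp)]
          simpa using Nat.lt_floor_add_one (κ a (disjointed W n)).toReal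
      obtain ⟨j, hj⟩ := hex
      rw [tsum_eq_single j]
      · simp only [η, Kernel.piecewise_apply, if_pos hj, Kernel.restrict_apply,
          Measure.restrict_apply hs]
      · intro i hij
        have hi : a ∉ S n i := by
          intro hi
          apply hij
          have h2 : (i : ℝ≥0∞) < (j : ℝ≥0∞) + 1 := hi.1.trans_lt hj.2
          have h3 : (j : ℝ≥0∞) < (i : ℝ≥0∞) + 1 := hj.1.trans_lt hi.2
          norm_cast at h2 h3
          omega
        simp [η, Kernel.piecewise_apply, hi]
    simp only [h1]
    rw [← measure_iUnion (fun i j hij => ((disjoint_disjointed W) hij).mono inter_subset_right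
      inter_subset_right) fun n => hs.inter (hD n), ← inter_iUnion, iUnion_disjointed]
    refine le_antisymm ?_ (measure_mono inter_subset_left)
    calc κ a s ≤ κ a (s ∩ ⋃ n, W n) + κ a (⋃ n, W n)ᶜ := by
          refine (measure_mono ?_).trans (measure_union_le _ _)
          intro x hx
          by_cases h : x ∈ ⋃ n, W n
          · exact Or.inl ⟨hx, h⟩
          · exact Or.inr h
      _ = _ := by rw [hcover, add_zero]
  rw [this]
  have : ∀ n j, IsSFiniteKernel (η n j) := fun n j => inferInstance
  exact Kernel.isSFiniteKernel_sum

/-- Positive times and nonnegative levels. -/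
def domain : Set (ℝ × ℝ × ℝ) := Ioi 0 ×ˢ (Ici 0 ×ˢ univ)

/-- Times in `(0,n]` and levels in `[0,n]`. -/
def window (n : ℕ) : Set (ℝ × ℝ × ℝ) := Ioc 0 (n : ℝ) ×ˢ (Icc 0 (n : ℝ) ×ˢ univ)

theorem measurableSet_domain : MeasurableSet domain :=
  measurableSet_Ioi.prod (measurableSet_Ici.prod MeasurableSet.univ)

theorem measurableSet_window (n : ℕ) : MeasurableSet (window n) :=
  measurableSet_Ioc.prod (measurableSet_Icc.prod MeasurableSet.univ)

theorem window_subset_domain (n : ℕ) : window n ⊆ domain :=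
  prod_mono Ioc_subset_Ioi_self (prod_mono Icc_subset_Ici_self subset_rfl)

theorem monotone_window : Monotone window := fun m n h => by
  have : (m : ℝ) ≤ n := by exact_mod_cast h
  exact prod_mono (Ioc_subset_Ioc_right this) (prod_mono (Icc_subset_Icc_right this) subset_rfl)

theorem iUnion_window : ⋃ n, window n = domain := by
  refine subset_antisymm (iUnion_subset window_subset_domain) fun z hz => ?_
  obtain ⟨n, hn⟩ := exists_nat_ge (max z.1 z.2.1)
  exact mem_iUnion.2 ⟨n, ⟨hz.1, (le_max_left _ _).trans hn⟩,
    ⟨hz.2.1, (le_max_right _ _).trans hn⟩, trivial⟩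

theorem pointIntensity_prod (ν : Measure ℝ) [IsProbabilityMeasure ν] (A B C : Set ℝ) :
    pointIntensity ν (A ×ˢ (B ×ˢ C))
      = volume.restrict (Ici (0 : ℝ)) A * (volume.restrict (Ici (0 : ℝ)) B * ν C) := by
  rw [pointIntensity, Measure.prod_prod, Measure.prod_prod]

theorem pointIntensity_window_lt_top (ν : Measure ℝ) [IsProbabilityMeasure ν] (n : ℕ) :
    pointIntensity ν (window n) < ∞ := by
  rw [window, pointIntensity_prod]
  refine ENNReal.mul_lt_top ?_ (ENNReal.mul_lt_top ?_ (by simp))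
  · exact (Measure.restrict_apply_le _ _).trans_lt (by simp)
  · exact (Measure.restrict_apply_le _ _).trans_lt (by simp)

instance (ν : Measure ℝ) [IsProbabilityMeasure ν] : SFinite (pointIntensity ν) := by
  unfold pointIntensity; infer_instance

/-! ### The predictable σ-algebra and determination of measures on it -/

section Predictable

variable {Ω : Type*} {mΩ : MeasurableSpace Ω}

/-- `ℝ₊ × Ω` with the predictable σ-algebra. -/
def PredSpace (_ : Filtration ℝ≥0 mΩ) : Type _ := ℝ≥0 × Ω

/-- The type synonym lets the predictable σ-algebra coexist with the product σ-algebra that `ℝ≥0 ×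
Ω` receives by inference. -/
instance (𝓕 : Filtration ℝ≥0 mΩ) : MeasurableSpace (PredSpace 𝓕) := 𝓕.predictable

/-- The point of `PredSpace 𝓕` with time `t` and outcome `ω`. -/
def PredSpace.mk (𝓕 : Filtration ℝ≥0 mΩ) (t : ℝ≥0) (ω : Ω) : PredSpace 𝓕 := (t, ω)

theorem PredSpace.measurable_mk (𝓕 : Filtration ℝ≥0 mΩ) :
    Measurable fun p : ℝ≥0 × Ω => PredSpace.mk 𝓕 p.1 p.2 := by
  refine measurable_generateFrom ?_
  rintro _ (⟨A, hA, rfl⟩ | ⟨i, A, hA, rfl⟩)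
  · exact (measurableSet_singleton _).prod (𝓕.le _ _ hA)
  · exact measurableSet_Ioi.prod (𝓕.le _ _ hA)

/-- The predictable base point, the level and the mark of a point of the configuration. -/
def predPoint (𝓕 : Filtration ℝ≥0 mΩ) (p : Ω × ℝ × ℝ × ℝ) : PredSpace 𝓕 × ℝ × ℝ :=
  (PredSpace.mk 𝓕 p.2.1.toNNReal p.1, p.2.2)

theorem measurable_predPoint (𝓕 : Filtration ℝ≥0 mΩ) : Measurable (predPoint 𝓕) := by
  refine Measurable.prodMk ?_ (by fun_prop)
  exact (PredSpace.measurable_mk 𝓕).comp (f := fun p : Ω × ℝ × ℝ × ℝ => (p.2.1.toNNReal, p.1))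
    (by fun_prop)

/-- The set `(t, ∞) × F` of `PredSpace 𝓕`. -/
def PredSpace.box (𝓕 : Filtration ℝ≥0 mΩ) (t : ℝ≥0) (F : Set Ω) : Set (PredSpace 𝓕) :=
  Ioi t ×ˢ F

theorem PredSpace.measurableSet_box {𝓕 : Filtration ℝ≥0 mΩ} {t : ℝ≥0} {F : Set Ω}
    (hF : MeasurableSet[𝓕 t] F) : MeasurableSet (PredSpace.box 𝓕 t F) :=
  measurableSet_predictable_Ioi_prod hF

theorem isPiSystem_predictable (𝓕 : Filtration ℝ≥0 mΩ) :
    IsPiSystem ({s | ∃ A, MeasurableSet[𝓕 ⊥] A ∧ s = {⊥} ×ˢ A} ∪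
      {s | ∃ i A, MeasurableSet[𝓕 i] A ∧ s = Set.Ioi i ×ˢ A}) := by
  rintro _ (⟨A, hA, rfl⟩ | ⟨i, A, hA, rfl⟩) _ (⟨B, hB, rfl⟩ | ⟨j, B, hB, rfl⟩) hne
  · exact Or.inl ⟨A ∩ B, hA.inter hB, by rw [prod_inter_prod, inter_self]⟩
  · obtain ⟨x, hx, hx'⟩ := hne
    have : x.1 = ⊥ := hx.1
    exact absurd hx'.1 (by rw [this]; simp)
  · obtain ⟨x, hx, hx'⟩ := hne
    have : x.1 = ⊥ := hx'.1
    exact absurd hx.1 (by rw [this]; simp)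
  · refine Or.inr ⟨max i j, A ∩ B, (𝓕.mono (le_max_left _ _) _ hA).inter
      (𝓕.mono (le_max_right _ _) _ hB), ?_⟩
    rw [prod_inter_prod, Ioi_inter_Ioi]

/-- Two finite measures on `PredSpace 𝓕 × E` which do not charge time `0` agree if they agree on
the products `(t, ∞) × F × S` with `F ∈ 𝓕 t`. -/
theorem ext_predictable {𝓕 : Filtration ℝ≥0 mΩ} {E : Type*} [MeasurableSpace E]
    {Q Q' : Measure (PredSpace 𝓕 × E)} [IsFiniteMeasure Q] [IsFiniteMeasure Q']
    (h0 : Q ((PredSpace.box 𝓕 0 univ)ᶜ ×ˢ univ) = 0)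
    (h0' : Q' ((PredSpace.box 𝓕 0 univ)ᶜ ×ˢ univ) = 0)
    (h : ∀ (t : ℝ≥0) (F : Set Ω) (S : Set E), MeasurableSet[𝓕 t] F → MeasurableSet S →
      Q (PredSpace.box 𝓕 t F ×ˢ S) = Q' (PredSpace.box 𝓕 t F ×ˢ S)) : Q = Q' := by
  refine Measure.ext_prod_iff.2 fun {B S} hB hS => ?_
  -- With S fixed, both sides are finite measures of the predictable coordinate alone, so they need
  -- only be compared on the generating π-system and on the whole space.
  have key : (Q.restrict (univ ×ˢ S)).map Prod.fst = (Q'.restrict (univ ×ˢ S)).map Prod.fst := by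
    have hev : ∀ (R : Measure (PredSpace 𝓕 × E)) (C : Set (PredSpace 𝓕)), MeasurableSet C →
        (R.restrict (univ ×ˢ S)).map Prod.fst C = R (C ×ˢ S) := by
      intro R C hC
      rw [Measure.map_apply measurable_fst hC, Measure.restrict_apply (measurable_fst hC)]
      congr 1
      ext x; simp
    -- The generators at time 0 carry no mass, so the hypothesis about (t,∞) × F covers the whole
    -- π-system.
    have hz : ∀ (R : Measure (PredSpace 𝓕 × E)),
        R ((PredSpace.box 𝓕 0 univ)ᶜ ×ˢ univ) = 0 →
        ∀ A : Set Ω, R (({x | x.1 = ⊥ ∧ x.2 ∈ A} : Set (PredSpace 𝓕)) ×ˢ S) = 0 := by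
      intro R hR A
      refine measure_mono_null (prod_mono ?_ (subset_univ _)) hR
      rintro x hx hx'
      have h1 : x.1 = ⊥ := hx.1
      have h2 : (0 : ℝ≥0) < x.1 := hx'.1
      rw [h1] at h2
      exact lt_irrefl _ h2
    have hbox : ∀ R : Measure (PredSpace 𝓕 × E), R ((PredSpace.box 𝓕 0 univ)ᶜ ×ˢ univ) = 0 →
        R (univ ×ˢ S) = R (PredSpace.box 𝓕 0 univ ×ˢ S) := by
      intro R hR
      refine le_antisymm ?_ (measure_mono (prod_mono (subset_univ _) subset_rfl))
      calc R (univ ×ˢ S) ≤ R (PredSpace.box 𝓕 0 univ ×ˢ S)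
            + R ((PredSpace.box 𝓕 0 univ)ᶜ ×ˢ univ) := by
            refine (measure_mono ?_).trans (measure_union_le _ _)
            rintro x ⟨-, hx⟩
            by_cases hx' : x.1 ∈ PredSpace.box 𝓕 0 univ
            · exact Or.inl ⟨hx', hx⟩
            · exact Or.inr ⟨hx', trivial⟩
        _ = _ := by rw [hR, add_zero]
    refine ext_of_generate_finite _ rfl (isPiSystem_predictable 𝓕) ?_ ?_
    · rintro C (⟨A, hA, rfl⟩ | ⟨i, A, hA, rfl⟩)
      · have hm := measurableSet_predictable_singleton_bot_prod hA
        erw [hev _ _ hm, hev _ _ hm]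
        have e : ({⊥} ×ˢ A : Set (ℝ≥0 × Ω))
          = ({x | x.1 = ⊥ ∧ x.2 ∈ A} : Set (PredSpace 𝓕)) := rfl
        erw [e, hz Q h0 A, hz Q' h0' A]
      · have hm := PredSpace.measurableSet_box hA
        erw [hev _ _ hm, hev _ _ hm]
        exact h i A S hA hS
    · rw [hev _ _ MeasurableSet.univ, hev _ _ MeasurableSet.univ, hbox Q h0, hbox Q' h0']
      exact h 0 univ S MeasurableSet.univ hS
  have := congrArg (fun R => R B) key
  simp only [Measure.map_apply measurable_fst hB, Measure.restrict_apply (measurable_fst hB)] at this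
  convert this using 2 <;> · ext x; simp

end Predictable

/-! ### The Poisson measure as a kernel, and its restriction to windows -/

variable {Ω : Type*} {mΩ : MeasurableSpace Ω} {μ : Measure Ω} {ν : Measure ℝ}
  {P : Ω → Measure (ℝ × ℝ × ℝ)}

theorem IsPoissonRandomMeasure.window_lt_top (hP : IsPoissonRandomMeasure ν P μ) (ω : Ω) (n : ℕ) :
    P ω (window n) < ∞ :=
  (measure_mono (prod_mono Ioc_subset_Icc_self subset_rfl)).trans_lt (hP.locallyFinite ω n n)

/-- The random measure on positive times and nonnegative levels, as a kernel. -/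
noncomputable def IsPoissonRandomMeasure.kernel (hP : IsPoissonRandomMeasure ν P μ) :
    Kernel Ω (ℝ × ℝ × ℝ) :=
  Kernel.restrict ⟨P, hP.measurable⟩ measurableSet_domain

theorem IsPoissonRandomMeasure.kernel_apply (hP : IsPoissonRandomMeasure ν P μ) (ω : Ω) :
    hP.kernel ω = (P ω).restrict domain := rfl

instance (hP : IsPoissonRandomMeasure ν P μ) : IsSFiniteKernel hP.kernel := by
  refine isSFiniteKernel_of_cover _ window measurableSet_window (fun ω => ?_) fun ω n => ?_
  · rw [iUnion_window, hP.kernel_apply, Measure.restrict_apply measurableSet_domain.compl,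
      compl_inter_self, measure_empty]
  · exact (Measure.restrict_apply_le _ _).trans_lt (hP.window_lt_top ω n)

/-- The random measure on the `n`-th window, as a kernel. -/
noncomputable def IsPoissonRandomMeasure.windowKernel (hP : IsPoissonRandomMeasure ν P μ) (n : ℕ) :
    Kernel Ω (ℝ × ℝ × ℝ) :=
  hP.kernel.restrict (measurableSet_window n)

theorem IsPoissonRandomMeasure.windowKernel_apply (hP : IsPoissonRandomMeasure ν P μ) (n : ℕ)
    (ω : Ω) : hP.windowKernel n ω = (P ω).restrict (window n) := by
  rw [windowKernel, Kernel.restrict_apply, hP.kernel_apply,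
    Measure.restrict_restrict_of_subset (window_subset_domain n)]

instance (hP : IsPoissonRandomMeasure ν P μ) (n : ℕ) : IsSFiniteKernel (hP.windowKernel n) := by
  unfold IsPoissonRandomMeasure.windowKernel; infer_instance

/-- The intensity on the `n`-th window. -/
noncomputable def windowIntensity (ν : Measure ℝ) (n : ℕ) : Measure (ℝ × ℝ × ℝ) :=
  (pointIntensity ν).restrict (window n)

instance (ν : Measure ℝ) [IsProbabilityMeasure ν] (n : ℕ) : IsFiniteMeasure (windowIntensity ν n) :=
  ⟨by rw [windowIntensity, Measure.restrict_apply_univ]; exact pointIntensity_window_lt_top ν n⟩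

/-- The points of the window after time `t` with level and mark in `S`. -/
def windowAfter (n : ℕ) (t : ℝ≥0) (S : Set (ℝ × ℝ)) : Set (ℝ × ℝ × ℝ) :=
  Ioc (t : ℝ) n ×ˢ (S ∩ Icc 0 (n : ℝ) ×ˢ univ)

theorem measurableSet_windowAfter (n : ℕ) (t : ℝ≥0) {S : Set (ℝ × ℝ)} (hS : MeasurableSet S) :
    MeasurableSet (windowAfter n t S) :=
  measurableSet_Ioc.prod (hS.inter (measurableSet_Icc.prod MeasurableSet.univ))

theorem windowAfter_subset (n : ℕ) (t : ℝ≥0) (S : Set (ℝ × ℝ)) : windowAfter n t S ⊆ window n :=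
  prod_mono (Ioc_subset_Ioc_left t.2) inter_subset_right

/-- This reduces predictable rectangles to counts over points after t, which are independent of the
event F when F lies in ℱ_t. -/
theorem restrict_window_section {𝓕 : Filtration ℝ≥0 mΩ} (π : Measure (ℝ × ℝ × ℝ)) (n : ℕ)
    (t : ℝ≥0) (F : Set Ω) (S : Set (ℝ × ℝ)) (ω : Ω) :
    π.restrict (window n) {z | predPoint 𝓕 (ω, z) ∈ PredSpace.box 𝓕 t F ×ˢ S}
      = F.indicator (fun _ => π (windowAfter n t S)) ω := by
  have hset : {z | predPoint 𝓕 (ω, z) ∈ PredSpace.box 𝓕 t F ×ˢ S}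
      = {z | ω ∈ F ∧ (t : ℝ) < z.1 ∧ z.2 ∈ S} := by
    ext z
    change ((t < z.1.toNNReal ∧ ω ∈ F) ∧ z.2 ∈ S) ↔ _
    rw [Real.lt_toNNReal_iff_coe_lt, mem_ofPred_eq]
    tauto
  rw [hset, Measure.restrict_apply' (measurableSet_window n)]
  by_cases hω : ω ∈ F
  · rw [indicator_of_mem hω]
    congr 1
    ext z
    simp only [hω, window, windowAfter, mem_inter_iff, mem_ofPred_eq, mem_prod, mem_Ioc, true_and]
    have := t.2
    constructor
    · rintro ⟨⟨h1, h2⟩, h3, h4⟩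
      exact ⟨⟨h1, h3.2⟩, h2, h4⟩
    · rintro ⟨⟨h1, h3⟩, h2, h4⟩
      exact ⟨⟨h1, h2⟩, ⟨lt_of_le_of_lt t.2 h1, h3⟩, h4⟩
  · simp [hω]

end HawkesRisk

/-! ### The compensation formula, and the measures of pairs of points -/

namespace HawkesRisk

variable {Ω : Type*} {mΩ : MeasurableSpace Ω} {μ : Measure Ω} {ν : Measure ℝ}
  {P : Ω → Measure (ℝ × ℝ × ℝ)}

theorem pointIntensity_windowAfter_lt_top [IsProbabilityMeasure ν] (n : ℕ) (t : ℝ≥0)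
    (S : Set (ℝ × ℝ)) : pointIntensity ν (windowAfter n t S) < ∞ :=
  (measure_mono (windowAfter_subset n t S)).trans_lt (pointIntensity_window_lt_top ν n)

theorem windowAfter_subset_Ioi (n : ℕ) (t : ℝ≥0) (S : Set (ℝ × ℝ)) :
    windowAfter n t S ⊆ Ioi (t : ℝ) ×ˢ univ :=
  prod_mono Ioc_subset_Ioi_self (subset_univ _)

/-- The natural filtration of `P`, with `P` packaged in `hP`. -/
abbrev IsPoissonRandomMeasure.filtration (hP : IsPoissonRandomMeasure ν P μ) : Filtration ℝ≥0 mΩ :=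
  poissonFiltration P hP.measurable

theorem map_predPoint_apply [SFinite μ] {𝓕 : Filtration ℝ≥0 mΩ} (κ : Kernel Ω (ℝ × ℝ × ℝ))
    [IsSFiniteKernel κ] {G : Set (PredSpace 𝓕 × ℝ × ℝ)} (hG : MeasurableSet G) :
    (μ ⊗ₘ κ).map (predPoint 𝓕) G = ∫⁻ ω, κ ω {z | predPoint 𝓕 (ω, z) ∈ G} ∂μ := by
  rw [Measure.map_apply (measurable_predPoint 𝓕) hG,
    Measure.compProd_apply (measurable_predPoint 𝓕 hG)]
  rfl

theorem restrict_window_bot {𝓕 : Filtration ℝ≥0 mΩ} (π : Measure (ℝ × ℝ × ℝ)) (n : ℕ) (ω : Ω) :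
    π.restrict (window n) {z | predPoint 𝓕 (ω, z) ∈ (PredSpace.box 𝓕 0 univ)ᶜ ×ˢ univ} = 0 := by
  rw [Measure.restrict_apply' (measurableSet_window n)]
  convert! measure_empty (μ := π)
  refine Set.eq_empty_of_forall_notMem fun z hz => hz.1.1 ⟨?_, trivial⟩
  exact Real.toNNReal_pos.2 hz.2.1.1

theorem PredSpace.measurableSet_box_zero (𝓕 : Filtration ℝ≥0 mΩ) :
    MeasurableSet (PredSpace.box 𝓕 0 univ) := PredSpace.measurableSet_box MeasurableSet.univ

theorem IsPoissonRandomMeasure.lintegral_windowKernel_univ [IsProbabilityMeasure ν]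
    (hP : IsPoissonRandomMeasure ν P μ) (n : ℕ) :
    ∫⁻ ω, hP.windowKernel n ω univ ∂μ = pointIntensity ν (window n) := by
  simp only [hP.windowKernel_apply, Measure.restrict_apply_univ]
  exact hP.lintegral_apply (measurableSet_window n) (pointIntensity_window_lt_top ν n)

theorem IsPoissonRandomMeasure.isFiniteMeasure_compProd [IsProbabilityMeasure μ]
    [IsProbabilityMeasure ν] (hP : IsPoissonRandomMeasure ν P μ) (n : ℕ) :
    IsFiniteMeasure (μ ⊗ₘ hP.windowKernel n) :=
  ⟨by rw [Measure.compProd_apply .univ]; exact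
      (hP.lintegral_windowKernel_univ n).trans_lt (pointIntensity_window_lt_top ν n)⟩

/-- On (t,∞) × F × S with F in ℱ_t, independence of F and the later points makes both sides equal to
μ(F) times the intensity of the later points. Both measures are finite on a window, so these values
determine them. -/
theorem IsPoissonRandomMeasure.map_compProd_window [IsProbabilityMeasure μ]
    [IsProbabilityMeasure ν] (hP : IsPoissonRandomMeasure ν P μ) (n : ℕ) :
    (μ ⊗ₘ hP.windowKernel n).map (predPoint hP.filtration)
      = (μ ⊗ₘ Kernel.const Ω (windowIntensity ν n)).map (predPoint hP.filtration) := by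
  have := hP.isFiniteMeasure_compProd n
  have hbot : MeasurableSet
      ((PredSpace.box hP.filtration 0 univ)ᶜ ×ˢ (univ : Set (ℝ × ℝ))) :=
    (PredSpace.measurableSet_box_zero _).compl.prod .univ
  refine ext_predictable ?_ ?_ fun t F S hF hS => ?_
  · rw [map_predPoint_apply _ hbot]
    simp only [hP.windowKernel_apply, restrict_window_bot, lintegral_zero]
  · rw [map_predPoint_apply _ hbot]
    simp only [Kernel.const_apply, windowIntensity, restrict_window_bot, lintegral_zero]
  · have hG := (PredSpace.measurableSet_box hF).prod hS
    rw [map_predPoint_apply _ hG, map_predPoint_apply _ hG]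
    simp only [hP.windowKernel_apply, Kernel.const_apply, windowIntensity, restrict_window_section]
    have hA := measurableSet_windowAfter n t hS
    have h1 := hP.lintegral_mul_of_future t (f := F.indicator fun _ => 1)
      ((measurable_const (a := (1 : ℝ≥0∞))).indicator hF) hA hA (windowAfter_subset_Ioi n t S)
      (windowAfter_subset_Ioi n t S) (g := Prod.fst) measurable_fst
    simp only [hP.lintegral_apply hA (pointIntensity_windowAfter_lt_top n t S)] at h1
    have e1 : ∀ ω, F.indicator (fun _ => P ω (windowAfter n t S)) ω
        = F.indicator (fun _ => (1 : ℝ≥0∞)) ω * P ω (windowAfter n t S) := fun ω => by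
      by_cases h : ω ∈ F <;> simp [h]
    simp only [e1]
    rw [h1, lintegral_indicator (hP.filtration.le t F hF),
      lintegral_indicator (hP.filtration.le t F hF)]
    simp [mul_comm]

/-- **Compensation formula**: predictable nonnegative integrands have the same expected integral
against the Poisson random measure and against its intensity. -/
theorem IsPoissonRandomMeasure.lintegral_kernel_predPoint [IsProbabilityMeasure μ]
    [IsProbabilityMeasure ν] (hP : IsPoissonRandomMeasure ν P μ)
    {H : PredSpace hP.filtration × ℝ × ℝ → ℝ≥0∞} (hH : Measurable H) :
    ∫⁻ ω, ∫⁻ z, H (predPoint _ (ω, z)) ∂(hP.kernel ω) ∂μ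
      = ∫⁻ ω, ∫⁻ z, H (predPoint _ (ω, z)) ∂((pointIntensity ν).restrict domain) ∂μ := by
  have hm : Measurable fun p : Ω × ℝ × ℝ × ℝ => H (predPoint hP.filtration p) :=
    hH.comp (measurable_predPoint _)
  have hw : ∀ n, ∫⁻ ω, ∫⁻ z, H (predPoint _ (ω, z)) ∂((P ω).restrict (window n)) ∂μ
      = ∫⁻ ω, ∫⁻ z, H (predPoint _ (ω, z)) ∂((pointIntensity ν).restrict (window n)) ∂μ := by
    intro n
    have h := congrArg (fun Q => ∫⁻ x, H x ∂Q) (hP.map_compProd_window n)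
    simp only [lintegral_map hH (measurable_predPoint _)] at h
    rw [Measure.lintegral_compProd hm, Measure.lintegral_compProd hm] at h
    simpa only [hP.windowKernel_apply, Kernel.const_apply, windowIntensity] using h
  -- The windows increase to the whole domain; monotone convergence on both sides removes the
  -- restriction to a window.
  have hlim : ∀ (π : Measure (ℝ × ℝ × ℝ)) (f : ℝ × ℝ × ℝ → ℝ≥0∞),
      ∫⁻ z, f z ∂(π.restrict domain) = ⨆ n, ∫⁻ z, f z ∂(π.restrict (window n)) := by
    intro π f
    rw [← iUnion_window]
    exact setLIntegral_iUnion_of_directed f monotone_window.directed_le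
  have hmono : ∀ (π : Ω → Measure (ℝ × ℝ × ℝ)),
      Monotone fun (n : ℕ) (ω : Ω) =>
        ∫⁻ z, H (predPoint hP.filtration (ω, z)) ∂((π ω).restrict (window n)) :=
    fun π m n hmn ω => lintegral_mono' (Measure.restrict_mono (monotone_window hmn) le_rfl) le_rfl
  simp only [hP.kernel_apply, hlim]
  rw [lintegral_iSup _ (hmono P), lintegral_iSup _ (hmono fun _ => pointIntensity ν)]
  · simp only [hw]
  · intro n
    exact hm.lintegral_prod_right' (ν := (pointIntensity ν).restrict (window n))
  · intro n
    simp only [← hP.windowKernel_apply n]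
    exact Measurable.lintegral_kernel_prod_right' (κ := hP.windowKernel n) hm

/-- Pairs of points of the configuration. -/
def predPair (𝓕 : Filtration ℝ≥0 mΩ) (p : Ω × (ℝ × ℝ × ℝ) × (ℝ × ℝ × ℝ)) :
    (PredSpace 𝓕 × ℝ × ℝ) × (PredSpace 𝓕 × ℝ × ℝ) :=
  (predPoint 𝓕 (p.1, p.2.1), predPoint 𝓕 (p.1, p.2.2))

theorem measurable_predPair (𝓕 : Filtration ℝ≥0 mΩ) : Measurable (predPair 𝓕) :=
  ((measurable_predPoint 𝓕).comp (by fun_prop)).prodMk ((measurable_predPoint 𝓕).comp (by fun_prop))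

theorem map_predPair_prod [SFinite μ] {𝓕 : Filtration ℝ≥0 mΩ} (κ κ' : Kernel Ω (ℝ × ℝ × ℝ))
    [IsSFiniteKernel κ] [IsSFiniteKernel κ'] {G G' : Set (PredSpace 𝓕 × ℝ × ℝ)}
    (hG : MeasurableSet G) (hG' : MeasurableSet G') :
    (μ ⊗ₘ (κ ×ₖ κ')).map (predPair 𝓕) (G ×ˢ G') = ∫⁻ ω, κ ω {z | predPoint 𝓕 (ω, z) ∈ G}
      * κ' ω {z | predPoint 𝓕 (ω, z) ∈ G'} ∂μ := by
  rw [Measure.map_apply (measurable_predPair 𝓕) (hG.prod hG'),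
    Measure.compProd_apply (measurable_predPair 𝓕 (hG.prod hG'))]
  refine lintegral_congr fun ω => ?_
  rw [← Kernel.prod_apply_prod]
  rfl

theorem map_predPair_diag [SFinite μ] {𝓕 : Filtration ℝ≥0 mΩ} (κ : Kernel Ω (ℝ × ℝ × ℝ))
    [IsSFiniteKernel κ] {G G' : Set (PredSpace 𝓕 × ℝ × ℝ)}
    (hG : MeasurableSet G) (hG' : MeasurableSet G') :
    (μ ⊗ₘ (κ.map fun z => (z, z))).map (predPair 𝓕) (G ×ˢ G')
      = ∫⁻ ω, κ ω {z | predPoint 𝓕 (ω, z) ∈ G ∩ G'} ∂μ := by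
  rw [Measure.map_apply (measurable_predPair 𝓕) (hG.prod hG'),
    Measure.compProd_apply (measurable_predPair 𝓕 (hG.prod hG'))]
  refine lintegral_congr fun ω => ?_
  rw [Kernel.map_apply' _ (by fun_prop) _
    (measurable_prodMk_left (measurable_predPair 𝓕 (hG.prod hG')))]
  rfl

/-- `E[P ⊗ P + m ⊗ m]` on pairs of predictable points of a window. -/
noncomputable def IsPoissonRandomMeasure.secondMoment [IsProbabilityMeasure ν]
    (hP : IsPoissonRandomMeasure ν P μ) (n : ℕ) :
    Measure ((PredSpace hP.filtration × ℝ × ℝ) × (PredSpace hP.filtration × ℝ × ℝ)) :=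
  (μ ⊗ₘ (hP.windowKernel n ×ₖ hP.windowKernel n)).map (predPair _)
    + (μ ⊗ₘ (Kernel.const Ω (windowIntensity ν n) ×ₖ Kernel.const Ω (windowIntensity ν n))).map
      (predPair _)

/-- `E[P ⊗ m + m ⊗ P + m_diag]` on pairs of predictable points of a window. -/
noncomputable def IsPoissonRandomMeasure.crossMoment [IsProbabilityMeasure ν]
    (hP : IsPoissonRandomMeasure ν P μ) (n : ℕ) :
    Measure ((PredSpace hP.filtration × ℝ × ℝ) × (PredSpace hP.filtration × ℝ × ℝ)) :=
  (μ ⊗ₘ (hP.windowKernel n ×ₖ Kernel.const Ω (windowIntensity ν n))).map (predPair _)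
    + (μ ⊗ₘ (Kernel.const Ω (windowIntensity ν n) ×ₖ hP.windowKernel n)).map (predPair _)
    + (μ ⊗ₘ ((Kernel.const Ω (windowIntensity ν n)).map fun z => (z, z))).map (predPair _)

end HawkesRisk

/-! ### Second-order structure of the compensated Poisson measure -/

namespace HawkesRisk

variable {Ω : Type*} {mΩ : MeasurableSpace Ω} {μ : Measure Ω} {ν : Measure ℝ}
  {P : Ω → Measure (ℝ × ℝ × ℝ)}

theorem map_fst_restrict_apply {α β : Type*} {mα : MeasurableSpace α} {mβ : MeasurableSpace β}
    (R : Measure (α × β)) (S : Set β) {C : Set α} (hC : MeasurableSet C) :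
    (R.restrict (univ ×ˢ S)).map Prod.fst C = R (C ×ˢ S) := by
  rw [Measure.map_apply measurable_fst hC, Measure.restrict_apply (measurable_fst hC)]
  congr 1
  ext x; simp

theorem map_snd_restrict_apply {α β : Type*} {mα : MeasurableSpace α} {mβ : MeasurableSpace β}
    (R : Measure (α × β)) (S : Set α) {C : Set β} (hC : MeasurableSet C) :
    (R.restrict (S ×ˢ univ)).map Prod.snd C = R (S ×ˢ C) := by
  rw [Measure.map_apply measurable_snd hC, Measure.restrict_apply (measurable_snd hC)]
  congr 1
  ext x; simp [and_comm]

/-- Split the earlier set at time t into A₁, whose count is ℱ_t-measurable, and A₂ after t. The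
event F ∩ F' is in ℱ_t, so A₁ decouples from the later set A', while A₂ and A' obey the product
formula for Poisson counts. Only A₂ ∩ A' leaves an extra term. The negative terms of the covariance
are moved across the equality, since nothing can be subtracted in `ℝ≥0∞`. -/
theorem IsPoissonRandomMeasure.second_moment_of_le [IsProbabilityMeasure μ]
    [IsProbabilityMeasure ν] (hP : IsPoissonRandomMeasure ν P μ) (n : ℕ) {s t : ℝ≥0} (hst : s ≤ t)
    {F F' : Set Ω} (hF : MeasurableSet[hP.filtration s] F) (hF' : MeasurableSet[hP.filtration t] F')
    {S S' : Set (ℝ × ℝ)} (hS : MeasurableSet S) (hS' : MeasurableSet S') :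
    ∫⁻ ω, F.indicator (fun _ => P ω (windowAfter n s S)) ω
        * F'.indicator (fun _ => P ω (windowAfter n t S')) ω ∂μ
      + ∫⁻ ω, F.indicator (fun _ => pointIntensity ν (windowAfter n s S)) ω
        * F'.indicator (fun _ => pointIntensity ν (windowAfter n t S')) ω ∂μ
    = ∫⁻ ω, F.indicator (fun _ => P ω (windowAfter n s S)) ω
        * F'.indicator (fun _ => pointIntensity ν (windowAfter n t S')) ω ∂μ
      + ∫⁻ ω, F.indicator (fun _ => pointIntensity ν (windowAfter n s S)) ω
        * F'.indicator (fun _ => P ω (windowAfter n t S')) ω ∂μ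
      + ∫⁻ ω, (F ∩ F').indicator
          (fun _ => pointIntensity ν (windowAfter n t (S ∩ S'))) ω ∂μ := by
  set m := pointIntensity ν with hm
  set A := windowAfter n s S with hA
  set A' := windowAfter n t S' with hA'
  set A₁ := A ∩ Iic (t : ℝ) ×ˢ univ with hA₁
  set A₂ := windowAfter n t S with hA₂
  have mA : MeasurableSet A := measurableSet_windowAfter n s hS
  have mA' : MeasurableSet A' := measurableSet_windowAfter n t hS'
  have mA₁ : MeasurableSet A₁ := mA.inter (measurableSet_Iic.prod .univ)
  have mA₂ : MeasurableSet A₂ := measurableSet_windowAfter n t hS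
  have fA' : m A' < ∞ := pointIntensity_windowAfter_lt_top n t S'
  have fA₂ : m A₂ < ∞ := pointIntensity_windowAfter_lt_top n t S
  have sA' : A' ⊆ Ioi (t : ℝ) ×ˢ univ := windowAfter_subset_Ioi n t S'
  have sA₂ : A₂ ⊆ Ioi (t : ℝ) ×ˢ univ := windowAfter_subset_Ioi n t S
  have hst' : (s : ℝ) ≤ t := by exact_mod_cast hst
  have hsplit : ∀ π : Measure (ℝ × ℝ × ℝ), π A = π A₁ + π A₂ := by
    intro π
    have : A = A₁ ∪ A₂ := by
      ext z
      simp only [hA, hA₁, hA₂, windowAfter, mem_union, mem_inter_iff, mem_prod, mem_Ioc, mem_Iic,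
        mem_univ, and_true]
      constructor
      · rintro ⟨⟨h1, h2⟩, h3⟩
        rcases le_or_gt z.1 t with h | h
        · exact Or.inl ⟨⟨⟨h1, h2⟩, h3⟩, h⟩
        · exact Or.inr ⟨⟨h, h2⟩, h3⟩
      · rintro (⟨h, -⟩ | ⟨⟨h1, h2⟩, h3⟩)
        · exact h
        · exact ⟨⟨lt_of_le_of_lt hst' h1, h2⟩, h3⟩
    rw [this, measure_union _ mA₂]
    exact Set.disjoint_left.2 fun z hz hz' => not_lt.2 (show z.1 ≤ t from hz.2.1) (sA₂ hz').1
  have hinter : A₂ ∩ A' = windowAfter n t (S ∩ S') := by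
    ext z
    simp only [hA₂, hA', windowAfter, mem_inter_iff, mem_prod]
    tauto
  have hA₁meas : Measurable[hP.filtration t] fun ω => P ω A₁ := by
    have e : A₁ = (Ioc (s : ℝ) n ∩ Iic (t : ℝ)) ×ˢ (S ∩ Icc 0 (n : ℝ) ×ˢ univ) := by
      ext z
      simp only [hA₁, hA, windowAfter, mem_inter_iff, mem_prod, mem_univ, and_true]
      tauto
    rw [e]
    intro U hU
    refine MeasurableSpace.measurableSet_generateFrom
      ⟨_, _, U, measurableSet_Ioc.inter measurableSet_Iic, ?_,
        hS.inter (measurableSet_Icc.prod .univ), ?_, hU, rfl⟩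
    · exact fun x hx => ⟨lt_of_le_of_lt s.2 hx.1.1, hx.2⟩
    · exact inter_subset_right.trans (prod_mono Icc_subset_Ici_self subset_rfl)
  let f : Ω → ℝ≥0∞ := (F ∩ F').indicator fun _ => 1
  have hf : Measurable[hP.filtration t] f :=
    (measurable_const (a := (1 : ℝ≥0∞))).indicator ((hP.filtration.mono hst _ hF).inter hF')
  have hfm : Measurable f := hf.mono (hP.filtration.le t) le_rfl
  have hprod : ∀ a b : Ω → ℝ≥0∞, ∀ ω, F.indicator (fun _ => a ω) ω * F'.indicator (fun _ => b ω) ω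
      = f ω * (a ω * b ω) := by
    intro a b ω
    by_cases h : ω ∈ F <;> by_cases h' : ω ∈ F' <;> simp [f, h, h']
  have mP := @IsPoissonRandomMeasure.measurable_apply _ _ _ _ _ hP
  have mPA₁ := mP mA₁
  have mPA₂ := mP mA₂
  have mPA' := mP mA'
  have i1 : ∫⁻ ω, f ω * P ω A₁ * P ω A' ∂μ = (∫⁻ ω, f ω * P ω A₁ ∂μ) * m A' := by
    have h := hP.lintegral_mul_of_future t (f := fun ω => f ω * P ω A₁)
      (hf.mul hA₁meas) mA' mA' sA' sA' (g := Prod.fst) measurable_fst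
    simpa only [hP.lintegral_apply mA' fA'] using h
  have i2 : ∫⁻ ω, f ω * (P ω A₂ * P ω A') ∂μ
      = (∫⁻ ω, f ω ∂μ) * (m A₂ * m A' + m (A₂ ∩ A')) := by
    have h := hP.lintegral_mul_of_future t hf mA₂ mA' sA₂ sA' (g := fun p => p.1 * p.2)
      (by fun_prop)
    simpa only [hP.lintegral_mul mA₂ mA' fA₂ fA'] using h
  have i3 : ∫⁻ ω, f ω * P ω A₂ ∂μ = (∫⁻ ω, f ω ∂μ) * m A₂ := by
    have h := hP.lintegral_mul_of_future t hf mA₂ mA₂ sA₂ sA₂ (g := Prod.fst) measurable_fst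
    simpa only [hP.lintegral_apply mA₂ fA₂] using h
  have i4 : ∫⁻ ω, f ω * P ω A' ∂μ = (∫⁻ ω, f ω ∂μ) * m A' := by
    have h := hP.lintegral_mul_of_future t hf mA' mA' sA' sA' (g := Prod.fst) measurable_fst
    simpa only [hP.lintegral_apply mA' fA'] using h
  have e1 : ∫⁻ ω, F.indicator (fun _ => P ω A) ω * F'.indicator (fun _ => P ω A') ω ∂μ
      = (∫⁻ ω, f ω * P ω A₁ ∂μ) * m A' + (∫⁻ ω, f ω ∂μ) * (m A₂ * m A' + m (A₂ ∩ A')) := by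
    rw [← i1, ← i2, ← lintegral_add_left (by fun_prop)]
    refine lintegral_congr fun ω => ?_
    rw [hprod (fun ω => P ω A) fun ω => P ω A', hsplit]
    ring
  have e2 : ∫⁻ ω, F.indicator (fun _ => m A) ω * F'.indicator (fun _ => m A') ω ∂μ
      = (∫⁻ ω, f ω ∂μ) * (m A * m A') := by
    rw [← lintegral_mul_const _ hfm]
    exact lintegral_congr fun ω => hprod (fun _ => m A) (fun _ => m A') ω
  have e3 : ∫⁻ ω, F.indicator (fun _ => P ω A) ω * F'.indicator (fun _ => m A') ω ∂μ
      = (∫⁻ ω, f ω * P ω A₁ ∂μ) * m A' + (∫⁻ ω, f ω ∂μ) * m A₂ * m A' := by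
    rw [← i3, ← lintegral_mul_const _ (by fun_prop), ← lintegral_mul_const _ (by fun_prop),
      ← lintegral_add_left (by fun_prop)]
    refine lintegral_congr fun ω => ?_
    rw [hprod (fun ω => P ω A) fun ω => m A', hsplit]
    ring
  have e4 : ∫⁻ ω, F.indicator (fun _ => m A) ω * F'.indicator (fun _ => P ω A') ω ∂μ
      = (∫⁻ ω, f ω ∂μ) * m A' * m A := by
    rw [← i4, ← lintegral_mul_const _ (by fun_prop)]
    refine lintegral_congr fun ω => ?_
    rw [hprod (fun ω => m A) fun ω => P ω A']
    ring
  have e5 : ∫⁻ ω, (F ∩ F').indicator (fun _ => m (windowAfter n t (S ∩ S'))) ω ∂μ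
      = (∫⁻ ω, f ω ∂μ) * m (A₂ ∩ A') := by
    rw [← lintegral_mul_const _ hfm, hinter]
    refine lintegral_congr fun ω => ?_
    by_cases h : ω ∈ F ∩ F' <;> simp [f, h]
  rw [e1, e2, e3, e4, e5]
  ring

theorem PredSpace.box_inter (𝓕 : Filtration ℝ≥0 mΩ) (s t : ℝ≥0) (F F' : Set Ω) :
    PredSpace.box 𝓕 s F ∩ PredSpace.box 𝓕 t F' = PredSpace.box 𝓕 (max s t) (F ∩ F') := by
  change (Ioi s ×ˢ F) ∩ (Ioi t ×ˢ F') = Ioi (max s t) ×ˢ (F ∩ F')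
  rw [prod_inter_prod, Ioi_inter_Ioi]

/-- This is E[(P-m) ⊗ (P-m)] = E[m on the diagonal] with the negative terms on the other side.
Applying `ext_predictable` in each coordinate in turn reduces it to rectangles (s,∞) × F × S and
(t,∞) × F' × S'. -/
theorem IsPoissonRandomMeasure.secondMoment_eq_crossMoment [IsProbabilityMeasure μ]
    [IsProbabilityMeasure ν] (hP : IsPoissonRandomMeasure ν P μ) (n : ℕ) :
    IsFiniteMeasure (hP.secondMoment n) ∧ hP.secondMoment n = hP.crossMoment n := by
  have hsec : ∀ {G G' : Set (PredSpace hP.filtration × ℝ × ℝ)}, MeasurableSet G → MeasurableSet G' →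
      hP.secondMoment n (G ×ˢ G')
      = ∫⁻ ω, (P ω).restrict (window n) {z | predPoint _ (ω, z) ∈ G}
          * (P ω).restrict (window n) {z | predPoint _ (ω, z) ∈ G'} ∂μ
        + ∫⁻ ω, (pointIntensity ν).restrict (window n) {z | predPoint _ (ω, z) ∈ G}
          * (pointIntensity ν).restrict (window n) {z | predPoint _ (ω, z) ∈ G'} ∂μ := by
    intro G G' hG hG'
    rw [secondMoment, Measure.add_apply, map_predPair_prod _ _ hG hG', map_predPair_prod _ _ hG hG']
    simp only [hP.windowKernel_apply, Kernel.const_apply, windowIntensity]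
  have hcross : ∀ {G G' : Set (PredSpace hP.filtration × ℝ × ℝ)}, MeasurableSet G →
      MeasurableSet G' → hP.crossMoment n (G ×ˢ G')
      = ∫⁻ ω, (P ω).restrict (window n) {z | predPoint _ (ω, z) ∈ G}
          * (pointIntensity ν).restrict (window n) {z | predPoint _ (ω, z) ∈ G'} ∂μ
        + ∫⁻ ω, (pointIntensity ν).restrict (window n) {z | predPoint _ (ω, z) ∈ G}
          * (P ω).restrict (window n) {z | predPoint _ (ω, z) ∈ G'} ∂μ
        + ∫⁻ ω, (pointIntensity ν).restrict (window n) {z | predPoint _ (ω, z) ∈ G ∩ G'} ∂μ := by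
    intro G G' hG hG'
    rw [crossMoment, Measure.add_apply, Measure.add_apply, map_predPair_prod _ _ hG hG',
      map_predPair_prod _ _ hG hG', map_predPair_diag _ hG hG']
    simp only [hP.windowKernel_apply, Kernel.const_apply, windowIntensity]
  have hw := pointIntensity_window_lt_top ν n
  have mw := measurableSet_window n
  have mPw := hP.measurable_apply mw
  have hfin : IsFiniteMeasure (hP.secondMoment n) := by
    refine ⟨?_⟩
    rw [← univ_prod_univ, hsec .univ .univ]
    simp only [mem_univ, ofPred_true, Measure.restrict_apply_univ]
    rw [hP.lintegral_mul mw mw hw hw, lintegral_const, measure_univ, mul_one, inter_self]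
    exact ENNReal.add_lt_top.2 ⟨ENNReal.add_lt_top.2 ⟨ENNReal.mul_lt_top hw hw, hw⟩,
      ENNReal.mul_lt_top hw hw⟩
  have hfin' : IsFiniteMeasure (hP.crossMoment n) := by
    refine ⟨?_⟩
    rw [← univ_prod_univ, hcross .univ .univ]
    simp only [mem_univ, ofPred_true, Measure.restrict_apply_univ, inter_self]
    rw [lintegral_mul_const _ mPw, lintegral_const_mul _ mPw, hP.lintegral_apply mw hw,
      lintegral_const, measure_univ, mul_one]
    exact ENNReal.add_lt_top.2 ⟨ENNReal.add_lt_top.2 ⟨ENNReal.mul_lt_top hw hw,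
      ENNReal.mul_lt_top hw hw⟩, hw⟩
  refine ⟨hfin, ?_⟩
  have hbot : MeasurableSet
      ((PredSpace.box hP.filtration 0 univ)ᶜ ×ˢ (univ : Set (ℝ × ℝ))) :=
    (PredSpace.measurableSet_box_zero _).compl.prod .univ
  have hdiag0 : ∀ (G : Set (PredSpace hP.filtration × ℝ × ℝ)) (ω : Ω),
      (pointIntensity ν).restrict (window n) {z | predPoint hP.filtration (ω, z) ∈
        ((PredSpace.box hP.filtration 0 univ)ᶜ ×ˢ univ) ∩ G} = 0 := fun G ω =>
    measure_mono_null (fun z hz => hz.1) (restrict_window_bot _ n ω)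
  refine Measure.ext_prod_iff.2 fun {G G'} hG hG' => ?_
  suffices h : ((hP.secondMoment n).restrict (univ ×ˢ G')).map Prod.fst
      = ((hP.crossMoment n).restrict (univ ×ˢ G')).map Prod.fst by
    rw [← map_fst_restrict_apply _ _ hG, h, map_fst_restrict_apply _ _ hG]
  refine ext_predictable ?_ ?_ fun s F S hF hS => ?_
  · rw [map_fst_restrict_apply _ _ hbot, hsec hbot hG']
    simp only [restrict_window_bot, zero_mul, lintegral_zero, add_zero]
  · rw [map_fst_restrict_apply _ _ hbot, hcross hbot hG']
    simp only [restrict_window_bot, zero_mul, lintegral_zero, add_zero, hdiag0]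
  have hB := (PredSpace.measurableSet_box hF).prod hS
  rw [map_fst_restrict_apply _ _ hB, map_fst_restrict_apply _ _ hB]
  suffices h : ((hP.secondMoment n).restrict ((PredSpace.box hP.filtration s F ×ˢ S) ×ˢ univ)).map
      Prod.snd = ((hP.crossMoment n).restrict
        ((PredSpace.box hP.filtration s F ×ˢ S) ×ˢ univ)).map Prod.snd by
    rw [← map_snd_restrict_apply _ _ hG', h, map_snd_restrict_apply _ _ hG']
  refine ext_predictable ?_ ?_ fun t F' S' hF' hS' => ?_
  · rw [map_snd_restrict_apply _ _ hbot, hsec hB hbot]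
    simp only [restrict_window_bot, mul_zero, lintegral_zero, add_zero]
  · rw [map_snd_restrict_apply _ _ hbot, hcross hB hbot, inter_comm]
    simp only [restrict_window_bot, mul_zero, lintegral_zero, add_zero, hdiag0]
  have hB' := (PredSpace.measurableSet_box hF').prod hS'
  rw [map_snd_restrict_apply _ _ hB', map_snd_restrict_apply _ _ hB', hsec hB hB', hcross hB hB',
    prod_inter_prod, PredSpace.box_inter]
  simp only [restrict_window_section]
  -- Both measures are symmetric in the two points, so the ordered case gives the other after
  -- exchanging them.
  rcases le_total s t with hst | hst
  · rw [max_eq_right hst]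
    exact hP.second_moment_of_le n hst hF hF' hS hS'
  · rw [max_eq_left hst, inter_comm F, inter_comm S]
    have h := hP.second_moment_of_le n hst hF' hF hS' hS
    simp only [mul_comm (F'.indicator _ _)] at h
    rw [h]
    ring

end HawkesRisk

/-! ### The L² isometry and the second-moment bound for predictable integrands -/

namespace HawkesRisk

variable {Ω : Type*} {mΩ : MeasurableSpace Ω} {μ : Measure Ω} {ν : Measure ℝ}
  {P : Ω → Measure (ℝ × ℝ × ℝ)}

theorem integrable_integral_compProd {β : Type*} {mβ : MeasurableSpace β} [SFinite μ]
    {κ : Kernel Ω β} [IsSFiniteKernel κ] {f : Ω × β → ℝ} (hf : Integrable f (μ ⊗ₘ κ)) :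
    Integrable (fun ω => ∫ z, f (ω, z) ∂(κ ω)) μ :=
  Integrable.integral_compProd (κ := Kernel.const Unit μ) (η := Kernel.prodMkLeft Unit κ)
    (a := ()) hf

theorem integral_map_predPair [SFinite μ] {𝓕 : Filtration ℝ≥0 mΩ} (κ κ' : Kernel Ω (ℝ × ℝ × ℝ))
    [IsSFiniteKernel κ] [IsSFiniteKernel κ'] {f : PredSpace 𝓕 × ℝ × ℝ → ℝ} (hf : Measurable f)
    (h : Integrable (fun p : (PredSpace 𝓕 × ℝ × ℝ) × (PredSpace 𝓕 × ℝ × ℝ) => f p.1 * f p.2)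
      ((μ ⊗ₘ (κ ×ₖ κ')).map (predPair 𝓕))) :
    Integrable (fun ω => (∫ z, f (predPoint 𝓕 (ω, z)) ∂(κ ω)) *
        ∫ z, f (predPoint 𝓕 (ω, z)) ∂(κ' ω)) μ ∧
      ∫ p, f p.1 * f p.2 ∂((μ ⊗ₘ (κ ×ₖ κ')).map (predPair 𝓕))
        = ∫ ω, (∫ z, f (predPoint 𝓕 (ω, z)) ∂(κ ω)) *
            ∫ z, f (predPoint 𝓕 (ω, z)) ∂(κ' ω) ∂μ := by
  have hm : Measurable fun p : (PredSpace 𝓕 × ℝ × ℝ) × (PredSpace 𝓕 × ℝ × ℝ) => f p.1 * f p.2 := by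
    fun_prop
  have h' := (integrable_map_measure hm.aestronglyMeasurable
    (measurable_predPair 𝓕).aemeasurable).1 h
  have e : ∀ ω, ∫ q, f (predPoint 𝓕 (ω, q.1)) * f (predPoint 𝓕 (ω, q.2)) ∂((κ ×ₖ κ') ω)
      = (∫ z, f (predPoint 𝓕 (ω, z)) ∂(κ ω)) * ∫ z, f (predPoint 𝓕 (ω, z)) ∂(κ' ω) := by
    intro ω
    rw [Kernel.prod_apply]
    exact integral_prod_mul (fun z => f (predPoint 𝓕 (ω, z))) fun z => f (predPoint 𝓕 (ω, z))
  constructor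
  · have h2 := integrable_integral_compProd h'
    exact h2.congr (ae_of_all _ e)
  · rw [integral_map (measurable_predPair 𝓕).aemeasurable hm.aestronglyMeasurable]
    exact (Measure.integral_compProd h').trans (integral_congr_ae (ae_of_all _ e))

/-- The isometry for bounded predictable integrands on a window. -/
theorem IsPoissonRandomMeasure.integral_sq_window [IsProbabilityMeasure μ]
    [IsProbabilityMeasure ν] (hP : IsPoissonRandomMeasure ν P μ) (n : ℕ)
    {f : PredSpace hP.filtration × ℝ × ℝ → ℝ} (hf : Measurable f) {C : ℝ} (hC : ∀ x, |f x| ≤ C) :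
    ∫⁻ ω, ENNReal.ofReal ((∫ z, f (predPoint _ (ω, z)) ∂((P ω).restrict (window n))
        - ∫ z, f (predPoint _ (ω, z)) ∂((pointIntensity ν).restrict (window n))) ^ 2) ∂μ
      = ∫⁻ ω, ∫⁻ z, ENNReal.ofReal (f (predPoint _ (ω, z)) ^ 2)
          ∂((pointIntensity ν).restrict (window n)) ∂μ := by
  obtain ⟨hfin, heq⟩ := hP.secondMoment_eq_crossMoment n
  have hfin' : IsFiniteMeasure (hP.crossMoment n) := heq ▸ hfin
  let g : (PredSpace hP.filtration × ℝ × ℝ) × (PredSpace hP.filtration × ℝ × ℝ) → ℝ :=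
    fun p => f p.1 * f p.2
  have hg : Measurable g := by fun_prop
  have hgC : ∀ p, ‖g p‖ ≤ C * C := fun p => by
    rw [norm_mul]
    exact mul_le_mul (hC _) (hC _) (norm_nonneg _) ((abs_nonneg _).trans (hC p.1))
  -- Boundedness of f and finiteness of both measures make every term integrable; the equality of
  -- measures can then be rearranged as an equality of real numbers.
  have hi1 : Integrable g (hP.secondMoment n) :=
    Integrable.of_bound hg.aestronglyMeasurable _ (ae_of_all _ hgC)
  have hi2 : Integrable g (hP.crossMoment n) :=
    Integrable.of_bound hg.aestronglyMeasurable _ (ae_of_all _ hgC)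
  have hint : ∫ p, g p ∂(hP.secondMoment n) = ∫ p, g p ∂(hP.crossMoment n) := by rw [heq]
  rw [secondMoment] at hi1 hint
  rw [crossMoment] at hi2 hint
  have j1 := hi1.left_of_add_measure
  have j2 := hi1.right_of_add_measure
  have j3 := hi2.left_of_add_measure.left_of_add_measure
  have j4 := hi2.left_of_add_measure.right_of_add_measure
  have j5 := hi2.right_of_add_measure
  rw [integral_add_measure j1 j2, integral_add_measure hi2.left_of_add_measure j5,
    integral_add_measure j3 j4] at hint
  obtain ⟨k1, l1⟩ := integral_map_predPair _ _ hf j1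
  obtain ⟨k2, l2⟩ := integral_map_predPair _ _ hf j2
  obtain ⟨k3, l3⟩ := integral_map_predPair _ _ hf j3
  obtain ⟨k4, l4⟩ := integral_map_predPair _ _ hf j4
  have j5' := (integrable_map_measure hg.aestronglyMeasurable
    (measurable_predPair _).aemeasurable).1 j5
  have e5 : ∀ ω, ∫ q, (g ∘ predPair hP.filtration) (ω, q)
      ∂(((Kernel.const Ω (windowIntensity ν n)).map fun z => (z, z)) ω)
      = ∫ z, f (predPoint _ (ω, z)) ^ 2 ∂(windowIntensity ν n) := by
    intro ω
    rw [Kernel.map_apply _ (by fun_prop), Kernel.const_apply, integral_map (by fun_prop)]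
    · refine integral_congr_ae (ae_of_all _ fun z => ?_)
      simp only [g, predPair, Function.comp_apply, sq]
    · exact ((hg.comp (measurable_predPair _)).comp measurable_prodMk_left).aestronglyMeasurable
  have l5 : ∫ p, g p ∂((μ ⊗ₘ ((Kernel.const Ω (windowIntensity ν n)).map fun z => (z, z))).map
      (predPair hP.filtration)) = ∫ ω, ∫ z, f (predPoint _ (ω, z)) ^ 2 ∂(windowIntensity ν n) ∂μ := by
    rw [integral_map (measurable_predPair _).aemeasurable hg.aestronglyMeasurable]
    exact (Measure.integral_compProd j5').trans (integral_congr_ae (ae_of_all _ e5))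
  have k5 : Integrable (fun ω => ∫ z, f (predPoint _ (ω, z)) ^ 2 ∂(windowIntensity ν n)) μ :=
    (integrable_integral_compProd j5').congr (ae_of_all _ e5)
  rw [l1, l2, l3, l4, l5] at hint
  simp only [hP.windowKernel_apply, Kernel.const_apply, windowIntensity] at *
  set A : Ω → ℝ := fun ω => ∫ z, f (predPoint _ (ω, z)) ∂((P ω).restrict (window n))
  set B : Ω → ℝ := fun ω => ∫ z, f (predPoint _ (ω, z)) ∂((pointIntensity ν).restrict (window n))
  have hsq : (fun ω => (A ω - B ω) ^ 2)
      = fun ω => (A ω * A ω + B ω * B ω) - (A ω * B ω + B ω * A ω) := by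
    funext ω; ring
  have hisq : Integrable (fun ω => (A ω - B ω) ^ 2) μ := by
    rw [hsq]; exact (k1.add k2).sub (k3.add k4)
  have hEsq : ∫ ω, (A ω - B ω) ^ 2 ∂μ
      = ∫ ω, ∫ z, f (predPoint _ (ω, z)) ^ 2 ∂((pointIntensity ν).restrict (window n)) ∂μ := by
    have h1 := integral_sub (k1.add k2) (k3.add k4)
    simp only [Pi.add_apply] at h1
    rw [hsq, h1, integral_add k1 k2, integral_add k3 k4]
    linarith
  rw [← ofReal_integral_eq_lintegral_ofReal hisq (ae_of_all _ fun ω => sq_nonneg _), hEsq,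
    ofReal_integral_eq_lintegral_ofReal k5
      (ae_of_all _ fun ω => integral_nonneg fun z => sq_nonneg _)]
  refine lintegral_congr fun ω => ?_
  have : IsFiniteMeasure ((pointIntensity ν).restrict (window n)) :=
    inferInstanceAs (IsFiniteMeasure (windowIntensity ν n))
  refine ofReal_integral_eq_lintegral_ofReal ?_ (ae_of_all _ fun z => sq_nonneg _)
  refine Integrable.of_bound (C := C ^ 2) ?_ (ae_of_all _ fun z => ?_)
  · exact (((hf.comp (measurable_predPoint _)).comp
      measurable_prodMk_left).pow_const 2).aestronglyMeasurable
  · rw [norm_pow]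
    exact pow_le_pow_left₀ (norm_nonneg _) (hC _) 2

/-- The second moment of the compensated integral of a predictable integrand is at most the
expected integral of its square. -/
theorem IsPoissonRandomMeasure.lintegral_sq_le [IsProbabilityMeasure μ]
    [IsProbabilityMeasure ν] (hP : IsPoissonRandomMeasure ν P μ)
    {f : PredSpace hP.filtration × ℝ × ℝ → ℝ} (hf : Measurable f)
    (hint : ∫⁻ ω, ∫⁻ z, ‖f (predPoint _ (ω, z))‖ₑ ∂((pointIntensity ν).restrict domain) ∂μ < ∞) :
    ∫⁻ ω, ENNReal.ofReal ((∫ z, f (predPoint _ (ω, z)) ∂((P ω).restrict domain)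
        - ∫ z, f (predPoint _ (ω, z)) ∂((pointIntensity ν).restrict domain)) ^ 2) ∂μ
      ≤ ∫⁻ ω, ∫⁻ z, ENNReal.ofReal (f (predPoint _ (ω, z)) ^ 2)
          ∂((pointIntensity ν).restrict domain) ∂μ := by
  have hm : Measurable fun p : Ω × ℝ × ℝ × ℝ => f (predPoint hP.filtration p) :=
    hf.comp (measurable_predPoint _)
  -- Truncation at height n together with restriction to the n-th window puts the integrand under
  -- the bounded isometry. The truncated integrals converge almost surely, and Fatou's lemma passes
  -- to the limit, which costs the equality.
  let F : ℕ → PredSpace hP.filtration × ℝ × ℝ → ℝ := fun n x => max (-n) (min n (f x))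
  have hF : ∀ n, Measurable (F n) := fun n => measurable_const.max (measurable_const.min hf)
  have hFn : ∀ n x, |F n x| ≤ n := fun n x => by
    have : (0 : ℝ) ≤ n := n.cast_nonneg
    exact abs_le.2 ⟨le_max_left _ _, max_le (by linarith) (min_le_left _ _)⟩
  have hFf : ∀ n x, |F n x| ≤ |f x| := fun n x => by
    have : (0 : ℝ) ≤ n := n.cast_nonneg
    refine abs_le.2 ⟨?_, max_le ((neg_nonpos.2 this).trans (abs_nonneg _))
      ((min_le_right _ _).trans (le_abs_self _))⟩
    exact le_max_of_le_right (le_min ((neg_nonpos.2 (abs_nonneg _)).trans this) (neg_abs_le _))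
  have hFlim : ∀ x, ∀ᶠ n in atTop, F n x = f x := fun x => by
    obtain ⟨N, hN⟩ := exists_nat_ge |f x|
    filter_upwards [eventually_ge_atTop N] with n hn
    have h1 : |f x| ≤ n := hN.trans (by exact_mod_cast hn)
    have h2 := abs_le.1 h1
    simp only [F]
    rw [min_eq_right h2.2, max_eq_right h2.1]
  have hlim : ∀ (π : Measure (ℝ × ℝ × ℝ)) (ω : Ω),
      Integrable (fun z => f (predPoint hP.filtration (ω, z))) (π.restrict domain) →
      Tendsto (fun n => ∫ z, F n (predPoint _ (ω, z)) ∂(π.restrict (window n))) atTop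
        (𝓝 (∫ z, f (predPoint hP.filtration (ω, z)) ∂(π.restrict domain))) := by
    intro π ω hi
    have e : ∀ n, ∫ z, F n (predPoint hP.filtration (ω, z)) ∂(π.restrict (window n))
        = ∫ z, (window n).indicator (fun z => F n (predPoint hP.filtration (ω, z))) z
          ∂(π.restrict domain) := by
      intro n
      rw [integral_indicator (measurableSet_window n),
        Measure.restrict_restrict_of_subset (window_subset_domain n)]
    simp only [e]
    refine tendsto_integral_of_dominated_convergence
      (fun z => ‖f (predPoint hP.filtration (ω, z))‖) (fun n => ?_) hi.norm
      (fun n => ae_of_all _ fun z => ?_) ?_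
    · exact ((((hF n).comp (measurable_predPoint _)).comp
        measurable_prodMk_left).indicator (measurableSet_window n)).aestronglyMeasurable
    · refine (norm_indicator_le_norm_self _ _).trans (hFf n _)
    · refine (ae_restrict_iff' measurableSet_domain).2 (ae_of_all _ fun z hz => ?_)
      refine tendsto_const_nhds.congr' ?_
      rw [← iUnion_window] at hz
      obtain ⟨N, hN⟩ := mem_iUnion.1 hz
      filter_upwards [hFlim (predPoint hP.filtration (ω, z)), eventually_ge_atTop N] with n h1 h2
      rw [indicator_of_mem (monotone_window h2 hN), h1]
  -- The compensation formula transfers the finite expected absolute integral from the intensity to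
  -- P, so the integral against P converges almost surely.
  have hPfin : ∀ᵐ ω ∂μ, Integrable (fun z => f (predPoint hP.filtration (ω, z)))
      ((P ω).restrict domain) := by
    have h1 := hP.lintegral_kernel_predPoint (H := fun x => ‖f x‖ₑ) (by fun_prop)
    have h2 := ae_lt_top (Measurable.lintegral_kernel_prod_right' (κ := hP.kernel)
      (f := fun p => ‖f (predPoint hP.filtration p)‖ₑ) hm.enorm) (h1.trans_lt hint).ne
    filter_upwards [h2] with ω hω
    exact ⟨(hm.comp measurable_prodMk_left).aestronglyMeasurable, hω⟩
  have hmfin : ∀ᵐ ω ∂μ, Integrable (fun z => f (predPoint hP.filtration (ω, z)))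
      ((pointIntensity ν).restrict domain) := by
    have h2 := ae_lt_top (Measurable.lintegral_prod_right' (ν := (pointIntensity ν).restrict domain)
      (f := fun p => ‖f (predPoint hP.filtration p)‖ₑ) hm.enorm) hint.ne
    filter_upwards [h2] with ω hω
    exact ⟨(hm.comp measurable_prodMk_left).aestronglyMeasurable, hω⟩
  have hmF : ∀ n, Measurable fun p : Ω × ℝ × ℝ × ℝ => F n (predPoint hP.filtration p) := fun n =>
    (hF n).comp (measurable_predPoint _)
  calc ∫⁻ ω, ENNReal.ofReal ((∫ z, f (predPoint _ (ω, z)) ∂((P ω).restrict domain)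
        - ∫ z, f (predPoint _ (ω, z)) ∂((pointIntensity ν).restrict domain)) ^ 2) ∂μ
      = ∫⁻ ω, liminf (fun n => ENNReal.ofReal
          ((∫ z, F n (predPoint _ (ω, z)) ∂((P ω).restrict (window n))
          - ∫ z, F n (predPoint _ (ω, z)) ∂((pointIntensity ν).restrict (window n))) ^ 2))
          atTop ∂μ := by
        refine lintegral_congr_ae ?_
        filter_upwards [hPfin, hmfin] with ω h1 h2
        exact (Tendsto.liminf_eq (ENNReal.tendsto_ofReal
          (((hlim _ ω h1).sub (hlim _ ω h2)).pow 2))).symm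
    _ ≤ liminf (fun n => ∫⁻ ω, ENNReal.ofReal
          ((∫ z, F n (predPoint _ (ω, z)) ∂((P ω).restrict (window n))
          - ∫ z, F n (predPoint _ (ω, z)) ∂((pointIntensity ν).restrict (window n))) ^ 2) ∂μ)
          atTop := by
        refine lintegral_liminf_le fun n => ?_
        have m1 : Measurable fun ω =>
            ∫ z, F n (predPoint hP.filtration (ω, z)) ∂((P ω).restrict (window n)) := by
          simp only [← hP.windowKernel_apply]
          exact ((hmF n).stronglyMeasurable.integral_kernel_prod_right').measurable
        have m2 : Measurable fun ω => ∫ z, F n (predPoint hP.filtration (ω, z))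
            ∂((pointIntensity ν).restrict (window n)) :=
          ((hmF n).stronglyMeasurable.integral_prod_right').measurable
        fun_prop
    _ ≤ liminf (fun _ : ℕ => ∫⁻ ω, ∫⁻ z, ENNReal.ofReal (f (predPoint _ (ω, z)) ^ 2)
          ∂((pointIntensity ν).restrict domain) ∂μ) atTop := by
        refine liminf_le_liminf (Eventually.of_forall fun n => ?_)
        rw [hP.integral_sq_window n (hF n) (hFn n)]
        refine lintegral_mono fun ω => lintegral_mono'
          (Measure.restrict_mono (window_subset_domain n) le_rfl) fun z => ?_
        exact ENNReal.ofReal_le_ofReal (sq_le_sq.2 (hFf n _))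
    _ = _ := by simp

end HawkesRisk

/-! ### Sums over accepted points, and predictability of the accumulated mass -/

namespace HawkesRisk

variable {Ω : Type*} {mΩ : MeasurableSpace Ω} {μ : Measure Ω} {ν : Measure ℝ}
  {P : Ω → Measure (ℝ × ℝ × ℝ)}

/-- A finite-valued function is integrable over a set which contains finitely many points of the
configuration. -/
theorem setLIntegral_configuration_lt_top {α : Type*} [MeasurableSpace α] {π : Measure α}
    (hπ : ∃ (s : Set ℕ) (x : ℕ → α), π = Measure.sum fun i : s => Measure.dirac (x i))
    {A : Set α} (hA : MeasurableSet A) (hAfin : π A < ∞) {f : α → ℝ≥0∞} (hf : Measurable f)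
    (hfin : ∀ z, f z ≠ ∞) : ∫⁻ z in A, f z ∂π < ∞ := by
  obtain ⟨s, x, rfl⟩ := hπ
  have h1 : ∀ i : s, A.indicator (1 : α → ℝ≥0∞) (x i) = Measure.dirac (x i) A := fun i =>
    (Measure.dirac_apply' _ hA).symm
  rw [Measure.sum_apply _ hA] at hAfin
  -- Each Dirac mass gives A the value 0 or 1, so a finite total leaves only finitely many points in
  -- A.
  have hS : {i : s | (1 : ℝ≥0∞) ≤ Measure.dirac (x i) A}.Finite :=
    ENNReal.finite_const_le_of_tsum_ne_top hAfin.ne one_ne_zero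
  rw [← lintegral_indicator hA, lintegral_sum_measure]
  simp only [lintegral_dirac' _ (hf.indicator hA)]
  rw [tsum_eq_sum (s := hS.toFinset)]
  · refine ENNReal.sum_lt_top.2 fun i _ => ?_
    by_cases h : x i ∈ A
    · simpa [h] using (hfin _).lt_top
    · simp [h]
  · intro i hi
    refine indicator_of_notMem (fun h => hi ?_) _
    rw [Set.Finite.mem_toFinset, mem_ofPred_eq, ← h1, indicator_of_mem h]
    simp

theorem pointIntensity_restrict_domain (ν : Measure ℝ) [IsProbabilityMeasure ν] :
    (pointIntensity ν).restrict domain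
      = (volume.restrict (Ioi (0 : ℝ))).prod ((volume.restrict (Ici (0 : ℝ))).prod ν) := by
  have h1 : ((volume.restrict (Ici (0 : ℝ))).prod ν).restrict (Ici 0 ×ˢ univ)
      = (volume.restrict (Ici (0 : ℝ))).prod ν := by
    rw [← Measure.prod_restrict, Measure.restrict_restrict measurableSet_Ici, inter_self,
      Measure.restrict_univ]
  rw [pointIntensity, domain, ← Measure.prod_restrict, h1,
    Measure.restrict_restrict_of_subset Ioi_subset_Ici_self]

theorem measurable_time_mk (𝓕 : Filtration ℝ≥0 mΩ) :
    Measurable fun p : Ω × ℝ => PredSpace.mk 𝓕 p.2.toNNReal p.1 :=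
  (PredSpace.measurable_mk 𝓕).comp (f := fun p : Ω × ℝ => (p.2.toNNReal, p.1)) (by fun_prop)

theorem lintegral_domain_mul [IsProbabilityMeasure ν] {k : ℝ × ℝ → ℝ≥0∞} (hk : Measurable k)
    {g : ℝ → ℝ≥0∞} (hg : Measurable g) :
    ∫⁻ z, k (z.1, z.2.1) * g z.2.2 ∂((pointIntensity ν).restrict domain)
      = (∫⁻ s in Ioi (0 : ℝ), ∫⁻ θ in Ici (0 : ℝ), k (s, θ)) * ∫⁻ y, g y ∂ν := by
  rw [pointIntensity_restrict_domain, lintegral_prod _ (by fun_prop),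
    ← lintegral_mul_const _ (Measurable.lintegral_prod_right' hk)]
  refine lintegral_congr fun s => ?_
  rw [lintegral_prod _ (by fun_prop), ← lintegral_mul_const _ (by fun_prop)]
  refine lintegral_congr fun θ => ?_
  exact lintegral_const_mul (k (s, θ)) hg

/-- The compensation formula for integrands of the form `k(s, ω, θ) g(y)`. -/
theorem IsPoissonRandomMeasure.lintegral_kernel_mul [IsProbabilityMeasure μ]
    [IsProbabilityMeasure ν] (hP : IsPoissonRandomMeasure ν P μ)
    {k : PredSpace hP.filtration × ℝ → ℝ≥0∞} (hk : Measurable k) {g : ℝ → ℝ≥0∞}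
    (hg : Measurable g) :
    ∫⁻ ω, ∫⁻ z in domain, k (PredSpace.mk _ z.1.toNNReal ω, z.2.1) * g z.2.2 ∂(P ω) ∂μ
      = (∫⁻ ω, ∫⁻ s in Ioi (0 : ℝ), ∫⁻ θ in Ici (0 : ℝ), k (PredSpace.mk _ s.toNNReal ω, θ) ∂volume ∂volume ∂μ)
        * ∫⁻ y, g y ∂ν := by
  have h := hP.lintegral_kernel_predPoint (H := fun x => k (x.1, x.2.1) * g x.2.2) (by fun_prop)
  simp only [predPoint, hP.kernel_apply] at h
  rw [h, ← lintegral_mul_const]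
  · refine lintegral_congr fun ω => ?_
    refine lintegral_domain_mul (k := fun p => k (PredSpace.mk _ p.1.toNNReal ω, p.2)) ?_ hg
    exact hk.comp (((measurable_time_mk _).comp (measurable_const.prodMk measurable_fst)).prodMk
      measurable_snd)
  · have hm : Measurable fun p : (Ω × ℝ) × ℝ =>
        k (PredSpace.mk hP.filtration p.1.2.toNNReal p.1.1, p.2) :=
      hk.comp (((measurable_time_mk _).comp measurable_fst).prodMk measurable_snd)
    exact (hm.lintegral_prod_right' (ν := volume.restrict (Ici (0 : ℝ)))).lintegral_prod_right'

/-- Integrating out the level turns acceptance into the intensity; a negative a accepts no level, in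
agreement with `ENNReal.ofReal`. -/
theorem lintegral_level_indicator (a : ℝ) :
    ∫⁻ θ in Ici (0 : ℝ), (Iic a).indicator 1 θ = ENNReal.ofReal a := by
  rw [lintegral_indicator_one measurableSet_Iic, Measure.restrict_apply measurableSet_Iic,
    inter_comm, Ici_inter_Iic, Real.volume_Icc, sub_zero]

/-- The compensation formula for the points accepted by a predictable intensity `ℓ`. -/
theorem IsPoissonRandomMeasure.lintegral_accepted [IsProbabilityMeasure μ]
    [IsProbabilityMeasure ν] (hP : IsPoissonRandomMeasure ν P μ)
    {ℓ : PredSpace hP.filtration → ℝ} (hℓ : Measurable ℓ)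
    {φ : PredSpace hP.filtration → ℝ≥0∞} (hφ : Measurable φ) {g : ℝ → ℝ≥0∞} (hg : Measurable g) :
    ∫⁻ ω, ∫⁻ z in domain, φ (PredSpace.mk _ z.1.toNNReal ω)
        * (Iic (ℓ (PredSpace.mk _ z.1.toNNReal ω))).indicator 1 z.2.1 * g z.2.2 ∂(P ω) ∂μ
      = (∫⁻ ω, ∫⁻ s in Ioi (0 : ℝ), φ (PredSpace.mk _ s.toNNReal ω)
          * ENNReal.ofReal (ℓ (PredSpace.mk _ s.toNNReal ω)) ∂volume ∂μ) * ∫⁻ y, g y ∂ν := by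
  have hind : Measurable fun x : PredSpace hP.filtration × ℝ =>
      (Iic (ℓ x.1)).indicator (1 : ℝ → ℝ≥0∞) x.2 := by
    have : (fun x : PredSpace hP.filtration × ℝ => (Iic (ℓ x.1)).indicator (1 : ℝ → ℝ≥0∞) x.2)
        = {x : PredSpace hP.filtration × ℝ | x.2 ≤ ℓ x.1}.indicator 1 := by
      ext x; simp [indicator]
    rw [this]
    exact measurable_one.indicator (measurableSet_le measurable_snd (by fun_prop))
  have h := hP.lintegral_kernel_mul (k := fun x => φ x.1 * (Iic (ℓ x.1)).indicator 1 x.2)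
    ((hφ.comp measurable_fst).mul hind) hg
  rw [h]
  congr 1
  refine lintegral_congr fun ω => lintegral_congr fun s => ?_
  have key : ∀ (a : ℝ≥0∞) (c : ℝ), ∫⁻ θ in Ici (0 : ℝ), a * (Iic c).indicator (1 : ℝ → ℝ≥0∞) θ
      = a * ENNReal.ofReal c := fun a c => by
    rw [lintegral_const_mul a (measurable_one.indicator measurableSet_Iic),
      lintegral_level_indicator]
  exact key (φ (PredSpace.mk _ s.toNNReal ω)) (ℓ (PredSpace.mk _ s.toNNReal ω))

/-- On `[0, t] × Ω` with `𝓕 t`, predictable sets are measurable. -/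
theorem measurable_mk_min (𝓕 : Filtration ℝ≥0 mΩ) (t : ℝ≥0) :
    @Measurable (Ω × ℝ) (PredSpace 𝓕) (@Prod.instMeasurableSpace _ _ (𝓕 t) _) _
      fun p => PredSpace.mk 𝓕 (min p.2.toNNReal t) p.1 := by
  let : MeasurableSpace Ω := 𝓕 t
  have h : Measurable fun p : Ω × ℝ => ((⟨min p.2.toNNReal t, mem_Iic.2 (min_le_right _ _)⟩ : Iic t), p.1) := by
    refine Measurable.prodMk (Measurable.subtype_mk ?_) measurable_fst
    fun_prop
  exact (measurable_inclusion_predictable (𝓕 := 𝓕) (i := t)).comp h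

/-- Capping the time at t changes nothing on (0,t) and makes the integrand jointly measurable for
ℱ_t: predictable processes are progressively measurable. -/
theorem measurable_setLIntegral_pred {𝓕 : Filtration ℝ≥0 mΩ} {ℓ : PredSpace 𝓕 → ℝ≥0∞}
    (hℓ : Measurable ℓ) (t : ℝ≥0) :
    Measurable[𝓕 t] fun ω => ∫⁻ s in Ioo 0 (t : ℝ), ℓ (PredSpace.mk 𝓕 s.toNNReal ω) := by
  have e : (fun ω => ∫⁻ s in Ioo 0 (t : ℝ), ℓ (PredSpace.mk 𝓕 s.toNNReal ω))
      = fun ω => ∫⁻ s in Ioo 0 (t : ℝ), ℓ (PredSpace.mk 𝓕 (min s.toNNReal t) ω) := by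
    funext ω
    refine setLIntegral_congr_fun measurableSet_Ioo fun s hs => ?_
    rw [min_eq_left (Real.toNNReal_le_iff_le_coe.2 hs.2.le)]
  rw [e]
  exact @Measurable.lintegral_prod_right' _ _ (𝓕 t) _ _ _ _ (hℓ.comp (measurable_mk_min 𝓕 t))

theorem stronglyMeasurable_intervalIntegral_pred {𝓕 : Filtration ℝ≥0 mΩ} {ℓ : PredSpace 𝓕 → ℝ}
    (hℓ : Measurable ℓ) (t : ℝ≥0) :
    StronglyMeasurable[𝓕 t] fun ω => ∫ s in (0 : ℝ)..t, ℓ (PredSpace.mk 𝓕 s.toNNReal ω) := by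
  have e : (fun ω => ∫ s in (0 : ℝ)..t, ℓ (PredSpace.mk 𝓕 s.toNNReal ω))
      = fun ω => ∫ s in Ioc 0 (t : ℝ), ℓ (PredSpace.mk 𝓕 (min s.toNNReal t) ω) := by
    funext ω
    rw [intervalIntegral.integral_of_le (NNReal.coe_nonneg t)]
    refine setIntegral_congr_fun measurableSet_Ioc fun s hs => ?_
    rw [min_eq_left (Real.toNNReal_le_iff_le_coe.2 hs.2)]
  rw [e]
  exact @StronglyMeasurable.integral_prod_right' _ _ _ (𝓕 t) _ _ _ _ _ _
    (hℓ.comp (measurable_mk_min 𝓕 t)).stronglyMeasurable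

/-- The time of a point of `PredSpace 𝓕`. -/
def PredSpace.time {𝓕 : Filtration ℝ≥0 mΩ} (x : PredSpace 𝓕) : ℝ≥0 := Prod.fst (β := Ω) x

/-- The outcome of a point of `PredSpace 𝓕`. -/
def PredSpace.outcome {𝓕 : Filtration ℝ≥0 mΩ} (x : PredSpace 𝓕) : Ω := Prod.snd (α := ℝ≥0) x

/-- The event that the predictable `ℓ` has mass at most `c` before the present is predictable. -/
theorem measurableSet_mass_le {𝓕 : Filtration ℝ≥0 mΩ} {ℓ : PredSpace 𝓕 → ℝ≥0∞}
    (hℓ : Measurable ℓ) (c : ℝ≥0∞) :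
    MeasurableSet {x : PredSpace 𝓕 |
      ∫⁻ s in Ioo 0 (x.time : ℝ), ℓ (PredSpace.mk 𝓕 s.toNNReal x.outcome) ≤ c} := by
  -- The mass of the open interval (0,t) is the supremum of the masses of (0,q) over rational q < t.
  -- If it exceeds c it already does so at some such q, and (q,∞) × {mass on (0,q) > c} is a
  -- generator of the predictable σ-algebra.
  have e : {x : PredSpace 𝓕 | ∫⁻ s in Ioo 0 (x.time : ℝ), ℓ (PredSpace.mk 𝓕 s.toNNReal x.outcome) ≤ c}ᶜ
      = ⋃ q : ℚ≥0, PredSpace.box 𝓕 (q : ℝ≥0)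
        {ω | ∫⁻ s in Ioo 0 (((q : ℝ≥0) : ℝ)), ℓ (PredSpace.mk 𝓕 s.toNNReal ω) ≤ c}ᶜ := by
    ext x
    obtain ⟨t, ω, rfl⟩ : ∃ t ω, x = PredSpace.mk 𝓕 t ω := ⟨x.time, x.outcome, rfl⟩
    change ¬ (∫⁻ s in Ioo 0 (t : ℝ), ℓ (PredSpace.mk 𝓕 s.toNNReal ω) ≤ c) ↔ _
    rw [not_le, mem_iUnion]
    constructor
    · intro h
      have hU : Ioo 0 (t : ℝ) = ⋃ q : {q : ℚ≥0 // (q : ℝ≥0) < t}, Ioo 0 (((q : ℚ≥0) : ℝ≥0) : ℝ) := by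
        ext x
        simp only [mem_Ioo, mem_iUnion, exists_and_left]
        constructor
        · rintro ⟨h0, hx⟩
          obtain ⟨q, hq, hq'⟩ := exists_rat_btwn hx
          have hq0 : 0 ≤ q := by
            have : (0 : ℝ) < q := h0.trans hq
            exact_mod_cast this.le
          refine ⟨h0, ⟨⟨⟨q, hq0⟩, ?_⟩, ?_⟩⟩
          · rw [← NNReal.coe_lt_coe]; exact_mod_cast hq'
          · exact_mod_cast hq
        · rintro ⟨h0, q, hq⟩
          exact ⟨h0, hq.trans (by exact_mod_cast q.2)⟩
      rw [hU, setLIntegral_iUnion_of_directed] at h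
      · obtain ⟨q, hq⟩ := lt_iSup_iff.1 h
        exact ⟨q.1, q.2, not_le.2 hq⟩
      · intro p q
        rcases le_total p.1 q.1 with hpq | hpq
        · exact ⟨q, Ioo_subset_Ioo_right (by exact_mod_cast hpq), subset_rfl⟩
        · exact ⟨p, subset_rfl, Ioo_subset_Ioo_right (by exact_mod_cast hpq)⟩
    · rintro ⟨q, hq, hω⟩
      change ¬ (∫⁻ s in Ioo 0 ((q : ℝ≥0) : ℝ), ℓ (PredSpace.mk 𝓕 s.toNNReal ω) ≤ c) at hω
      refine (not_le.1 hω).trans_le (lintegral_mono_set (Ioo_subset_Ioo_right ?_))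
      exact_mod_cast (show (q : ℝ≥0) < t from hq).le
  rw [← MeasurableSet.compl_iff, e]
  refine MeasurableSet.iUnion fun q => PredSpace.measurableSet_box ?_
  exact (measurableSet_le (measurable_setLIntegral_pred hℓ _) measurable_const).compl

/-- Integrating a density only as long as its accumulated mass is at most `c` gives at most `c`. -/
theorem setLIntegral_mass_le (f : ℝ → ℝ≥0∞) (c : ℝ≥0∞) (T : ℝ) :
    ∫⁻ t in {t | t ∈ Ioc 0 T ∧ ∫⁻ s in Ioo 0 t, f s ≤ c}, f t ≤ c := by
  set I := {t | t ∈ Ioc 0 T ∧ ∫⁻ s in Ioo 0 t, f s ≤ c} with hI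
  rcases I.eq_empty_or_nonempty with h | ⟨t₀, ht₀⟩
  · simp [h]
  have hbdd : BddAbove I := ⟨T, fun t ht => ht.1.2⟩
  -- At the last admissible time the mass of (0,τ) is still a supremum of masses at most c, and the
  -- endpoint τ is negligible.
  set τ := sSup I
  obtain ⟨u, hu, hulim, huI⟩ := exists_seq_tendsto_sSup ⟨t₀, ht₀⟩ hbdd
  calc ∫⁻ t in I, f t ≤ ∫⁻ t in Ioc 0 τ, f t :=
        lintegral_mono_set fun t ht => ⟨ht.1.1, le_csSup hbdd ht⟩
    _ = ∫⁻ t in Ioo 0 τ, f t := by rw [restrict_Ioo_eq_restrict_Ioc]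
    _ ≤ c := by
      have hU : Ioo 0 τ = ⋃ n, Ioo 0 (u n) := by
        ext x
        simp only [mem_Ioo, mem_iUnion, exists_and_left]
        constructor
        · rintro ⟨h0, hx⟩
          exact ⟨h0, (hulim.eventually (lt_mem_nhds hx)).exists⟩
        · rintro ⟨h0, n, hn⟩
          exact ⟨h0, hn.trans_le (le_csSup hbdd (huI n))⟩
      rw [hU, setLIntegral_iUnion_of_directed]
      · exact iSup_le fun n => (huI n).2
      · exact (show Monotone fun n => Ioo 0 (u n) from
          fun m n hmn => Ioo_subset_Ioo_right (hu hmn)).directed_le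

end HawkesRisk

/-! ### Compensation along time sets, and integrals of causal kernels -/

namespace HawkesRisk

variable {Ω : Type*} {mΩ : MeasurableSpace Ω} {μ : Measure Ω} {ν : Measure ℝ}
  {P : Ω → Measure (ℝ × ℝ × ℝ)}

/-- The path `s ↦ ℓ(s, ω)` of a function on `PredSpace 𝓕`. -/
def path {𝓕 : Filtration ℝ≥0 mΩ} {E : Type*} (ℓ : PredSpace 𝓕 → E) (ω : Ω) (s : ℝ) : E :=
  ℓ (PredSpace.mk 𝓕 s.toNNReal ω)

theorem measurable_uncurry_path {𝓕 : Filtration ℝ≥0 mΩ} {E : Type*} [MeasurableSpace E]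
    {ℓ : PredSpace 𝓕 → E} (hℓ : Measurable ℓ) : Measurable (Function.uncurry (path ℓ)) :=
  hℓ.comp (measurable_time_mk 𝓕)

theorem measurable_path {𝓕 : Filtration ℝ≥0 mΩ} {E : Type*} [MeasurableSpace E]
    {ℓ : PredSpace 𝓕 → E} (hℓ : Measurable ℓ) (ω : Ω) : Measurable (path ℓ ω) :=
  (measurable_uncurry_path hℓ).comp measurable_prodMk_left

theorem measurableSet_accepted {I : Set ℝ} (hI : MeasurableSet I) {f : ℝ → ℝ} (hf : Measurable f) :
    MeasurableSet (accepted I f) :=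
  (measurable_fst hI).inter ((measurable_snd (measurable_fst measurableSet_Ici)).inter
    (measurableSet_le measurable_snd.fst (hf.comp measurable_fst)))

theorem accepted_subset_domain {I : Set ℝ} (hI : I ⊆ Ioi 0) (f : ℝ → ℝ) :
    accepted I f ⊆ domain := fun _ hz => ⟨hI hz.1, hz.2.1, trivial⟩

theorem accepted_congr {I : Set ℝ} {f g : ℝ → ℝ} (h : EqOn f g I) :
    accepted I f = accepted I g := by
  ext z
  refine and_congr_right fun hz => and_congr_right fun _ => ?_
  rw [h hz]

theorem accepted_mono {I J : Set ℝ} (h : I ⊆ J) (f : ℝ → ℝ) : accepted I f ⊆ accepted J f :=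
  fun _ hz => ⟨h hz.1, hz.2⟩

theorem setLIntegral_accepted {I : Set ℝ} (hI : MeasurableSet I) (hI0 : I ⊆ Ioi 0) {f : ℝ → ℝ}
    (hf : Measurable f) (π : Measure (ℝ × ℝ × ℝ)) (F : ℝ × ℝ × ℝ → ℝ≥0∞) :
    ∫⁻ z in accepted I f, F z ∂π
      = ∫⁻ z in domain, I.indicator 1 z.1 * (Iic (f z.1)).indicator 1 z.2.1 * F z ∂π := by
  rw [← Measure.restrict_restrict_of_subset (accepted_subset_domain hI0 f),
    ← lintegral_indicator (measurableSet_accepted hI hf)]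
  refine setLIntegral_congr_fun measurableSet_domain fun z hz => ?_
  have h0 : 0 ≤ z.2.1 := hz.2.1
  by_cases h1 : z.1 ∈ I <;> by_cases h2 : z.2.1 ≤ f z.1 <;>
    simp [accepted, indicator, h1, h2, h0]

theorem measurable_time (𝓕 : Filtration ℝ≥0 mΩ) :
    Measurable fun x : PredSpace 𝓕 => (x.time : ℝ) := by
  refine measurable_of_Ioi fun a => ?_
  rcases lt_or_ge a 0 with ha | ha
  · convert! MeasurableSet.univ
    exact eq_univ_of_forall fun x => lt_of_lt_of_le ha (NNReal.coe_nonneg x.time)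
  · convert! PredSpace.measurableSet_box (𝓕 := 𝓕) (t := ⟨a, ha⟩) MeasurableSet.univ
    ext x
    change a < x.time ↔ (⟨a, ha⟩ : ℝ≥0) < x.time ∧ True
    exact ⟨fun h => ⟨h, trivial⟩, fun h => h.1⟩

/-- The compensation formula for the points accepted by a predictable intensity, with times in
a set `I`. -/
theorem IsPoissonRandomMeasure.setLIntegral_accepted [IsProbabilityMeasure μ]
    [IsProbabilityMeasure ν] (hP : IsPoissonRandomMeasure ν P μ)
    {ℓ : PredSpace hP.filtration → ℝ} (hℓ : Measurable ℓ) {I : Set ℝ} (hI : MeasurableSet I)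
    (hI0 : I ⊆ Ioi 0)
    {φ : PredSpace hP.filtration → ℝ≥0∞} (hφ : Measurable φ) {g : ℝ → ℝ≥0∞} (hg : Measurable g) :
    ∫⁻ ω, ∫⁻ z in accepted I (path ℓ ω), path φ ω z.1 * g z.2.2 ∂(P ω) ∂μ
      = (∫⁻ ω, ∫⁻ s in I, path φ ω s * ENNReal.ofReal (path ℓ ω s) ∂volume ∂μ)
        * ∫⁻ y, g y ∂ν := by
  have h := hP.lintegral_accepted hℓ (φ := fun x => I.indicator 1 (x.time : ℝ) * φ x)
    (((measurable_one.indicator hI).comp (measurable_time _)).mul hφ) hg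
  have hpt : ∀ s : ℝ, 0 ≤ s → ∀ ω, ((PredSpace.mk hP.filtration s.toNNReal ω).time : ℝ) = s :=
    fun s hs _ => Real.coe_toNNReal s hs
  convert! h using 1
  · refine lintegral_congr fun ω => ?_
    rw [HawkesRisk.setLIntegral_accepted hI hI0 (measurable_path hℓ ω)]
    refine setLIntegral_congr_fun measurableSet_domain fun z hz => ?_
    simp only [hpt z.1 (le_of_lt hz.1), path]
    ring
  · congr 1
    refine lintegral_congr fun ω => ?_
    rw [← Measure.restrict_restrict_of_subset hI0, ← lintegral_indicator hI]
    refine setLIntegral_congr_fun measurableSet_Ioi fun s hs => ?_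
    simp only [hpt s (le_of_lt hs), path]
    by_cases hs' : s ∈ I <;> simp [hs']

theorem setLIntegral_shift_le (h : ℝ → ℝ) (T s : ℝ) (hs : 0 ≤ s) :
    ∫⁻ t in Ioc s T, ‖h (t - s)‖ₑ ≤ ∫⁻ t in Ioc 0 T, ‖h t‖ₑ := by
  calc ∫⁻ t in Ioc s T, ‖h (t - s)‖ₑ
      = ∫⁻ t, (Ioc 0 (T - s)).indicator (fun u => ‖h u‖ₑ) (t - s) := by
        rw [← lintegral_indicator measurableSet_Ioc]
        refine lintegral_congr fun t => ?_
        by_cases ht : t ∈ Ioc s T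
        · rw [indicator_of_mem ht, indicator_of_mem
            (show t - s ∈ Ioc 0 (T - s) from ⟨by linarith [ht.1], by linarith [ht.2]⟩)]
        · rw [indicator_of_notMem ht, indicator_of_notMem]
          rintro ⟨h1, h2⟩
          exact ht ⟨by linarith, by linarith⟩
    _ = ∫⁻ t in Ioc 0 (T - s), ‖h t‖ₑ := by
        rw [lintegral_sub_right_eq_self, lintegral_indicator measurableSet_Ioc]
    _ ≤ _ := lintegral_mono_set (Ioc_subset_Ioc_right (by linarith))

/-- Young's inequality for a causal convolution: exchange the integrals, then translate h. -/
theorem lintegral_convolution_le {h : ℝ → ℝ} (hh : Measurable h) {g : ℝ → ℝ≥0∞} (hg : Measurable g)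
    (T : ℝ) :
    ∫⁻ t in Ioc 0 T, ∫⁻ s in Ioo 0 t, ‖h (t - s)‖ₑ * g s
      ≤ (∫⁻ t in Ioc 0 T, ‖h t‖ₑ) * ∫⁻ s in Ioc 0 T, g s := by
  have hk : Measurable fun p : ℝ × ℝ => {p : ℝ × ℝ | p.2 < p.1}.indicator
      (fun p => ‖h (p.1 - p.2)‖ₑ * g p.2) p :=
    (show Measurable fun p : ℝ × ℝ => ‖h (p.1 - p.2)‖ₑ * g p.2 by fun_prop).indicator
      (measurableSet_lt measurable_snd measurable_fst)
  calc ∫⁻ t in Ioc 0 T, ∫⁻ s in Ioo 0 t, ‖h (t - s)‖ₑ * g s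
      = ∫⁻ t in Ioc 0 T, ∫⁻ s in Ioc 0 T, {p : ℝ × ℝ | p.2 < p.1}.indicator
          (fun p => ‖h (p.1 - p.2)‖ₑ * g p.2) (t, s) := by
        refine setLIntegral_congr_fun measurableSet_Ioc fun t ht => ?_
        rw [← lintegral_indicator measurableSet_Ioo, ← lintegral_indicator measurableSet_Ioc]
        refine lintegral_congr fun s => ?_
        by_cases h1 : s < t <;> by_cases h2 : 0 < s <;> by_cases h3 : s ≤ T <;>
          simp [indicator, h1, h2, h3]
        exact absurd (h1.le.trans ht.2) h3
    _ = ∫⁻ s in Ioc 0 T, ∫⁻ t in Ioc 0 T, {p : ℝ × ℝ | p.2 < p.1}.indicator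
          (fun p => ‖h (p.1 - p.2)‖ₑ * g p.2) (t, s) :=
        lintegral_lintegral_swap hk.aemeasurable
    _ ≤ ∫⁻ s in Ioc 0 T, (∫⁻ t in Ioc 0 T, ‖h t‖ₑ) * g s := by
        refine setLIntegral_mono' measurableSet_Ioc fun s hs => ?_
        calc ∫⁻ t in Ioc 0 T, {p : ℝ × ℝ | p.2 < p.1}.indicator
              (fun p => ‖h (p.1 - p.2)‖ₑ * g p.2) (t, s)
            = ∫⁻ t in Ioc s T, ‖h (t - s)‖ₑ * g s := by
              rw [← lintegral_indicator measurableSet_Ioc, ← lintegral_indicator measurableSet_Ioc]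
              refine lintegral_congr fun t => ?_
              by_cases h1 : s < t <;> by_cases h2 : 0 < t <;> by_cases h3 : t ≤ T <;>
                simp [indicator, h1, h2, h3]
              exact absurd (hs.1.trans h1) h2
          _ = (∫⁻ t in Ioc s T, ‖h (t - s)‖ₑ) * g s := lintegral_mul_const _ (by fun_prop)
          _ ≤ _ := mul_le_mul' (setLIntegral_shift_le h T s hs.1.le) le_rfl
    _ = _ := lintegral_const_mul _ hg

theorem measurable_past_integrand {κ : ℝ × ℝ → ℝ≥0∞} (hκ : Measurable κ) {β : ℝ → ℝ≥0∞}
    (hβ : Measurable β) : Measurable fun p : ℝ × ℝ × ℝ × ℝ =>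
      {p : ℝ × ℝ × ℝ × ℝ | p.2.1 < p.1}.indicator (fun p => κ (p.1, p.2.1) * β p.2.2.2) p :=
  (show Measurable fun p : ℝ × ℝ × ℝ × ℝ => κ (p.1, p.2.1) * β p.2.2.2 by
    fun_prop).indicator (measurableSet_lt (by fun_prop) measurable_fst)

theorem setLIntegral_inter_lt (π : Measure (ℝ × ℝ × ℝ)) (E : Set (ℝ × ℝ × ℝ)) (t : ℝ)
    (κ : ℝ × ℝ → ℝ≥0∞) (β : ℝ → ℝ≥0∞) :
    ∫⁻ z in E ∩ {z | z.1 < t}, κ (t, z.1) * β z.2.2 ∂π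
      = ∫⁻ z in E, {p : ℝ × ℝ × ℝ × ℝ | p.2.1 < p.1}.indicator
          (fun p => κ (p.1, p.2.1) * β p.2.2.2) (t, z) ∂π := by
  have hmt : MeasurableSet {z : ℝ × ℝ × ℝ | z.1 < t} :=
    measurableSet_lt measurable_fst measurable_const
  rw [inter_comm, ← Measure.restrict_restrict hmt, ← lintegral_indicator hmt]
  refine lintegral_congr fun z => ?_
  by_cases hz : z.1 < t <;> simp [indicator, hz]

theorem measurable_sum_past {π : Measure (ℝ × ℝ × ℝ)} {E : Set (ℝ × ℝ × ℝ)} (hfin : π E < ∞)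
    {κ : ℝ × ℝ → ℝ≥0∞} (hκ : Measurable κ) {β : ℝ → ℝ≥0∞} (hβ : Measurable β) :
    Measurable fun t => ∫⁻ z in E ∩ {z | z.1 < t}, κ (t, z.1) * β z.2.2 ∂π := by
  have hfinE : IsFiniteMeasure (π.restrict E) := ⟨by simpa using hfin⟩
  simp only [setLIntegral_inter_lt]
  exact (measurable_past_integrand hκ hβ).lintegral_prod_right'

/-- Integrating over time a sum over past points of a kernel of mass at most `C`. -/
theorem lintegral_sum_past_le {π : Measure (ℝ × ℝ × ℝ)} {T : ℝ} {E : Set (ℝ × ℝ × ℝ)}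
    (hE : MeasurableSet E) (hE0 : ∀ z ∈ E, z.1 ∈ Ioc 0 T) (hfin : π E < ∞)
    {κ : ℝ × ℝ → ℝ≥0∞} (hκ : Measurable κ) {C : ℝ≥0∞}
    (hC : ∀ u ∈ Ioc 0 T, ∫⁻ t in Ioc u T, κ (t, u) ≤ C) {β : ℝ → ℝ≥0∞} (hβ : Measurable β) :
    ∫⁻ t in Ioc 0 T, ∫⁻ z in E ∩ {z | z.1 < t}, κ (t, z.1) * β z.2.2 ∂π
      ≤ C * ∫⁻ z in E, β z.2.2 ∂π := by
  have hfinE : IsFiniteMeasure (π.restrict E) := ⟨by simpa using hfin⟩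
  have hk := measurable_past_integrand hκ hβ
  simp only [setLIntegral_inter_lt]
  calc _ = ∫⁻ z in E, ∫⁻ t in Ioc 0 T, {p : ℝ × ℝ × ℝ × ℝ | p.2.1 < p.1}.indicator
            (fun p => κ (p.1, p.2.1) * β p.2.2.2) (t, z) ∂volume ∂π :=
        lintegral_lintegral_swap hk.aemeasurable
    _ ≤ ∫⁻ z in E, C * β z.2.2 ∂π := by
        refine setLIntegral_mono' hE fun z hz => ?_
        have hz0 := hE0 z hz
        calc ∫⁻ t in Ioc 0 T, {p : ℝ × ℝ × ℝ × ℝ | p.2.1 < p.1}.indicator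
              (fun p => κ (p.1, p.2.1) * β p.2.2.2) (t, z)
            = ∫⁻ t in Ioc z.1 T, κ (t, z.1) * β z.2.2 := by
              rw [← lintegral_indicator measurableSet_Ioc,
                ← lintegral_indicator measurableSet_Ioc]
              refine lintegral_congr fun t => ?_
              by_cases h1 : z.1 < t <;> by_cases h2 : 0 < t <;> by_cases h3 : t ≤ T <;>
                simp [indicator, h1, h2, h3]
              exact absurd (hz0.1.trans h1) h2
          _ = (∫⁻ t in Ioc z.1 T, κ (t, z.1)) * β z.2.2 :=
              lintegral_mul_const _ (hκ.comp measurable_prodMk_right)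
          _ ≤ _ := mul_le_mul' (hC z.1 hz0) le_rfl
    _ = _ := lintegral_const_mul _ (by fun_prop)

theorem accepted_Ioc_inter_lt {t T : ℝ} (ht : t ≤ T) (f : ℝ → ℝ) :
    accepted (Ioc 0 T) f ∩ {z | z.1 < t} = accepted (Ioo 0 t) f := by
  ext z
  constructor
  · rintro ⟨h1, h2⟩
    exact ⟨⟨h1.1.1, h2⟩, h1.2⟩
  · rintro ⟨h1, h2⟩
    exact ⟨⟨⟨h1.1, h1.2.le.trans ht⟩, h2⟩, h1.2⟩

end HawkesRisk

/-! ### Expected mass of a subcritical self-exciting intensity -/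

namespace HawkesRisk

variable {Ω : Type*} {mΩ : MeasurableSpace Ω} {μ : Measure Ω} {ν : Measure ℝ}
  {P : Ω → Measure (ℝ × ℝ × ℝ)}

/-- The indicator that the predictable intensity `ℓ` has accumulated a mass at most `c`. -/
noncomputable def massCutoff {𝓕 : Filtration ℝ≥0 mΩ} (ℓ : PredSpace 𝓕 → ℝ) (c : ℝ≥0∞) :
    PredSpace 𝓕 → ℝ≥0∞ :=
  {x | ∫⁻ s in Ioo 0 (x.time : ℝ), ENNReal.ofReal (path ℓ x.outcome s) ≤ c}.indicator 1

theorem measurable_massCutoff {𝓕 : Filtration ℝ≥0 mΩ} {ℓ : PredSpace 𝓕 → ℝ} (hℓ : Measurable ℓ)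
    (c : ℝ≥0∞) : Measurable (massCutoff ℓ c) :=
  measurable_one.indicator (measurableSet_mass_le hℓ.ennreal_ofReal c)

theorem path_massCutoff {𝓕 : Filtration ℝ≥0 mΩ} (ℓ : PredSpace 𝓕 → ℝ) (c : ℝ≥0∞) (ω : Ω) {t : ℝ}
    (ht : 0 ≤ t) : path (massCutoff ℓ c) ω t
      = {t | ∫⁻ s in Ioo 0 t, ENNReal.ofReal (path ℓ ω s) ≤ c}.indicator 1 t := by
  have h : ((PredSpace.mk 𝓕 t.toNNReal ω).time : ℝ) = t := Real.coe_toNNReal t ht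
  have h' : (PredSpace.mk 𝓕 t.toNNReal ω).outcome = ω := rfl
  by_cases hm : ∫⁻ s in Ioo 0 t, ENNReal.ofReal (path ℓ ω s) ≤ c
  · rw [path, massCutoff, indicator_of_mem, indicator_of_mem (by exact hm)]
    · rfl
    · rw [mem_ofPred_eq, h, h']
      exact hm
  · rw [path, massCutoff, indicator_of_notMem, indicator_of_notMem (by exact hm)]
    rw [mem_ofPred_eq, h, h']
    exact hm

theorem lintegral_massCutoff_le {𝓕 : Filtration ℝ≥0 mΩ} {ℓ : PredSpace 𝓕 → ℝ} (hℓ : Measurable ℓ)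
    (c : ℝ≥0∞) (ω : Ω) (T : ℝ) :
    ∫⁻ t in Ioc 0 T, path (massCutoff ℓ c) ω t * ENNReal.ofReal (path ℓ ω t) ≤ c := by
  have hm := (measurable_path (measurable_massCutoff hℓ c) ω) (measurableSet_singleton 1)
  refine le_trans (le_of_eq ?_)
    (setLIntegral_mass_le (fun s => ENNReal.ofReal (path ℓ ω s)) c T)
  have hset : {t | t ∈ Ioc 0 T ∧ ∫⁻ s in Ioo 0 t, ENNReal.ofReal (path ℓ ω s) ≤ c}
      = Ioc 0 T ∩ path (massCutoff ℓ c) ω ⁻¹' {1} := by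
    ext t
    simp only [mem_ofPred_eq, mem_inter_iff, mem_preimage, mem_singleton_iff]
    refine and_congr_right fun ht => ?_
    rw [path_massCutoff ℓ c ω ht.1.le]
    simp [indicator]
  rw [hset, ← lintegral_indicator measurableSet_Ioc,
    ← lintegral_indicator (measurableSet_Ioc.inter hm)]
  refine lintegral_congr fun t => ?_
  by_cases ht : t ∈ Ioc 0 T
  · by_cases ht' : path (massCutoff ℓ c) ω t = 1
    · rw [indicator_of_mem ht, indicator_of_mem
        (show t ∈ Ioc 0 T ∩ path (massCutoff ℓ c) ω ⁻¹' {1} from ⟨ht, ht'⟩), ht', one_mul]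
    · rw [indicator_of_mem ht, indicator_of_notMem fun h => ht' h.2]
      rw [path_massCutoff ℓ c ω ht.1.le] at ht' ⊢
      rw [indicator_of_notMem, zero_mul]
      intro h
      exact ht' (by rw [indicator_of_mem h]; rfl)
  · rw [indicator_of_notMem ht, indicator_of_notMem fun h => ht h.1]

/-- The total mass of a path is finite when it is driven by finitely many accepted points. -/
theorem IsPoissonRandomMeasure.setLIntegral_path_lt_top
    (hP : IsPoissonRandomMeasure ν P μ)
    {f : ℝ → ℝ} (hf : Measurable f) {h : ℝ → ℝ} (hh : Measurable h)
    {β : ℝ → ℝ≥0∞} (hβ : Measurable β) (hβfin : ∀ y, β y ≠ ∞) {a L : ℝ≥0∞} (ha : a ≠ ∞)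
    (hL : L ≠ ∞) {T : ℝ} (hH : ∫⁻ t in Ioc 0 T, ‖h t‖ₑ ≠ ∞) (ω : Ω)
    (h1 : ∀ t ∈ Ioc 0 T, ENNReal.ofReal (f t) ≤ a
      + L * ∫⁻ z in accepted (Ioo 0 t) f, ‖h (t - z.1)‖ₑ * β z.2.2 ∂(P ω))
    (h2 : P ω (accepted (Ioc 0 T) f) < ∞) :
    ∫⁻ t in Ioc 0 T, ENNReal.ofReal (f t) < ∞ := by
  have hA : MeasurableSet (accepted (Ioc 0 T) f) := measurableSet_accepted measurableSet_Ioc hf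
  have hβA := setLIntegral_configuration_lt_top (hP.configuration ω) hA h2
    (f := fun z => β z.2.2) (by fun_prop) fun z => hβfin _
  have key : ∫⁻ t in Ioc 0 T, ∫⁻ z in accepted (Ioo 0 t) f, ‖h (t - z.1)‖ₑ * β z.2.2 ∂(P ω)
      ≤ (∫⁻ t in Ioc 0 T, ‖h t‖ₑ) * ∫⁻ z in accepted (Ioc 0 T) f, β z.2.2 ∂(P ω) := by
    refine le_trans (le_of_eq (setLIntegral_congr_fun measurableSet_Ioc fun t ht => ?_))
      (lintegral_sum_past_le hA (fun z hz => hz.1) h2 (κ := fun p => ‖h (p.1 - p.2)‖ₑ)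
        (by fun_prop) (fun u hu => setLIntegral_shift_le h T u hu.1.le) hβ)
    simp only [accepted_Ioc_inter_lt ht.2]
  calc ∫⁻ t in Ioc 0 T, ENNReal.ofReal (f t)
      ≤ ∫⁻ t in Ioc 0 T, (a
        + L * ∫⁻ z in accepted (Ioo 0 t) f, ‖h (t - z.1)‖ₑ * β z.2.2 ∂(P ω)) :=
        setLIntegral_mono' measurableSet_Ioc h1
    _ = a * volume (Ioc 0 T) + L * ∫⁻ t in Ioc 0 T,
          ∫⁻ z in accepted (Ioo 0 t) f, ‖h (t - z.1)‖ₑ * β z.2.2 ∂(P ω) := by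
        rw [lintegral_add_left measurable_const, setLIntegral_const, lintegral_const_mul' _ _ hL]
    _ ≤ a * volume (Ioc 0 T) + L * ((∫⁻ t in Ioc 0 T, ‖h t‖ₑ)
          * ∫⁻ z in accepted (Ioc 0 T) f, β z.2.2 ∂(P ω)) := by gcongr
    _ < ∞ := by
        refine ENNReal.add_lt_top.2 ⟨ENNReal.mul_lt_top ha.lt_top (by simp), ?_⟩
        exact ENNReal.mul_lt_top hL.lt_top (ENNReal.mul_lt_top hH.lt_top hβA)

/-- The expected total mass of a self-exciting intensity with branching ratio `q < 1`. -/
theorem IsPoissonRandomMeasure.lintegral_intensity_le [IsProbabilityMeasure μ]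
    [IsProbabilityMeasure ν] (hP : IsPoissonRandomMeasure ν P μ)
    {ℓ : PredSpace hP.filtration → ℝ} (hℓ : Measurable ℓ) {h : ℝ → ℝ} (hh : Measurable h)
    {β : ℝ → ℝ≥0∞} (hβ : Measurable β) (hβfin : ∀ y, β y ≠ ∞) {a L q : ℝ≥0∞} (ha : a ≠ ∞)
    (hL : L ≠ ∞) {T : ℝ} (hH : ∫⁻ t in Ioc 0 T, ‖h t‖ₑ ≠ ∞)
    (hq : L * (∫⁻ t in Ioc 0 T, ‖h t‖ₑ) * ∫⁻ y, β y ∂ν ≤ q) (hq1 : q < 1)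
    (h1 : ∀ᵐ ω ∂μ, ∀ t ∈ Ioc 0 T, ENNReal.ofReal (path ℓ ω t) ≤ a
      + L * ∫⁻ z in accepted (Ioo 0 t) (path ℓ ω), ‖h (t - z.1)‖ₑ * β z.2.2 ∂(P ω))
    (h2 : ∀ᵐ ω ∂μ, P ω (accepted (Ioc 0 T) (path ℓ ω)) < ∞) :
    ∫⁻ ω, ∫⁻ t in Ioc 0 T, ENNReal.ofReal (path ℓ ω t) ∂volume ∂μ
      ≤ a * ENNReal.ofReal T / (1 - q) := by
  -- The inequality G ≤ aT + qG is empty when G is infinite. The cutoff keeps the mass at most n and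
  -- stays predictable, so compensation still applies; n is sent to infinity at the end.
  let D : ℕ → PredSpace hP.filtration → ℝ≥0∞ := fun n => massCutoff ℓ n
  have hD : ∀ n, Measurable (D n) := fun n => measurable_massCutoff hℓ _
  let X : ℕ → Ω → ℝ≥0∞ := fun n ω =>
    ∫⁻ t in Ioc 0 T, path (D n) ω t * ENNReal.ofReal (path ℓ ω t)
  have hjoint : ∀ n, Measurable fun p : Ω × ℝ =>
      path (D n) p.1 p.2 * ENNReal.ofReal (path ℓ p.1 p.2) := fun n =>
    (measurable_uncurry_path (hD n)).mul (measurable_uncurry_path hℓ).ennreal_ofReal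
  have hX : ∀ n, Measurable (X n) := fun n => (hjoint n).lintegral_prod_right'
  have hXbound : ∀ n, ∫⁻ ω, X n ω ∂μ ≤ a * ENNReal.ofReal T / (1 - q) := by
    intro n
    let g : ℝ → ℝ≥0∞ := fun t => ∫⁻ ω, path (D n) ω t * ENNReal.ofReal (path ℓ ω t) ∂μ
    have hg : Measurable g := (hjoint n).lintegral_prod_left'
    have hGg : ∫⁻ ω, X n ω ∂μ = ∫⁻ t in Ioc 0 T, g t :=
      lintegral_lintegral_swap (hjoint n).aemeasurable
    have hGfin : ∫⁻ ω, X n ω ∂μ ≠ ∞ := by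
      refine ((lintegral_mono fun ω => lintegral_massCutoff_le hℓ n ω T).trans_lt ?_).ne
      simp
    have hpt : ∀ t ∈ Ioc 0 T, g t ≤ a + L * ((∫⁻ s in Ioo 0 t, ‖h (t - s)‖ₑ * g s)
        * ∫⁻ y, β y ∂ν) := by
      intro t ht
      have hφ : Measurable fun x : PredSpace hP.filtration => D n x * ‖h (t - x.time)‖ₑ :=
        (hD n).mul (hh.comp (measurable_const.sub (measurable_time _))).enorm
      have hpath : ∀ ω s, 0 ≤ s → path (fun x : PredSpace hP.filtration =>
          D n x * ‖h (t - x.time)‖ₑ) ω s = path (D n) ω s * ‖h (t - s)‖ₑ := by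
        intro ω s hs
        have : ((PredSpace.mk hP.filtration s.toNNReal ω).time : ℝ) = s := Real.coe_toNNReal s hs
        simp only [path, this]
      have hcomp := hP.setLIntegral_accepted hℓ measurableSet_Ioo Ioo_subset_Ioi_self hφ hβ
        (I := Ioo 0 t)
      calc g t ≤ ∫⁻ ω, (a + L * ∫⁻ z in accepted (Ioo 0 t) (path ℓ ω),
            path (fun x : PredSpace hP.filtration => D n x * ‖h (t - x.time)‖ₑ) ω z.1
              * β z.2.2 ∂(P ω)) ∂μ := by
            refine lintegral_mono_ae ?_
            filter_upwards [h1] with ω hω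
            -- If the cutoff is 1 at t it is 1 at all earlier times, because the accumulated mass is
            -- nondecreasing. It may therefore be inserted inside the sum over the past; otherwise
            -- the left side vanishes.
            by_cases hm : ∫⁻ s in Ioo 0 t, ENNReal.ofReal (path ℓ ω s) ≤ n
            · have hone : ∀ s, 0 ≤ s → s ≤ t → path (D n) ω s = 1 := by
                intro s hs hst
                rw [path_massCutoff ℓ n ω hs, indicator_of_mem]
                · rfl
                · exact (lintegral_mono_set (Ioo_subset_Ioo_right hst)).trans hm
              rw [hone t ht.1.le le_rfl, one_mul]
              refine (hω t ht).trans (le_of_eq ?_)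
              congr 2
              refine setLIntegral_congr_fun
                (measurableSet_accepted measurableSet_Ioo (measurable_path hℓ ω)) fun z hz => ?_
              simp only [hpath ω z.1 hz.1.1.le, hone z.1 hz.1.1.le hz.1.2.le, one_mul]
            · have : path (D n) ω t = 0 := by
                rw [path_massCutoff ℓ n ω ht.1.le, indicator_of_notMem]
                exact hm
              rw [this, zero_mul]
              exact zero_le
        _ = a + L * ((∫⁻ s in Ioo 0 t, ‖h (t - s)‖ₑ * g s) * ∫⁻ y, β y ∂ν) := by
            rw [lintegral_add_left measurable_const, lintegral_const, measure_univ, mul_one,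
              lintegral_const_mul' _ _ hL, hcomp]
            congr 3
            have hm2 : Measurable fun p : Ω × ℝ => path (D n) p.1 p.2 * ‖h (t - p.2)‖ₑ
                * ENNReal.ofReal (path ℓ p.1 p.2) :=
              ((measurable_uncurry_path (hD n)).mul (by fun_prop)).mul
                (measurable_uncurry_path hℓ).ennreal_ofReal
            calc _ = ∫⁻ ω, ∫⁻ s in Ioo 0 t, path (D n) ω s * ‖h (t - s)‖ₑ
                  * ENNReal.ofReal (path ℓ ω s) ∂volume ∂μ := by
                  refine lintegral_congr fun ω =>
                    setLIntegral_congr_fun measurableSet_Ioo fun s hs => ?_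
                  simp only [hpath ω s hs.1.le]
              _ = ∫⁻ s in Ioo 0 t, ∫⁻ ω, path (D n) ω s * ‖h (t - s)‖ₑ
                  * ENNReal.ofReal (path ℓ ω s) ∂μ := lintegral_lintegral_swap hm2.aemeasurable
              _ = _ := by
                  refine lintegral_congr fun s => ?_
                  rw [← lintegral_const_mul' _ _ enorm_ne_top]
                  refine lintegral_congr fun ω => ?_
                  ring
    have hrec : ∫⁻ ω, X n ω ∂μ ≤ a * ENNReal.ofReal T + q * ∫⁻ ω, X n ω ∂μ := by
      calc ∫⁻ ω, X n ω ∂μ = ∫⁻ t in Ioc 0 T, g t := hGg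
        _ ≤ ∫⁻ t in Ioc 0 T, (a + L * ((∫⁻ s in Ioo 0 t, ‖h (t - s)‖ₑ * g s)
              * ∫⁻ y, β y ∂ν)) := setLIntegral_mono' measurableSet_Ioc hpt
        _ = a * ENNReal.ofReal T + L * ((∫⁻ t in Ioc 0 T, ∫⁻ s in Ioo 0 t, ‖h (t - s)‖ₑ * g s)
              * ∫⁻ y, β y ∂ν) := by
            rw [lintegral_add_left measurable_const, setLIntegral_const, Real.volume_Ioc, sub_zero,
              lintegral_const_mul' _ _ hL, lintegral_mul_const'']
            have hk : Measurable fun p : ℝ × ℝ => (Ioi (0 : ℝ)).indicator 1 p.2 *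
                {p : ℝ × ℝ | p.2 < p.1}.indicator (fun p => ‖h (p.1 - p.2)‖ₑ * g p.2) p :=
              ((measurable_one.indicator measurableSet_Ioi).comp measurable_snd).mul
                ((show Measurable fun p : ℝ × ℝ => ‖h (p.1 - p.2)‖ₑ * g p.2 by
                  fun_prop).indicator (measurableSet_lt measurable_snd measurable_fst))
            refine (hk.lintegral_prod_right' (ν := volume)).aemeasurable.congr ?_
            refine ae_of_all _ fun t => ?_
            simp only
            rw [← lintegral_indicator measurableSet_Ioo]
            refine lintegral_congr fun s => ?_
            by_cases h1 : s < t <;> by_cases h2 : 0 < s <;> simp [indicator, h1, h2]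
        _ ≤ a * ENNReal.ofReal T + L * (((∫⁻ t in Ioc 0 T, ‖h t‖ₑ) * ∫⁻ s in Ioc 0 T, g s)
              * ∫⁻ y, β y ∂ν) := by
            gcongr
            exact lintegral_convolution_le hh hg T
        _ = a * ENNReal.ofReal T + (L * (∫⁻ t in Ioc 0 T, ‖h t‖ₑ) * ∫⁻ y, β y ∂ν)
              * ∫⁻ s in Ioc 0 T, g s := by ring
        _ ≤ a * ENNReal.ofReal T + q * ∫⁻ ω, X n ω ∂μ := by rw [hGg]; gcongr
    -- Finiteness of the cut-off mass is what allows the term with factor q to be absorbed.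
    rw [ENNReal.le_div_iff_mul_le (Or.inl (tsub_pos_of_lt hq1).ne')
      (Or.inl (ENNReal.sub_ne_top ENNReal.one_ne_top)), ENNReal.mul_sub (fun _ _ => hGfin), mul_one]
    rw [mul_comm _ q]
    exact tsub_le_iff_right.2 hrec
  have hmono : Monotone X := by
    intro m n hmn ω
    refine setLIntegral_mono' measurableSet_Ioc fun t ht => mul_le_mul' ?_ le_rfl
    rw [path_massCutoff ℓ m ω ht.1.le, path_massCutoff ℓ n ω ht.1.le]
    refine indicator_le_indicator_of_subset (fun t ht => ?_) (fun _ => zero_le) _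
    exact le_trans (b := (m : ℝ≥0∞)) ht (by exact_mod_cast hmn)
  calc ∫⁻ ω, ∫⁻ t in Ioc 0 T, ENNReal.ofReal (path ℓ ω t) ∂volume ∂μ
      ≤ ∫⁻ ω, ⨆ n, X n ω ∂μ := by
        refine lintegral_mono_ae ?_
        filter_upwards [h1, h2] with ω hω1 hω2
        have hfin := hP.setLIntegral_path_lt_top (measurable_path hℓ ω) hh hβ hβfin ha hL hH ω
          hω1 hω2
        -- Almost every path has finite total mass, so beyond some n the cutoff never acts on it.
        obtain ⟨n, hn⟩ := ENNReal.exists_nat_gt hfin.ne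
        refine le_iSup_of_le n (le_of_eq ?_)
        refine setLIntegral_congr_fun measurableSet_Ioc fun t ht => ?_
        rw [path_massCutoff ℓ n ω ht.1.le, indicator_of_mem]
        · simp
        · exact (lintegral_mono_set (t := Ioc 0 T) fun s hs => ⟨hs.1, hs.2.le.trans ht.2⟩).trans hn.le
    _ = ⨆ n, ∫⁻ ω, X n ω ∂μ := lintegral_iSup hX hmono
    _ ≤ _ := iSup_le hXbound

end HawkesRisk

/-! ### Measurability of thinned integrals, and the discrete intensity as a predictable step process
-/

namespace HawkesRisk

/-- Integrals over past points depend measurably on the counts over product sets of past points. -/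
theorem stronglyMeasurable_integral_past {Ω : Type*} [MeasurableSpace Ω]
    {Q : Ω → Measure (ℝ × ℝ × ℝ)} {t : ℝ}
    (hQ : ∀ (A : Set ℝ) (S : Set (ℝ × ℝ)), MeasurableSet A → A ⊆ Ioc 0 t → MeasurableSet S →
      S ⊆ Ici 0 ×ˢ univ → Measurable fun ω => Q ω (A ×ˢ S))
    (hfin : ∀ ω (c : ℝ), Q ω (Ioc 0 t ×ˢ (Icc 0 c ×ˢ univ)) < ∞)
    {f : Ω × ℝ × ℝ × ℝ → ℝ} (hf : Measurable f) :
    StronglyMeasurable fun ω => ∫ z in Ioc 0 t ×ˢ (Ici 0 ×ˢ univ), f (ω, z) ∂(Q ω) := by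
  set W : ℕ → Set (ℝ × ℝ × ℝ) := fun n => Ioc 0 t ×ˢ (Icc 0 (n : ℝ) ×ˢ univ) with hW
  set D : Set (ℝ × ℝ × ℝ) := Ioc 0 t ×ˢ (Ici 0 ×ˢ univ) with hD
  have mW : ∀ n, MeasurableSet (W n) := fun n =>
    measurableSet_Ioc.prod (measurableSet_Icc.prod .univ)
  have mD : MeasurableSet D := measurableSet_Ioc.prod (measurableSet_Ici.prod .univ)
  have hWD : ⋃ n, W n = D := by
    refine subset_antisymm (iUnion_subset fun n =>
      prod_mono subset_rfl (prod_mono Icc_subset_Ici_self subset_rfl)) fun z hz => ?_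
    obtain ⟨n, hn⟩ := exists_nat_ge z.2.1
    exact mem_iUnion.2 ⟨n, hz.1, ⟨hz.2.1, hn⟩, trivial⟩
  have hmono : Monotone W := fun m n h =>
    prod_mono subset_rfl (prod_mono (Icc_subset_Icc_right (by exact_mod_cast h)) subset_rfl)
  -- On a window the measures are finite, so measurability of the counts over product sets extends
  -- to all measurable sets by a π-λ argument.
  have hmeasW : ∀ n, Measurable fun ω => (Q ω).restrict (W n) := by
    intro n
    have hf : ∀ ω, IsFiniteMeasure ((Q ω).restrict (W n)) := fun ω => ⟨by simpa using hfin ω n⟩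
    have hprod : ∀ (A : Set ℝ) (S : Set (ℝ × ℝ)), MeasurableSet A → MeasurableSet S →
        Measurable fun ω => (Q ω).restrict (W n) (A ×ˢ S) := by
      intro A S hA hS
      simp only [Measure.restrict_apply (hA.prod hS), hW, prod_inter_prod]
      exact hQ _ _ (hA.inter measurableSet_Ioc) inter_subset_right
        (hS.inter (measurableSet_Icc.prod .univ))
        (inter_subset_right.trans (prod_mono Icc_subset_Ici_self subset_rfl))
    refine Measurable.measure_of_isPiSystem generateFrom_prod.symm isPiSystem_prod ?_ ?_
    · rintro _ ⟨A, hA, S, hS, rfl⟩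
      exact hprod A S hA hS
    · simpa only [univ_prod_univ] using hprod univ univ .univ .univ
  have hmeas : Measurable fun ω => (Q ω).restrict D := by
    refine Measure.measurable_of_measurable_coe _ fun A hA => ?_
    have : ∀ ω, (Q ω).restrict D A = ⨆ n, (Q ω).restrict (W n) A := by
      intro ω
      simp only [Measure.restrict_apply hA, ← hWD, inter_iUnion]
      exact (show Monotone fun n => A ∩ W n from
        fun m n h => inter_subset_inter_right _ (hmono h)).measure_iUnion
    simp only [this]
    exact Measurable.iSup fun n => (Measure.measurable_coe hA).comp (hmeasW n)
  let κ : Kernel Ω (ℝ × ℝ × ℝ) := ⟨fun ω => (Q ω).restrict D, hmeas⟩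
  have : IsSFiniteKernel κ := by
    refine isSFiniteKernel_of_cover κ W mW (fun ω => ?_) fun ω n => ?_
    · change (Q ω).restrict D _ = 0
      rw [hWD, Measure.restrict_apply mD.compl, compl_inter_self, measure_empty]
    · exact (Measure.restrict_apply_le _ _).trans_lt (hfin ω n)
  exact hf.stronglyMeasurable.integral_kernel_prod_right' (κ := κ)

variable {Ω : Type*} {mΩ : MeasurableSpace Ω} {μ : Measure Ω} {ν : Measure ℝ}
  {P : Ω → Measure (ℝ × ℝ × ℝ)}

theorem IsPoissonRandomMeasure.measurable_filtration_prod (hP : IsPoissonRandomMeasure ν P μ)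
    {t : ℝ≥0} {A : Set ℝ} (hA : MeasurableSet A) (hAt : A ⊆ Ioc 0 (t : ℝ)) {S : Set (ℝ × ℝ)}
    (hS : MeasurableSet S) (hS0 : S ⊆ Ici 0 ×ˢ univ) :
    Measurable[hP.filtration t] fun ω => P ω (A ×ˢ S) := fun U hU =>
  MeasurableSpace.measurableSet_generateFrom ⟨A, S, U, hA, hAt, hS, hS0, hU, rfl⟩

/-- A thinned integral over past times at an `ℱ_t`-measurable level is `ℱ_t`-measurable. -/
theorem IsPoissonRandomMeasure.stronglyMeasurable_thinnedIntegral
    (hP : IsPoissonRandomMeasure ν P μ) {t : ℝ≥0} {I : Set ℝ} (hI : MeasurableSet I)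
    (hIt : I ⊆ Ioc 0 (t : ℝ)) {l : Ω → ℝ} (hl : Measurable[hP.filtration t] l) {g : ℝ → ℝ}
    (hg : Measurable g) :
    StronglyMeasurable[hP.filtration t]
      fun ω => thinnedIntegral (P ω) I (fun _ => l ω) fun _ y => g y := by
  have e : (fun ω => thinnedIntegral (P ω) I (fun _ => l ω) fun _ y => g y)
      = fun ω => ∫ z in Ioc 0 (t : ℝ) ×ˢ (Ici 0 ×ˢ univ),
        {p : Ω × ℝ × ℝ × ℝ | p.2.1 ∈ I ∧ p.2.2.1 ≤ l p.1}.indicator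
          (fun p => g p.2.2.2) (ω, z) ∂(P ω) := by
    funext ω
    have hsub : accepted I (fun _ => l ω) ⊆ Ioc 0 (t : ℝ) ×ˢ (Ici 0 ×ˢ univ) :=
      fun z hz => ⟨hIt hz.1, hz.2.1, trivial⟩
    have hm : MeasurableSet (accepted I fun _ => l ω) := measurableSet_accepted hI measurable_const
    rw [thinnedIntegral, ← Measure.restrict_restrict_of_subset hsub, ← integral_indicator hm]
    refine setIntegral_congr_fun (measurableSet_Ioc.prod (measurableSet_Ici.prod .univ))
      fun z hz => ?_
    have h0 : 0 ≤ z.2.1 := hz.2.1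
    by_cases h1 : z.1 ∈ I <;> by_cases h2 : z.2.1 ≤ l ω <;>
      simp [accepted, indicator, h0, h1, h2]
  rw [e]
  refine @stronglyMeasurable_integral_past Ω (hP.filtration t) P t
    (fun A S hA hAt hS hS0 => hP.measurable_filtration_prod hA hAt hS hS0) (fun ω c => ?_) _ ?_
  · refine (measure_mono ?_).trans_lt (hP.locallyFinite ω t c)
    exact prod_mono Ioc_subset_Icc_self subset_rfl
  · let : MeasurableSpace Ω := hP.filtration t
    refine Measurable.indicator (by fun_prop) ?_
    exact (measurable_snd.fst hI).inter (measurableSet_le (by fun_prop) (hl.comp measurable_fst))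

/-- The grid time `kΔ`. -/
noncomputable def gridTime (Δ : ℝ) (k : ℕ) : ℝ≥0 := (k : ℝ≥0) * Δ.toNNReal

theorem coe_gridTime {Δ : ℝ} (hΔ : 0 ≤ Δ) (k : ℕ) : (gridTime Δ k : ℝ) = k * Δ := by
  simp [gridTime, hΔ]

theorem gridTime_mono (Δ : ℝ) : Monotone (gridTime Δ) := fun i j hij =>
  mul_le_mul' (by exact_mod_cast hij) le_rfl

theorem IsPoissonRandomMeasure.measurable_binSum (hP : IsPoissonRandomMeasure ν P μ) {Δ : ℝ}
    (hΔ : 0 ≤ Δ) {k : ℕ} (hk : 1 ≤ k) {t : ℝ≥0} (ht : gridTime Δ k ≤ t) {l : Ω → ℝ}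
    (hl : Measurable[hP.filtration t] l) {g : ℝ → ℝ} (hg : Measurable g) :
    Measurable[hP.filtration t] fun ω => binSum (P ω) Δ k (l ω) g := by
  refine (hP.stronglyMeasurable_thinnedIntegral measurableSet_Ioc ?_ hl hg).measurable
  have h1 : (1 : ℝ) ≤ k := by exact_mod_cast hk
  refine Ioc_subset_Ioc (mul_nonneg (by linarith) hΔ) ?_
  rw [← coe_gridTime hΔ]
  exact_mod_cast ht

/-- Only the bins 1, …, n-1 enter, so the level is known at the left end of the bin on which it
acts. For n = 0 the truncated subtraction gives time 0, where the level is the constant ψ(0). -/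
theorem IsPoissonRandomMeasure.measurable_discreteLevel (hP : IsPoissonRandomMeasure ν P μ) {Δ : ℝ}
    (hΔ : 0 ≤ Δ) {h ψ b : ℝ → ℝ} (hψ : Measurable ψ) (hb : Measurable b) (n : ℕ) :
    Measurable[hP.filtration (gridTime Δ (n - 1))] fun ω => discreteLevel (P ω) Δ h ψ b n := by
  induction n using Nat.strong_induction_on with
  | _ n ih =>
    simp only [discreteLevel_eq _ Δ h ψ b n]
    refine hψ.comp (Finset.measurable_sum _ fun k hk => ?_)
    obtain ⟨hk1, hkn⟩ := Finset.mem_Ico.1 hk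
    refine Measurable.const_mul ?_ _
    refine hP.measurable_binSum hΔ hk1 (gridTime_mono Δ (by omega)) ?_ hb
    exact (ih k hkn).mono (hP.filtration.mono (gridTime_mono Δ (by omega))) le_rfl

/-- The discrete-time intensity as a function on `PredSpace`: on `((n-1)Δ, nΔ]` it is `l_n`. -/
noncomputable def stepIntensity (hP : IsPoissonRandomMeasure ν P μ) (Δ : ℝ) (h ψ b : ℝ → ℝ)
    (x : PredSpace hP.filtration) : ℝ :=
  discreteLevel (P x.outcome) Δ h ψ b ⌈(x.time : ℝ) / Δ⌉₊

/-- Bins are open on the left and closed on the right, so the ceiling, not the floor, gives the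
index of the bin containing a time. -/
theorem ceil_div_eq_iff {Δ : ℝ} (hΔ : 0 < Δ) {n : ℕ} (hn : 1 ≤ n) (s : ℝ) :
    ⌈s / Δ⌉₊ = n ↔ s ∈ Ioc (((n : ℝ) - 1) * Δ) (n * Δ) := by
  rw [Nat.ceil_eq_iff (by omega), lt_div_iff₀ hΔ, div_le_iff₀ hΔ, Nat.cast_sub hn, Nat.cast_one,
    mem_Ioc]

/-- Each bin contributes a set (a,c] × F with F in ℱ_a, which is predictable; time 0 forms a
separate slice with the constant value ψ(0). -/
theorem measurable_stepIntensity (hP : IsPoissonRandomMeasure ν P μ) {Δ : ℝ}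
    (hΔ : 0 < Δ) {h ψ b : ℝ → ℝ} (hψ : Measurable ψ) (hb : Measurable b) :
    Measurable (stepIntensity hP Δ h ψ b) := by
  intro U hU
  have e : stepIntensity hP Δ h ψ b ⁻¹' U = ⋃ n : ℕ,
      {x | ⌈(x.time : ℝ) / Δ⌉₊ = n ∧ discreteLevel (P x.outcome) Δ h ψ b n ∈ U} := by
    ext x; simp [stepIntensity]
  rw [e]
  refine MeasurableSet.iUnion fun n => ?_
  rcases Nat.eq_zero_or_pos n with rfl | hn
  · have hN : Measurable fun x : PredSpace hP.filtration => ⌈(x.time : ℝ) / Δ⌉₊ :=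
      ((measurable_time _).div_const Δ).nat_ceil
    have : ∀ π : Measure (ℝ × ℝ × ℝ), discreteLevel π Δ h ψ b 0 = ψ 0 := fun π => by
      rw [discreteLevel_eq]; simp
    simp only [this]
    exact (hN (measurableSet_singleton 0)).inter (MeasurableSet.const _)
  · have hset : {x : PredSpace hP.filtration | ⌈(x.time : ℝ) / Δ⌉₊ = n ∧
        discreteLevel (P x.outcome) Δ h ψ b n ∈ U}
        = (Ioc (gridTime Δ (n - 1)) (gridTime Δ n) ×ˢ
          ((fun ω => discreteLevel (P ω) Δ h ψ b n) ⁻¹' U) : Set (ℝ≥0 × Ω)) := by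
      ext x
      refine and_congr ?_ Iff.rfl
      change _ ↔ gridTime Δ (n - 1) < x.time ∧ x.time ≤ gridTime Δ n
      rw [ceil_div_eq_iff hΔ hn, mem_Ioc, ← NNReal.coe_lt_coe, ← NNReal.coe_le_coe,
        coe_gridTime hΔ.le, coe_gridTime hΔ.le, Nat.cast_sub hn, Nat.cast_one]
    rw [hset]
    exact measurableSet_predictable_Ioc_prod _ _ (hP.measurable_discreteLevel hΔ.le hψ hb n hU)

theorem path_stepIntensity (hP : IsPoissonRandomMeasure ν P μ) (Δ : ℝ) (h ψ b : ℝ → ℝ) (ω : Ω)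
    {s : ℝ} (hs : 0 ≤ s) :
    path (stepIntensity hP Δ h ψ b) ω s = discreteLevel (P ω) Δ h ψ b ⌈s / Δ⌉₊ := by
  have h1 : ((PredSpace.mk hP.filtration s.toNNReal ω).time : ℝ) = s := Real.coe_toNNReal s hs
  simp only [path, stepIntensity, h1]
  rfl

/-- A continuous-time intensity as a function on `PredSpace`. -/
def toPred (𝓕 : Filtration ℝ≥0 mΩ) (lam : ℝ → Ω → ℝ) (x : PredSpace 𝓕) : ℝ := lam x.time x.outcome

theorem path_toPred (𝓕 : Filtration ℝ≥0 mΩ) (lam : ℝ → Ω → ℝ) (ω : Ω) {s : ℝ} (hs : 0 ≤ s) :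
    path (toPred 𝓕 lam) ω s = lam s ω := by
  have h1 : ((PredSpace.mk 𝓕 s.toNNReal ω).time : ℝ) = s := Real.coe_toNNReal s hs
  simp only [path, toPred, h1]
  rfl

theorem accepted_toPred (𝓕 : Filtration ℝ≥0 mΩ) (lam : ℝ → Ω → ℝ) (ω : Ω) {I : Set ℝ}
    (hI : I ⊆ Ici 0) : accepted I (fun s => lam s ω) = accepted I (path (toPred 𝓕 lam) ω) :=
  accepted_congr fun _ hs => (path_toPred 𝓕 lam ω (hI hs)).symm

theorem measurable_toPred {𝓕 : Filtration ℝ≥0 mΩ} {lam : ℝ → Ω → ℝ}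
    (h : IsStronglyPredictable 𝓕 fun (t : ℝ≥0) => lam (t : ℝ)) : Measurable (toPred 𝓕 lam) :=
  StronglyMeasurable.measurable h

/-- A measurable function is integrable over a set with finitely many points. -/
theorem IsPoissonRandomMeasure.integrableOn_of_lt_top (hP : IsPoissonRandomMeasure ν P μ) (ω : Ω)
    {A : Set (ℝ × ℝ × ℝ)} (hA : MeasurableSet A) (hfin : P ω A < ∞) {f : ℝ × ℝ × ℝ → ℝ}
    (hf : Measurable f) : IntegrableOn f A (P ω) :=
  ⟨hf.aestronglyMeasurable, setLIntegral_configuration_lt_top (hP.configuration ω) hA hfin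
    (f := fun z => ‖f z‖ₑ) (by fun_prop) fun _ => enorm_ne_top⟩

/-- The equation of λ sums over [0,t), whereas compensation concerns positive times; this lets the
time 0 be discarded. -/
theorem IsPoissonRandomMeasure.ae_zero_time [IsProbabilityMeasure ν]
    (hP : IsPoissonRandomMeasure ν P μ) : ∀ᵐ ω ∂μ, P ω ({0} ×ˢ univ) = 0 := by
  have hm : MeasurableSet (({0} : Set ℝ) ×ˢ (univ : Set (ℝ × ℝ))) :=
    (measurableSet_singleton 0).prod .univ
  have h0 : pointIntensity ν ({0} ×ˢ univ) = 0 := by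
    rw [← univ_prod_univ, pointIntensity_prod]
    simp
  have h1 := hP.lintegral_apply hm (by rw [h0]; simp)
  rw [h0, lintegral_eq_zero_iff (hP.measurable_apply hm)] at h1
  exact h1

theorem accepted_Ico_ae_eq {π : Measure (ℝ × ℝ × ℝ)} (h0 : π ({0} ×ˢ univ) = 0) (t : ℝ)
    (f : ℝ → ℝ) : accepted (Ico 0 t) f =ᵐ[π] accepted (Ioo 0 t) f := by
  refine (ae_eq_set).2 ⟨measure_mono_null ?_ h0, ?_⟩
  · rintro z ⟨hz, hz'⟩
    refine ⟨?_, trivial⟩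
    by_contra hne
    exact hz' ⟨⟨lt_of_le_of_ne hz.1.1 (Ne.symm hne), hz.1.2⟩, hz.2⟩
  · rw [sdiff_eq_empty.2 (accepted_mono Ioo_subset_Ico_self f), measure_empty]

end HawkesRisk

/-! ### Both intensities as solutions of one fixed-point equation, and the compensated risks -/

namespace HawkesRisk

theorem ofReal_le_add_enorm {L : ℝ≥0} {ψ : ℝ → ℝ} (hψ : LipschitzWith L ψ) (x : ℝ) :
    ENNReal.ofReal (ψ x) ≤ ENNReal.ofReal (ψ 0) + L * ‖x‖ₑ := by
  have h1 : ψ x ≤ ψ 0 + L * |x| := by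
    have h := hψ.dist_le_mul x 0
    rw [Real.dist_eq, dist_zero_right, Real.norm_eq_abs] at h
    linarith [le_abs_self (ψ x - ψ 0)]
  calc ENNReal.ofReal (ψ x) ≤ ENNReal.ofReal (ψ 0 + L * |x|) := ENNReal.ofReal_le_ofReal h1
    _ ≤ ENNReal.ofReal (ψ 0) + ENNReal.ofReal (L * |x|) := ENNReal.ofReal_add_le
    _ = _ := by
      rw [ENNReal.ofReal_mul L.coe_nonneg, ENNReal.ofReal_coe_nnreal, ← Real.enorm_eq_ofReal_abs]

theorem lintegral_enorm_eq_ofReal {h : ℝ → ℝ} {s t : ℝ} (hst : s ≤ t)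
    (hi : IntegrableOn h (Ioc s t)) :
    ∫⁻ u in Ioc s t, ‖h u‖ₑ = ENNReal.ofReal (∫ u in s..t, |h u|) := by
  rw [intervalIntegral.integral_of_le hst, ← ofReal_integral_norm_eq_lintegral_enorm hi]
  rfl

theorem mul_lintegral_eq_ofReal_rho {ν : Measure ℝ} (L : ℝ≥0) {h b : ℝ → ℝ} {T : ℝ} (hT : 0 ≤ T)
    (hi : IntegrableOn h (Icc 0 T)) (hb0 : ∀ y, 0 ≤ b y) (hb : Integrable b ν) :
    L * (∫⁻ t in Ioc 0 T, ‖h t‖ₑ) * ∫⁻ y, ENNReal.ofReal (b y) ∂ν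
      = ENNReal.ofReal (rho L ν h b T) := by
  have h0 : 0 ≤ ∫ t in (0 : ℝ)..T, |h t| :=
    intervalIntegral.integral_nonneg hT fun _ _ => abs_nonneg _
  rw [rho, ENNReal.ofReal_mul (by positivity), ENNReal.ofReal_mul (by positivity),
    ENNReal.ofReal_coe_nnreal, lintegral_enorm_eq_ofReal hT (hi.mono_set Ioc_subset_Icc_self),
    ofReal_integral_eq_lintegral_ofReal hb (ae_of_all _ hb0)]

theorem sum_setIntegral_accepted_bins {π : Measure (ℝ × ℝ × ℝ)} {Δ : ℝ} (hΔ : 0 ≤ Δ) {f : ℝ → ℝ}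
    (hf : Measurable f) {F : ℝ × ℝ × ℝ → ℝ}
    (hF : ∀ n : ℕ, IntegrableOn F (accepted (Ioc 0 (n * Δ)) f) π) (n : ℕ) :
    ∑ k ∈ Finset.Icc 1 n, ∫ z in accepted (Ioc (((k : ℝ) - 1) * Δ) (k * Δ)) f, F z ∂π
      = ∫ z in accepted (Ioc 0 (n * Δ)) f, F z ∂π := by
  induction n with
  | zero => simp [accepted]
  | succ n ih =>
    have h1 : accepted (Ioc 0 (((n + 1 : ℕ) : ℝ) * Δ)) f = accepted (Ioc 0 ((n : ℝ) * Δ)) f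
        ∪ accepted (Ioc ((((n + 1 : ℕ) : ℝ) - 1) * Δ) (((n + 1 : ℕ) : ℝ) * Δ)) f := by
      have h2 : Ioc 0 (((n + 1 : ℕ) : ℝ) * Δ) = Ioc 0 ((n : ℝ) * Δ)
          ∪ Ioc ((((n + 1 : ℕ) : ℝ) - 1) * Δ) (((n + 1 : ℕ) : ℝ) * Δ) := by
        have : (((n + 1 : ℕ) : ℝ) - 1) * Δ = n * Δ := by push_cast; ring
        rw [this, Ioc_union_Ioc_eq_Ioc (by positivity)]
        push_cast
        nlinarith
      rw [h2]
      ext z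
      simp only [accepted, mem_union, mem_ofPred_eq]
      tauto
    have hd : Disjoint (accepted (Ioc 0 ((n : ℝ) * Δ)) f)
        (accepted (Ioc ((((n + 1 : ℕ) : ℝ) - 1) * Δ) (((n + 1 : ℕ) : ℝ) * Δ)) f) := by
      refine disjoint_left.2 fun z hz hz' => ?_
      have a1 := hz.1.2
      have a2 := hz'.1.1
      push_cast at a2
      rw [add_sub_cancel_right] at a2
      exact absurd a1 (not_le.2 a2)
    rw [Finset.sum_Icc_succ_top (by omega), ih, h1,
      setIntegral_union hd (measurableSet_accepted measurableSet_Ioc hf) (hF n)]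
    exact (hF (n + 1)).mono_set (h1 ▸ subset_union_right)

variable {Ω : Type*} {mΩ : MeasurableSpace Ω} {μ : Measure Ω} {ν : Measure ℝ}
  {P : Ω → Measure (ℝ × ℝ × ℝ)}

section continuous

variable {T : ℝ} {h ψ b : ℝ → ℝ} {R lam : ℝ → Ω → ℝ}

theorem IsHawkesSolution.path_eq [IsProbabilityMeasure ν] (hP : IsPoissonRandomMeasure ν P μ)
    (hsol : IsHawkesSolution μ P hP.measurable T h ψ b R lam) :
    ∀ᵐ ω ∂μ, ∀ t ∈ Icc 0 T, path (toPred hP.filtration lam) ω t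
      = ψ (∫ z in accepted (Ioo 0 t) (path (toPred hP.filtration lam) ω),
        h (t - z.1) * b z.2.2 ∂(P ω)) := by
  filter_upwards [hsol.intensity_eq, hP.ae_zero_time] with ω hω h0 t ht
  rw [path_toPred _ _ _ ht.1, hω t ht, thinnedIntegral,
    accepted_toPred hP.filtration lam ω Ico_subset_Ici_self,
    setIntegral_congr_set (accepted_Ico_ae_eq h0 t _)]

theorem IsHawkesSolution.accepted_lt_top (hP : IsPoissonRandomMeasure ν P μ)
    (hsol : IsHawkesSolution μ P hP.measurable T h ψ b R lam) :
    ∀ᵐ ω ∂μ, P ω (accepted (Ioc 0 T) (path (toPred hP.filtration lam) ω)) < ∞ := by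
  filter_upwards [hsol.finite_count] with ω hω
  rwa [accepted_toPred hP.filtration lam ω (Ioc_subset_Ioi_self.trans Ioi_subset_Ici_self)] at hω

theorem IsHawkesSolution.lintegral_path_le [IsProbabilityMeasure μ] [IsProbabilityMeasure ν]
    (hP : IsPoissonRandomMeasure ν P μ)
    (hsol : IsHawkesSolution μ P hP.measurable T h ψ b R lam) (hT : 0 ≤ T) {L : ℝ≥0}
    (hψ : LipschitzWith L ψ) (hh : Measurable h) (hi : IntegrableOn h (Icc 0 T))
    (hb : Measurable b) (hb0 : ∀ y, 0 ≤ b y) (hbi : Integrable b ν) {r : ℝ}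
    (hr : rho L ν h b T ≤ r) (hr1 : r < 1) :
    ∫⁻ ω, ∫⁻ t in Ioc 0 T, ENNReal.ofReal (path (toPred hP.filtration lam) ω t) ∂volume ∂μ
      ≤ ENNReal.ofReal (ψ 0) * ENNReal.ofReal T / (1 - ENNReal.ofReal r) := by
  refine hP.lintegral_intensity_le (measurable_toPred hsol.predictable) hh hb.ennreal_ofReal
    (fun _ => ENNReal.ofReal_ne_top) ENNReal.ofReal_ne_top ENNReal.coe_ne_top (L := (L : ℝ≥0∞)) ?_ ?_
    ?_ ?_ (hsol.accepted_lt_top hP)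
  · rw [lintegral_enorm_eq_ofReal hT (hi.mono_set Ioc_subset_Icc_self)]
    exact ENNReal.ofReal_ne_top
  · rw [mul_lintegral_eq_ofReal_rho L hT hi hb0 hbi]
    exact ENNReal.ofReal_le_ofReal hr
  · exact ENNReal.ofReal_lt_one.2 hr1
  · filter_upwards [hsol.path_eq hP] with ω hω t ht
    rw [hω t (Ioc_subset_Icc_self ht)]
    refine (ofReal_le_add_enorm hψ _).trans (add_le_add le_rfl (mul_le_mul' le_rfl ?_))
    refine (enorm_integral_le_lintegral_enorm _).trans (le_of_eq ?_)
    refine lintegral_congr fun z => ?_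
    rw [enorm_mul, Real.enorm_of_nonneg (hb0 _)]

end continuous

section discrete

variable {Δ : ℝ} {h ψ b : ℝ → ℝ}

theorem accepted_bin_eq (hP : IsPoissonRandomMeasure ν P μ) (hΔ : 0 < Δ) (ω : Ω) {k : ℕ}
    (hk : 1 ≤ k) :
    accepted (Ioc (((k : ℝ) - 1) * Δ) (k * Δ)) (fun _ => discreteLevel (P ω) Δ h ψ b k)
      = accepted (Ioc (((k : ℝ) - 1) * Δ) (k * Δ)) (path (stepIntensity hP Δ h ψ b) ω) := by
  refine accepted_congr fun s hs => ?_
  have h1 : (1 : ℝ) ≤ k := by exact_mod_cast hk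
  have hs0 : 0 ≤ s := (mul_nonneg (by linarith) hΔ.le).trans hs.1.le
  rw [path_stepIntensity hP Δ h ψ b ω hs0, (ceil_div_eq_iff hΔ hk s).2 hs]

/-- The level is constant on each bin, so local finiteness applies bin by bin, for every outcome. -/
theorem IsPoissonRandomMeasure.accepted_step_lt_top (hP : IsPoissonRandomMeasure ν P μ)
    (hΔ : 0 < Δ) (ω : Ω) (n : ℕ) :
    P ω (accepted (Ioc 0 (n * Δ)) (path (stepIntensity hP Δ h ψ b) ω)) < ∞ := by
  refine (measure_mono (t := ⋃ k ∈ Finset.Icc 1 n,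
    accepted (Ioc (((k : ℝ) - 1) * Δ) (k * Δ)) (fun _ => discreteLevel (P ω) Δ h ψ b k))
    fun z hz => ?_).trans_lt ?_
  · have h1 : 1 ≤ ⌈z.1 / Δ⌉₊ := Nat.ceil_pos.2 (div_pos hz.1.1 hΔ)
    refine mem_iUnion₂.2 ⟨⌈z.1 / Δ⌉₊, Finset.mem_Icc.2 ⟨h1, ?_⟩, ?_⟩
    · exact Nat.ceil_le.2 ((div_le_iff₀ hΔ).2 hz.1.2)
    · rw [accepted_bin_eq hP hΔ ω h1]
      exact ⟨(ceil_div_eq_iff hΔ h1 _).1 rfl, hz.2⟩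
  · refine measure_biUnion_lt_top (Finset.finite_toSet _) fun k hk => ?_
    have h1 : (1 : ℝ) ≤ k := by exact_mod_cast (Finset.mem_Icc.1 hk).1
    refine (measure_mono fun z hz => ?_).trans_lt
      (hP.locallyFinite ω (k * Δ) (discreteLevel (P ω) Δ h ψ b k))
    exact ⟨⟨(mul_nonneg (by linarith) hΔ.le).trans hz.1.1.le, hz.1.2⟩, hz.2, trivial⟩

theorem IsPoissonRandomMeasure.sum_binSum_eq (hP : IsPoissonRandomMeasure ν P μ)
    (hΔ : 0 < Δ) (hψ : Measurable ψ) (hb : Measurable b) (ω : Ω) (c : ℕ → ℝ) {g : ℝ → ℝ}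
    (hg : Measurable g) (n : ℕ) :
    ∑ k ∈ Finset.Icc 1 n, c k * binSum (P ω) Δ k (discreteLevel (P ω) Δ h ψ b k) g
      = ∫ z in accepted (Ioc 0 (n * Δ)) (path (stepIntensity hP Δ h ψ b) ω),
        c ⌈z.1 / Δ⌉₊ * g z.2.2 ∂(P ω) := by
  have hf := measurable_path (measurable_stepIntensity (h := h) hP hΔ hψ hb) ω
  have hF : Measurable fun z : ℝ × ℝ × ℝ => c ⌈z.1 / Δ⌉₊ * g z.2.2 :=
    ((measurable_from_nat (f := c)).comp (measurable_fst.div_const Δ).nat_ceil).mul (by fun_prop)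
  rw [← sum_setIntegral_accepted_bins hΔ.le hf fun n => hP.integrableOn_of_lt_top ω
    (measurableSet_accepted measurableSet_Ioc hf) (hP.accepted_step_lt_top hΔ ω n) hF]
  refine Finset.sum_congr rfl fun k hk => ?_
  have hk1 := (Finset.mem_Icc.1 hk).1
  rw [binSum, thinnedIntegral, accepted_bin_eq hP hΔ ω hk1, ← integral_const_mul]
  refine setIntegral_congr_fun (measurableSet_accepted measurableSet_Ioc hf) fun z hz => ?_
  simp only [(ceil_div_eq_iff hΔ hk1 _).2 hz.1]

/-- The kernel of the discrete-time intensity, as a function of continuous times. -/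
noncomputable def gridKernel (h : ℝ → ℝ) (Δ s u : ℝ) : ℝ :=
  if ⌈u / Δ⌉₊ < ⌈s / Δ⌉₊ then h (((⌈s / Δ⌉₊ : ℝ) - ⌈u / Δ⌉₊) * Δ) else 0

theorem measurable_uncurry_gridKernel {h : ℝ → ℝ} (hh : Measurable h) (Δ : ℝ) :
    Measurable fun p : ℝ × ℝ => gridKernel h Δ p.1 p.2 := by
  have h1 : Measurable fun p : ℝ × ℝ => ⌈p.1 / Δ⌉₊ := (measurable_fst.div_const Δ).nat_ceil
  have h2 : Measurable fun p : ℝ × ℝ => ⌈p.2 / Δ⌉₊ := (measurable_snd.div_const Δ).nat_ceil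
  refine Measurable.ite (measurableSet_lt h2 h1) (hh.comp ?_) measurable_const
  exact (((measurable_from_nat (f := fun n : ℕ => (n : ℝ))).comp h1).sub
    ((measurable_from_nat (f := fun n : ℕ => (n : ℝ))).comp h2)).mul_const Δ

/-- Each X_k collects the points with ⌈u/Δ⌉ = k, so the recursion is a sum over past accepted
points. Points of the current bin, which the level does not see, get kernel value 0; the discrete
model thus has the form of the continuous equation with another kernel. -/
theorem IsPoissonRandomMeasure.path_step_eq (hP : IsPoissonRandomMeasure ν P μ)
    (hΔ : 0 < Δ) (hψ : Measurable ψ) (hb : Measurable b) (ω : Ω) {s : ℝ} (hs : 0 < s) :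
    path (stepIntensity hP Δ h ψ b) ω s
      = ψ (∫ z in accepted (Ioo 0 s) (path (stepIntensity hP Δ h ψ b) ω),
        gridKernel h Δ s z.1 * b z.2.2 ∂(P ω)) := by
  have hf := measurable_path (measurable_stepIntensity (h := h) hP hΔ hψ hb) ω
  obtain ⟨m, hm⟩ : ∃ m : ℕ, ⌈s / Δ⌉₊ = m + 1 :=
    ⟨⌈s / Δ⌉₊ - 1, (Nat.sub_add_cancel (Nat.ceil_pos.2 (div_pos hs hΔ))).symm⟩
  have hms : m * Δ < s := by
    have := ((ceil_div_eq_iff hΔ (by omega) s).1 hm).1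
    push_cast at this
    rwa [add_sub_cancel_right] at this
  rw [path_stepIntensity hP Δ h ψ b ω hs.le, hm, discreteLevel_eq, Finset.Ico_add_one_right_eq_Icc,
    hP.sum_binSum_eq hΔ hψ hb ω (fun k => h ((((m + 1 : ℕ) : ℝ) - k) * Δ)) hb]
  congr 1
  calc _ = ∫ z in accepted (Ioc 0 (m * Δ)) (path (stepIntensity hP Δ h ψ b) ω),
        gridKernel h Δ s z.1 * b z.2.2 ∂(P ω) := by
        refine setIntegral_congr_fun (measurableSet_accepted measurableSet_Ioc hf) fun z hz => ?_
        have h1 : ⌈z.1 / Δ⌉₊ ≤ m := Nat.ceil_le.2 ((div_le_iff₀ hΔ).2 hz.1.2)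
        simp only [gridKernel]
        rw [hm, if_pos (by omega)]
    _ = _ := by
        -- The points of (mΔ, s) lie in the same bin as s, where `gridKernel` vanishes.
        refine (setIntegral_eq_of_subset_of_forall_sdiff_eq_zero
          (measurableSet_accepted measurableSet_Ioo hf)
          (accepted_mono (Ioc_subset_Ioo_right hms) _) fun z hz => ?_).symm
        rw [gridKernel, if_neg, zero_mul]
        intro hlt
        rw [hm] at hlt
        refine hz.2 ⟨⟨hz.1.1.1, ?_⟩, hz.1.2⟩
        rw [← div_le_iff₀ hΔ]
        exact Nat.ceil_le.1 (Nat.lt_succ_iff.1 hlt)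

/-- No smallness of the branching ratio is needed for finiteness on finitely many bins. By
induction, the level of a new bin is bounded through a b-sum over earlier accepted points, whose
mean is finite by compensation. -/
theorem IsPoissonRandomMeasure.lintegral_path_step_lt_top [IsProbabilityMeasure μ]
    [IsProbabilityMeasure ν] (hP : IsPoissonRandomMeasure ν P μ)
    (hΔ : 0 < Δ) {L : ℝ≥0} (hψ : LipschitzWith L ψ) (hb : Measurable b)
    (hb0 : ∀ y, 0 ≤ b y) (hbi : Integrable b ν) (n : ℕ) :
    ∫⁻ ω, ∫⁻ t in Ioc 0 (n * Δ),
      ENNReal.ofReal (path (stepIntensity hP Δ h ψ b) ω t) ∂volume ∂μ < ∞ := by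
  have hℓ := measurable_stepIntensity (h := h) hP hΔ hψ.continuous.measurable hb
  have hβ : ∫⁻ y, ENNReal.ofReal (b y) ∂ν < ∞ := by
    rw [← ofReal_integral_eq_lintegral_ofReal hbi (ae_of_all _ hb0)]
    exact ENNReal.ofReal_lt_top
  induction n with
  | zero => simp
  | succ n ih =>
    have hsplit : Ioc 0 (((n + 1 : ℕ) : ℝ) * Δ)
        = Ioc 0 ((n : ℝ) * Δ) ∪ Ioc ((n : ℝ) * Δ) (((n + 1 : ℕ) : ℝ) * Δ) := by
      rw [Ioc_union_Ioc_eq_Ioc (by positivity)]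
      push_cast
      nlinarith
    -- A crude bound on every kernel value that can occur: the lags are multiples kΔ with k ≤ n + 1.
    set C : ℝ≥0∞ := ∑ k ∈ Finset.range (n + 2), ‖h (k * Δ)‖ₑ with hC
    have hCtop : C < ∞ := ENNReal.sum_lt_top.2 fun _ _ => enorm_lt_top
    set Z : Ω → ℝ≥0∞ := fun ω => ∫⁻ z in accepted (Ioc 0 (n * Δ))
      (path (stepIntensity hP Δ h ψ b) ω), ENNReal.ofReal (b z.2.2) ∂(P ω) with hZ
    have hZint : ∫⁻ ω, Z ω ∂μ < ∞ := by
      have h1 := hP.setLIntegral_accepted hℓ (measurableSet_Ioc (a := (0 : ℝ)) (b := n * Δ))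
        Ioc_subset_Ioi_self (φ := fun _ => 1) measurable_const hb.ennreal_ofReal
      simp only [path, one_mul] at h1
      rw [hZ]
      simp only
      rw [h1]
      exact ENNReal.mul_lt_top ih hβ
    have hpt : ∀ ω, ∀ t ∈ Ioc ((n : ℝ) * Δ) (((n + 1 : ℕ) : ℝ) * Δ),
        ENNReal.ofReal (path (stepIntensity hP Δ h ψ b) ω t)
          ≤ ENNReal.ofReal (ψ 0) + L * (C * Z ω) := by
      intro ω t ht
      have hf := measurable_path hℓ ω
      have ht0 : 0 < t := lt_of_le_of_lt (by positivity) ht.1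
      have hct : ⌈t / Δ⌉₊ = n + 1 := by
        rw [ceil_div_eq_iff hΔ (by omega)]
        refine ⟨?_, ht.2⟩
        push_cast
        rw [add_sub_cancel_right]
        exact ht.1
      rw [hP.path_step_eq hΔ hψ.continuous.measurable hb ω ht0]
      refine (ofReal_le_add_enorm hψ _).trans (add_le_add le_rfl (mul_le_mul' le_rfl ?_))
      refine (enorm_integral_le_lintegral_enorm _).trans ?_
      rw [hZ, ← lintegral_const_mul' _ _ hCtop.ne]
      rw [← lintegral_indicator (measurableSet_accepted measurableSet_Ioo hf),
        ← lintegral_indicator (measurableSet_accepted measurableSet_Ioc hf)]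
      refine lintegral_mono fun z => ?_
      by_cases hz : z ∈ accepted (Ioo 0 t) (path (stepIntensity hP Δ h ψ b) ω)
      · rw [indicator_of_mem hz]
        by_cases hlt : ⌈z.1 / Δ⌉₊ < ⌈t / Δ⌉₊
        · have hle : ⌈z.1 / Δ⌉₊ ≤ n := by omega
          rw [indicator_of_mem, gridKernel, if_pos hlt, enorm_mul, Real.enorm_of_nonneg (hb0 _)]
          · refine mul_le_mul' ?_ le_rfl
            rw [hct, ← Nat.cast_sub (by omega), hC]
            exact Finset.single_le_sum (f := fun k : ℕ => ‖h (k * Δ)‖ₑ) (fun _ _ => zero_le)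
              (Finset.mem_range.2 (by omega))
          · refine ⟨⟨hz.1.1, ?_⟩, hz.2⟩
            rw [← div_le_iff₀ hΔ]
            exact Nat.ceil_le.1 hle
        · rw [gridKernel, if_neg hlt, zero_mul, enorm_zero]
          exact zero_le
      · rw [indicator_of_notMem hz]
        exact zero_le
    calc _ ≤ ∫⁻ ω, (∫⁻ t in Ioc 0 (n * Δ),
            ENNReal.ofReal (path (stepIntensity hP Δ h ψ b) ω t) ∂volume)
          + (ENNReal.ofReal (ψ 0) + L * (C * Z ω)) * ENNReal.ofReal Δ ∂μ := by
          refine lintegral_mono fun ω => ?_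
          rw [hsplit]
          refine (lintegral_union_le _ _ _).trans (add_le_add le_rfl ?_)
          refine (setLIntegral_mono' measurableSet_Ioc (hpt ω)).trans (le_of_eq ?_)
          rw [setLIntegral_const, Real.volume_Ioc]
          congr 2
          push_cast
          ring
      _ < ∞ := by
          rw [lintegral_add_left, lintegral_mul_const' _ _ ENNReal.ofReal_ne_top,
            lintegral_add_left measurable_const, lintegral_const_mul' _ _ ENNReal.coe_ne_top,
            lintegral_const_mul' _ _ hCtop.ne]
          · refine ENNReal.add_lt_top.2 ⟨ih, ENNReal.mul_lt_top (ENNReal.add_lt_top.2 ⟨?_, ?_⟩)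
              ENNReal.ofReal_lt_top⟩
            · simp
            · exact ENNReal.mul_lt_top ENNReal.coe_lt_top (ENNReal.mul_lt_top hCtop hZint)
          · exact ((measurable_uncurry_path hℓ).ennreal_ofReal).lintegral_prod_right'

end discrete

/-- The compensated sum of the marks of the points accepted by `ℓ` up to time `t`. -/
noncomputable def compensated (ν : Measure ℝ) (P : Ω → Measure (ℝ × ℝ × ℝ)) {𝓕 : Filtration ℝ≥0 mΩ}
    (ℓ : PredSpace 𝓕 → ℝ) (t : ℝ) (ω : Ω) : ℝ :=
  (∫ z in accepted (Ioc 0 t) (path ℓ ω), z.2.2 ∂(P ω))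
    - (∫ y, y ∂ν) * ∫ s in (0 : ℝ)..t, path ℓ ω s

theorem IsHawkesSolution.compensatedRisk_ae_eq (hP : IsPoissonRandomMeasure ν P μ) {T Δ : ℝ}
    {h ψ b : ℝ → ℝ} {R lam : ℝ → Ω → ℝ}
    (hsol : IsHawkesSolution μ P hP.measurable T h ψ b R lam) (hΔ : 0 ≤ Δ) :
    ∀ᵐ ω ∂μ, ∀ k : ℕ, k * Δ ≤ T → compensatedRisk ν Δ R lam k ω
      = compensated ν P (toPred hP.filtration lam) (k * Δ) ω := by
  filter_upwards [hsol.risk_eq] with ω hω k hk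
  have h0 : 0 ≤ k * Δ := by positivity
  rw [compensatedRisk, compensated, hω _ ⟨h0, hk⟩, thinnedIntegral,
    accepted_toPred hP.filtration lam ω (Ioc_subset_Ioi_self.trans Ioi_subset_Ici_self)]
  congr 2
  refine intervalIntegral.integral_congr fun s hs => ?_
  rw [uIcc_of_le h0] at hs
  exact (path_toPred hP.filtration lam ω hs.1).symm

theorem discreteIntensity_mul {π : Measure (ℝ × ℝ × ℝ)} {Δ : ℝ} (hΔ : 0 < Δ) (h ψ b : ℝ → ℝ)
    (k : ℕ) : discreteIntensity π Δ h ψ b (k * Δ) = discreteLevel π Δ h ψ b k := by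
  rw [discreteIntensity, mul_div_cancel_right₀ _ hΔ.ne', Nat.floor_natCast]

theorem IsPoissonRandomMeasure.sum_discreteLevel_eq (hP : IsPoissonRandomMeasure ν P μ) {Δ : ℝ}
    (hΔ : 0 < Δ) (h ψ b : ℝ → ℝ) (ω : Ω) (n : ℕ) :
    IntervalIntegrable (path (stepIntensity hP Δ h ψ b) ω) volume 0 (n * Δ) ∧
    ∑ i ∈ Finset.Icc 1 n, discreteLevel (P ω) Δ h ψ b i * Δ
      = ∫ s in (0 : ℝ)..(n * Δ), path (stepIntensity hP Δ h ψ b) ω s := by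
  induction n with
  | zero => simp
  | succ n ih =>
    have hle : (n : ℝ) * Δ ≤ ((n + 1 : ℕ) : ℝ) * Δ := by
      push_cast
      nlinarith
    have hc : EqOn (fun _ => discreteLevel (P ω) Δ h ψ b (n + 1))
        (path (stepIntensity hP Δ h ψ b) ω) (uIoc ((n : ℝ) * Δ) (((n + 1 : ℕ) : ℝ) * Δ)) := by
      intro s hs
      rw [uIoc_of_le hle] at hs
      have hs0 : 0 ≤ s := le_trans (by positivity) hs.1.le
      simp only
      rw [path_stepIntensity hP Δ h ψ b ω hs0, (ceil_div_eq_iff hΔ (n := n + 1) (by omega) s).2]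
      refine ⟨?_, hs.2⟩
      push_cast
      rw [add_sub_cancel_right]
      exact hs.1
    have hi : IntervalIntegrable (path (stepIntensity hP Δ h ψ b) ω) volume
        ((n : ℝ) * Δ) (((n + 1 : ℕ) : ℝ) * Δ) :=
      (intervalIntegrable_const (c := discreteLevel (P ω) Δ h ψ b (n + 1))).congr hc
    refine ⟨ih.1.trans hi, ?_⟩
    rw [Finset.sum_Icc_succ_top (by omega), ih.2, ← intervalIntegral.integral_add_adjacent_intervals
      ih.1 hi, ← intervalIntegral.integral_congr_ae (ae_of_all _ hc), intervalIntegral.integral_const]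
    congr 1
    push_cast
    rw [smul_eq_mul]
    ring

theorem IsPoissonRandomMeasure.compensatedDiscreteRisk_eq (hP : IsPoissonRandomMeasure ν P μ)
    {Δ : ℝ} (hΔ : 0 < Δ) {h ψ b : ℝ → ℝ} (hψ : Measurable ψ) (hb : Measurable b) (k : ℕ) (ω : Ω) :
    compensatedDiscreteRisk ν P Δ h ψ b k ω
      = compensated ν P (stepIntensity hP Δ h ψ b) (k * Δ) ω := by
  have h1 := hP.sum_binSum_eq (h := h) hΔ hψ hb ω (fun _ => 1) measurable_id k
  simp only [one_mul, id_eq] at h1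
  rw [compensatedDiscreteRisk, compensated, discreteRisk, mul_div_cancel_right₀ _ hΔ.ne',
    Nat.floor_natCast, ← (hP.sum_discreteLevel_eq hΔ h ψ b ω k).2, ← h1]
  simp only [discreteIntensity_mul hΔ]
  rfl

end HawkesRisk

/-! ### Comparison of the kernel h with its grid version -/

namespace HawkesRisk

theorem setLIntegral_Ioc_sub (F : ℝ → ℝ≥0∞) (a c d : ℝ) :
    ∫⁻ t in Ioc a c, F (t - d) = ∫⁻ t in Ioc (a - d) (c - d), F t := by
  rw [← lintegral_indicator measurableSet_Ioc, ← lintegral_indicator measurableSet_Ioc,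
    ← lintegral_sub_right_eq_self ((Ioc (a - d) (c - d)).indicator F) d]
  refine lintegral_congr fun t => ?_
  simp [indicator]

theorem setLIntegral_ceil_div {Δ : ℝ} (hΔ : 0 < Δ) (G : ℕ → ℝ≥0∞) (n : ℕ) :
    ∫⁻ v in Ioc 0 (n * Δ), G ⌈v / Δ⌉₊ = ∑ j ∈ Finset.Icc 1 n, G j * ENNReal.ofReal Δ := by
  induction n with
  | zero => simp
  | succ n ih =>
    have hle : (n : ℝ) * Δ ≤ ((n + 1 : ℕ) : ℝ) * Δ := by
      push_cast
      nlinarith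
    have e : ((n + 1 : ℕ) : ℝ) * Δ - n * Δ = Δ := by
      push_cast
      ring
    rw [Finset.sum_Icc_succ_top (by omega), ← ih, ← Ioc_union_Ioc_eq_Ioc (by positivity) hle,
      lintegral_union measurableSet_Ioc (Ioc_disjoint_Ioc_of_le le_rfl)]
    congr 1
    have hc : EqOn (fun v => G ⌈v / Δ⌉₊) (fun _ => G (n + 1))
        (Ioc ((n : ℝ) * Δ) (((n + 1 : ℕ) : ℝ) * Δ)) := by
      intro v hv
      simp only
      rw [(ceil_div_eq_iff hΔ (n := n + 1) (by omega) v).2]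
      refine ⟨?_, hv.2⟩
      push_cast
      rw [add_sub_cancel_right]
      exact hv.1
    rw [setLIntegral_congr_fun measurableSet_Ioc hc, setLIntegral_const, Real.volume_Ioc, e]

/-- Reindex by the lag n - k. The bin of u has index k ≥ 1, so lags run from 1 to M - 1 and the last
grid value h(MΔ) never enters. -/
theorem setLIntegral_gridKernel_le (h : ℝ → ℝ) {Δ : ℝ} (hΔ : 0 < Δ) (M : ℕ) {u : ℝ} (hu : 0 < u) :
    ∫⁻ s in Ioc 0 (M * Δ), ‖gridKernel h Δ s u‖ₑ
      ≤ ∑ j ∈ Finset.Icc 1 (M - 1), ‖h (j * Δ)‖ₑ * ENNReal.ofReal Δ := by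
  have hk : 1 ≤ ⌈u / Δ⌉₊ := Nat.ceil_pos.2 (div_pos hu hΔ)
  set k := ⌈u / Δ⌉₊
  have h1 : ∀ s, ‖gridKernel h Δ s u‖ₑ
      = (fun n : ℕ => if k < n then ‖h (((n : ℝ) - k) * Δ)‖ₑ else 0) ⌈s / Δ⌉₊ := by
    intro s
    simp only [gridKernel]
    split_ifs <;> simp_all [k]
  simp only [h1]
  rw [setLIntegral_ceil_div hΔ (fun n : ℕ => if k < n then ‖h (((n : ℝ) - k) * Δ)‖ₑ else 0)]
  simp only [ite_mul, zero_mul]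
  rw [← Finset.sum_filter]
  calc _ = ∑ n ∈ (Finset.Icc 1 M).filter (k < ·),
        (fun j : ℕ => ‖h (j * Δ)‖ₑ * ENNReal.ofReal Δ) (n - k) := by
        refine Finset.sum_congr rfl fun n hn => ?_
        simp only
        rw [Nat.cast_sub (Finset.mem_filter.1 hn).2.le]
    _ = ∑ j ∈ ((Finset.Icc 1 M).filter (k < ·)).image (· - k),
          (fun j : ℕ => ‖h (j * Δ)‖ₑ * ENNReal.ofReal Δ) j := by
        refine (Finset.sum_image (g := fun n : ℕ => n - k)
          (f := fun j : ℕ => ‖h (j * Δ)‖ₑ * ENNReal.ofReal Δ) fun a ha b hb hab => ?_).symm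
        have ha := (Finset.mem_filter.1 ha).2
        have hb := (Finset.mem_filter.1 hb).2
        simp only at hab
        omega
    _ ≤ _ := by
        refine Finset.sum_le_sum_of_subset fun j hj => ?_
        obtain ⟨n, hn, rfl⟩ := Finset.mem_image.1 hj
        simp only [Finset.mem_filter, Finset.mem_Icc] at hn ⊢
        omega

/-- Away from the countable set of grid points the ceiling is the floor plus one; at grid points the
two conventions differ. -/
theorem ceil_mul_ae_eq {Δ : ℝ} (hΔ : 0 < Δ) :
    ∀ᵐ v : ℝ, 0 < v → (⌈v / Δ⌉₊ : ℝ) * Δ = gridFloor Δ v + Δ := by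
  have hc : (range fun n : ℕ => (n : ℝ) * Δ).Countable := countable_range _
  filter_upwards [hc.ae_notMem volume] with v hv hv0
  have h1 : 1 ≤ ⌈v / Δ⌉₊ := Nat.ceil_pos.2 (div_pos hv0 hΔ)
  obtain ⟨n, hn⟩ : ∃ n, ⌈v / Δ⌉₊ = n + 1 := ⟨⌈v / Δ⌉₊ - 1, by omega⟩
  have h2 := (ceil_div_eq_iff hΔ (by omega) v).1 hn
  have h3 : v ≠ ((n + 1 : ℕ) : ℝ) * Δ := fun h => hv ⟨n + 1, h.symm⟩
  have h4 : ⌊v / Δ⌋ = (n : ℤ) := by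
    rw [Int.floor_eq_iff, le_div_iff₀ hΔ, div_lt_iff₀ hΔ]
    push_cast at h2 h3 ⊢
    exact ⟨by linarith [h2.1], lt_of_le_of_ne h2.2 h3⟩
  rw [hn, gridFloor, h4]
  push_cast
  ring

section

variable {h : ℝ → ℝ} {T Δ : ℝ}

theorem setLIntegral_add_le (h : ℝ → ℝ) (T : ℝ) {ε : ℝ} (hε : ε ∈ Icc 0 Δ) :
    ∫⁻ v in Ioc 0 (T - Δ), ‖h (v + ε)‖ₑ ≤ ∫⁻ v in Ioc 0 T, ‖h v‖ₑ := by
  have := setLIntegral_Ioc_sub (fun v => ‖h v‖ₑ) 0 (T - Δ) (-ε)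
  simp only [sub_neg_eq_add] at this
  rw [this]
  exact lintegral_mono_set (Ioc_subset_Ioc (by linarith [hε.1]) (by linarith [hε.2]))

theorem setLIntegral_enorm_lt_top (hi : IntegrableOn h (Icc 0 T)) :
    ∫⁻ v in Ioc 0 T, ‖h v‖ₑ < ∞ := (hi.mono_set Ioc_subset_Icc_self).2

theorem integrableOn_add (hh : Measurable h) (hi : IntegrableOn h (Icc 0 T)) {ε : ℝ}
    (hε : ε ∈ Icc 0 Δ) : IntegrableOn (fun v => h (v + ε)) (Ioc 0 (T - Δ)) :=
  ⟨(hh.comp (measurable_add_const ε)).aestronglyMeasurable,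
    (setLIntegral_add_le h T hε).trans_lt (setLIntegral_enorm_lt_top hi)⟩

theorem setLIntegral_increment_le_iSup (hh : Measurable h) (hi : IntegrableOn h (Icc 0 T))
    (hΔT : Δ ≤ T) {ε : ℝ} (hε : ε ∈ Icc 0 Δ) :
    ∫⁻ v in Ioc 0 (T - Δ), ‖h (v + ε) - h v‖ₑ
      ≤ ENNReal.ofReal (⨆ ε : Icc (0 : ℝ) Δ, ∫ y in (0 : ℝ)..(T - Δ), |h (y + ε) - h y|) := by
  have h0 : ∀ ε ∈ Icc (0 : ℝ) Δ, ∫⁻ v in Ioc 0 (T - Δ), ‖h (v + ε) - h v‖ₑ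
      = ENNReal.ofReal (∫ y in (0 : ℝ)..(T - Δ), |h (y + ε) - h y|) := by
    intro ε hε
    refine lintegral_enorm_eq_ofReal (h := fun v => h (v + ε) - h v) (by linarith)
      ((integrableOn_add hh hi hε).sub (hi.mono_set fun v hv => ⟨hv.1.le, ?_⟩))
    linarith [hv.2, hε.1, hε.2]
  have hA := (setLIntegral_enorm_lt_top hi).ne
  rw [h0 ε hε]
  -- A real supremum over an unbounded family is 0, so boundedness must be shown; 2∫|h| over (0,T]
  -- is a bound.
  refine ENNReal.ofReal_le_ofReal
    (le_ciSup (f := fun ε : Icc (0 : ℝ) Δ => ∫ y in (0 : ℝ)..(T - Δ), |h (y + ε) - h y|)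
      ⟨((∫⁻ v in Ioc 0 T, ‖h v‖ₑ) + ∫⁻ v in Ioc 0 T, ‖h v‖ₑ).toReal, ?_⟩ ⟨ε, hε⟩)
  rintro _ ⟨⟨ε, hε⟩, rfl⟩
  refine (ENNReal.ofReal_le_iff_le_toReal (ENNReal.add_ne_top.2 ⟨hA, hA⟩)).1 ?_
  rw [← h0 ε hε]
  calc ∫⁻ v in Ioc 0 (T - Δ), ‖h (v + ε) - h v‖ₑ
      ≤ ∫⁻ v in Ioc 0 (T - Δ), (‖h (v + ε)‖ₑ + ‖h v‖ₑ) := lintegral_mono fun v => enorm_sub_le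
    _ = (∫⁻ v in Ioc 0 (T - Δ), ‖h (v + ε)‖ₑ) + ∫⁻ v in Ioc 0 (T - Δ), ‖h v‖ₑ :=
        lintegral_add_right _ hh.enorm
    _ ≤ _ := add_le_add (setLIntegral_add_le h T hε)
        (lintegral_mono_set (Ioc_subset_Ioc_right (by linarith [hε.1, hε.2])))

theorem measurable_comp_ceil (h : ℝ → ℝ) (Δ : ℝ) : Measurable fun v : ℝ => h (⌈v / Δ⌉₊ * Δ) :=
  (measurable_from_nat (f := fun n : ℕ => h (n * Δ))).comp (measurable_id.div_const Δ).nat_ceil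

theorem setLIntegral_sub_ceil (hi : IntegrableOn h (Icc 0 T)) (hΔ : 0 < Δ)
    (hΔT : Δ ≤ T) :
    ∫⁻ v in Ioc 0 (T - Δ), ‖h v - h (⌈v / Δ⌉₊ * Δ)‖ₑ
      = ENNReal.ofReal (∫ y in (0 : ℝ)..(T - Δ), |h y - h (gridFloor Δ y + Δ)|) := by
  have hm := measurable_comp_ceil h Δ
  -- Without integrability the Bochner integral on the right would be 0. The step function takes
  -- only finitely many values on the interval, so the sum of their norms bounds it.
  have hint : IntegrableOn (fun v => h v - h (⌈v / Δ⌉₊ * Δ)) (Ioc 0 (T - Δ)) := by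
    refine (hi.mono_set fun v hv => ⟨hv.1.le, by linarith [hv.2]⟩).sub ?_
    refine Measure.integrableOn_of_bounded (by simp) hm.aestronglyMeasurable
      (M := ∑ j ∈ Finset.range (⌈T / Δ⌉₊ + 1), ‖h (j * Δ)‖) ?_
    refine (ae_restrict_mem measurableSet_Ioc).mono fun v hv => ?_
    refine Finset.single_le_sum (f := fun j : ℕ => ‖h (j * Δ)‖) (fun _ _ => norm_nonneg _)
      (Finset.mem_range.2 (Nat.lt_succ_of_le (Nat.ceil_mono ?_)))
    exact (div_le_div_iff_of_pos_right hΔ).2 (by linarith [hv.2])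
  rw [lintegral_enorm_eq_ofReal (by linarith) hint]
  congr 1
  refine intervalIntegral.integral_congr_ae ?_
  filter_upwards [ceil_mul_ae_eq hΔ] with v hv hv'
  rw [uIoc_of_le (by linarith)] at hv'
  rw [hv hv'.1]

/-- Cut (u,T] at the end kΔ of the bin of u. Before the cut the grid kernel vanishes and |h| is
integrated over part of (0,Δ]. After it, put v = s - kΔ and δ = kΔ - u, a number in [0,Δ]: then
h(v+δ) is compared with h(⌈v/Δ⌉Δ) through h(v), which gives the translation and discretisation terms
of C_R. -/
theorem setLIntegral_sub_gridKernel_le (hh : Measurable h) (hi : IntegrableOn h (Icc 0 T))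
    (hΔ : 0 < Δ) {M : ℕ} (hM : 1 ≤ M) (hT : T = M * Δ) {u : ℝ} (hu : u ∈ Ioc 0 T) :
    ∫⁻ s in Ioc u T, ‖h (s - u) - gridKernel h Δ s u‖ₑ
      ≤ ENNReal.ofReal (regularityConst h T Δ) := by
  have hM' : (1 : ℝ) ≤ M := by exact_mod_cast hM
  have hΔT : Δ ≤ T := by rw [hT]; nlinarith
  obtain ⟨k, hk⟩ : ∃ k, ⌈u / Δ⌉₊ = k := ⟨_, rfl⟩
  have hk1 : 1 ≤ k := hk ▸ Nat.ceil_pos.2 (div_pos hu.1 hΔ)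
  have hk1' : (1 : ℝ) ≤ k := by exact_mod_cast hk1
  have hku := (ceil_div_eq_iff hΔ hk1 u).1 hk
  have hkT : k * Δ ≤ T := by
    rw [hT]
    refine mul_le_mul_of_nonneg_right ?_ hΔ.le
    rw [← hk]
    exact_mod_cast Nat.ceil_le.2 ((div_le_iff₀ hΔ).2 (hT ▸ hu.2))
  have hδ : k * Δ - u ∈ Icc 0 Δ := ⟨by linarith [hku.2], by linarith [hku.1]⟩
  have first : ∫⁻ s in Ioc u (k * Δ), ‖h (s - u) - gridKernel h Δ s u‖ₑ
      ≤ ENNReal.ofReal (∫ y in (0 : ℝ)..Δ, |h y|) := by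
    calc ∫⁻ s in Ioc u (k * Δ), ‖h (s - u) - gridKernel h Δ s u‖ₑ
        = ∫⁻ s in Ioc u (k * Δ), ‖h (s - u)‖ₑ := by
          refine setLIntegral_congr_fun measurableSet_Ioc fun s hs => ?_
          have : ⌈s / Δ⌉₊ = k := (ceil_div_eq_iff hΔ hk1 s).2 ⟨hku.1.trans hs.1, hs.2⟩
          simp only [gridKernel]
          rw [if_neg (by omega), sub_zero]
      _ = ∫⁻ s in Ioc (u - u) (k * Δ - u), ‖h s‖ₑ :=
          setLIntegral_Ioc_sub (fun v => ‖h v‖ₑ) _ _ _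
      _ ≤ ∫⁻ s in Ioc 0 Δ, ‖h s‖ₑ :=
          lintegral_mono_set (Ioc_subset_Ioc (sub_self u).ge hδ.2)
      _ = _ := lintegral_enorm_eq_ofReal hΔ.le
          (hi.mono_set fun v hv => ⟨hv.1.le, hv.2.trans hΔT⟩)
  have second : ∫⁻ s in Ioc (k * Δ) T, ‖h (s - u) - gridKernel h Δ s u‖ₑ
      ≤ ENNReal.ofReal (⨆ ε : Icc (0 : ℝ) Δ, ∫ y in (0 : ℝ)..(T - Δ), |h (y + ε) - h y|)
        + ENNReal.ofReal (∫ y in (0 : ℝ)..(T - Δ), |h y - h (gridFloor Δ y + Δ)|) := by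
    calc ∫⁻ s in Ioc (k * Δ) T, ‖h (s - u) - gridKernel h Δ s u‖ₑ
        = ∫⁻ s in Ioc (k * Δ) T, (fun v => ‖h (v + (k * Δ - u)) - h (⌈v / Δ⌉₊ * Δ)‖ₑ)
            (s - k * Δ) := by
          refine setLIntegral_congr_fun measurableSet_Ioc fun s hs => ?_
          have h1 : ⌈s / Δ⌉₊ = ⌈(s - k * Δ) / Δ⌉₊ + k := by
            rw [← Nat.ceil_add_natCast (div_nonneg (by linarith [hs.1]) hΔ.le)]
            congr 1
            field_simp
            ring
          have h2 : 1 ≤ ⌈(s - k * Δ) / Δ⌉₊ := Nat.ceil_pos.2 (div_pos (by linarith [hs.1]) hΔ)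
          simp only [gridKernel, hk]
          rw [if_pos (by omega), h1, Nat.cast_add, add_sub_cancel_right]
          congr 3
          ring
      _ = ∫⁻ v in Ioc (k * Δ - k * Δ) (T - k * Δ),
            ‖h (v + (k * Δ - u)) - h (⌈v / Δ⌉₊ * Δ)‖ₑ :=
          setLIntegral_Ioc_sub (fun v => ‖h (v + (k * Δ - u)) - h (⌈v / Δ⌉₊ * Δ)‖ₑ) _ _ _
      _ ≤ ∫⁻ v in Ioc 0 (T - Δ), ‖h (v + (k * Δ - u)) - h (⌈v / Δ⌉₊ * Δ)‖ₑ :=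
          lintegral_mono_set (Ioc_subset_Ioc (sub_self _).ge (by nlinarith))
      _ ≤ ∫⁻ v in Ioc 0 (T - Δ), (‖h (v + (k * Δ - u)) - h v‖ₑ
            + ‖h v - h (⌈v / Δ⌉₊ * Δ)‖ₑ) := by
          refine lintegral_mono fun v => ?_
          simp only [← edist_eq_enorm_sub]
          exact edist_triangle _ _ _
      _ = (∫⁻ v in Ioc 0 (T - Δ), ‖h (v + (k * Δ - u)) - h v‖ₑ)
            + ∫⁻ v in Ioc 0 (T - Δ), ‖h v - h (⌈v / Δ⌉₊ * Δ)‖ₑ :=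
          lintegral_add_right _ (hh.sub (measurable_comp_ceil h Δ)).enorm
      _ ≤ _ := add_le_add (setLIntegral_increment_le_iSup hh hi hΔT hδ)
          (setLIntegral_sub_ceil hi hΔ hΔT).le
  have hsup : 0 ≤ ⨆ ε : Icc (0 : ℝ) Δ, ∫ y in (0 : ℝ)..(T - Δ), |h (y + ε) - h y| :=
    Real.iSup_nonneg fun _ => intervalIntegral.integral_nonneg (by linarith) fun _ _ => abs_nonneg _
  rw [← Ioc_union_Ioc_eq_Ioc hku.2 hkT, regularityConst]
  refine (lintegral_union_le _ _ _).trans ((add_le_add first second).trans (le_of_eq ?_))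
  have h1 : 0 ≤ ∫ y in (0 : ℝ)..Δ, |h y| :=
    intervalIntegral.integral_nonneg hΔ.le fun _ _ => abs_nonneg _
  rw [ENNReal.ofReal_add (add_nonneg h1 hsup), ENNReal.ofReal_add h1 hsup, add_assoc]
  exact intervalIntegral.integral_nonneg (by linarith) fun _ _ => abs_nonneg _

/-- The sum is the integral over (0,T-Δ] of the step function v ↦ |h(⌈v/Δ⌉Δ)|; the triangle
inequality compares it with |h|. This controls the grid branching ratio in case (c). -/
theorem sum_enorm_grid_le (hh : Measurable h) (hi : IntegrableOn h (Icc 0 T))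
    (hΔ : 0 < Δ) {M : ℕ} (hM : 1 ≤ M) (hT : T = M * Δ) :
    ∑ j ∈ Finset.Icc 1 (M - 1), ‖h (j * Δ)‖ₑ * ENNReal.ofReal Δ
      ≤ (∫⁻ v in Ioc 0 T, ‖h v‖ₑ)
        + ENNReal.ofReal (∫ y in (0 : ℝ)..(T - Δ), |h y - h (gridFloor Δ y + Δ)|) := by
  have hM' : (1 : ℝ) ≤ M := by exact_mod_cast hM
  have hΔT : Δ ≤ T := by rw [hT]; nlinarith
  have e : ((M - 1 : ℕ) : ℝ) * Δ = T - Δ := by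
    rw [hT, Nat.cast_sub hM]
    push_cast
    ring
  rw [← setLIntegral_ceil_div hΔ (fun j : ℕ => ‖h (j * Δ)‖ₑ), e,
    ← setLIntegral_sub_ceil hi hΔ hΔT]
  calc ∫⁻ v in Ioc 0 (T - Δ), ‖h (⌈v / Δ⌉₊ * Δ)‖ₑ
      ≤ ∫⁻ v in Ioc 0 (T - Δ), (‖h v‖ₑ + ‖h v - h (⌈v / Δ⌉₊ * Δ)‖ₑ) := by
        refine lintegral_mono fun v => ?_
        refine le_trans (le_of_eq ?_) (enorm_sub_le (a := h v) (b := h v - h (⌈v / Δ⌉₊ * Δ)))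
        rw [sub_sub_cancel]
    _ = (∫⁻ v in Ioc 0 (T - Δ), ‖h v‖ₑ) + ∫⁻ v in Ioc 0 (T - Δ), ‖h v - h (⌈v / Δ⌉₊ * Δ)‖ₑ :=
        lintegral_add_left hh.enorm _
    _ ≤ _ := add_le_add (lintegral_mono_set (Ioc_subset_Ioc_right (by linarith))) le_rfl

end

end HawkesRisk

/-! ### Stability of self-exciting intensities under a change of kernel -/

namespace HawkesRisk

/-- The difference `1_{θ ≤ a} - 1_{θ ≤ c}` of two acceptance indicators. -/
noncomputable def levelDiff (a c θ : ℝ) : ℝ := (Iic a).indicator 1 θ - (Iic c).indicator 1 θ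

theorem enorm_levelDiff (a c θ : ℝ) : ‖levelDiff a c θ‖ₑ = (uIoc a c).indicator 1 θ := by
  have : θ ∈ uIoc a c ↔ ¬ (θ ≤ a ↔ θ ≤ c) := by
    rw [mem_uIoc, ← not_le, ← not_le]
    tauto
  by_cases h1 : θ ≤ a <;> by_cases h2 : θ ≤ c <;> simp [levelDiff, indicator, this, h1, h2]

/-- The difference takes only the values -1, 0 and 1. This is what turns an L¹ bound between
intensities into an L² bound between risks. -/
theorem ofReal_levelDiff_sq (a c θ : ℝ) :
    ENNReal.ofReal (levelDiff a c θ ^ 2) = ‖levelDiff a c θ‖ₑ := by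
  by_cases h1 : θ ≤ a <;> by_cases h2 : θ ≤ c <;> simp [levelDiff, indicator, h1, h2]

theorem lintegral_enorm_levelDiff_le (a c : ℝ) :
    ∫⁻ θ in Ici (0 : ℝ), ‖levelDiff a c θ‖ₑ ≤ ‖a - c‖ₑ := by
  simp only [enorm_levelDiff]
  rw [lintegral_indicator_one measurableSet_uIoc]
  refine (Measure.restrict_apply_le _ _).trans (le_of_eq ?_)
  rw [Real.volume_uIoc, Real.enorm_eq_ofReal_abs, abs_sub_comm]

theorem measurable_levelDiff {α : Type*} [MeasurableSpace α] {f g k : α → ℝ} (hf : Measurable f)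
    (hg : Measurable g) (hk : Measurable k) : Measurable fun x => levelDiff (f x) (g x) (k x) := by
  have key : ∀ {f : α → ℝ}, Measurable f → Measurable fun x => (Iic (f x)).indicator (1 : ℝ → ℝ) (k x) := by
    intro f hf
    have : (fun x => (Iic (f x)).indicator (1 : ℝ → ℝ) (k x)) = {x | k x ≤ f x}.indicator 1 := by
      ext x; simp [indicator]
    rw [this]
    exact measurable_one.indicator (measurableSet_le hk hf)
  exact (key hf).sub (key hg)

theorem setLIntegral_symmDiff_accepted {I : Set ℝ} (hI : MeasurableSet I) (hI0 : I ⊆ Ioi 0)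
    {f g : ℝ → ℝ} (hf : Measurable f) (hg : Measurable g) (π : Measure (ℝ × ℝ × ℝ))
    (F : ℝ × ℝ × ℝ → ℝ≥0∞) :
    ∫⁻ z in symmDiff (accepted I f) (accepted I g), F z ∂π
      = ∫⁻ z in domain, I.indicator 1 z.1 * ‖levelDiff (f z.1) (g z.1) z.2.1‖ₑ * F z ∂π := by
  have hm : MeasurableSet (symmDiff (accepted I f) (accepted I g)) :=
    (measurableSet_accepted hI hf).symmDiff (measurableSet_accepted hI hg)
  have hsub : symmDiff (accepted I f) (accepted I g) ⊆ domain := by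
    rintro z (hz | hz)
    exacts [accepted_subset_domain hI0 _ hz.1, accepted_subset_domain hI0 _ hz.1]
  rw [← Measure.restrict_restrict_of_subset hsub, ← lintegral_indicator hm]
  refine setLIntegral_congr_fun measurableSet_domain fun z hz => ?_
  have h0 : 0 ≤ z.2.1 := hz.2.1
  by_cases h1 : z.1 ∈ I <;> by_cases h2 : z.2.1 ≤ f z.1 <;> by_cases h3 : z.2.1 ≤ g z.1 <;>
    simp [levelDiff, accepted, indicator, mem_symmDiff, h1, h2, h3, h0]

theorem enorm_setIntegral_sub_le {α : Type*} [MeasurableSpace α] {π : Measure α} {A B : Set α}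
    (hA : MeasurableSet A) (hB : MeasurableSet B) {F : α → ℝ} (hFA : IntegrableOn F A π)
    (hFB : IntegrableOn F B π) :
    ‖(∫ z in A, F z ∂π) - ∫ z in B, F z ∂π‖ₑ ≤ ∫⁻ z in symmDiff A B, ‖F z‖ₑ ∂π := by
  rw [← integral_inter_add_sdiff hB hFA, ← integral_inter_add_sdiff hA hFB, inter_comm B A,
    add_sub_add_left_eq_sub, Set.symmDiff_def, lintegral_union (hB.diff hA)
      (disjoint_sdiff_sdiff)]
  exact enorm_sub_le.trans (add_le_add (enorm_integral_le_lintegral_enorm _)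
    (enorm_integral_le_lintegral_enorm _))

variable {Ω : Type*} {mΩ : MeasurableSpace Ω} {μ : Measure Ω} {ν : Measure ℝ}
  {P : Ω → Measure (ℝ × ℝ × ℝ)}

/-- The expected sum over the points accepted by exactly one of two predictable intensities. -/
theorem IsPoissonRandomMeasure.setLIntegral_symmDiff_accepted_le [IsProbabilityMeasure μ]
    [IsProbabilityMeasure ν] (hP : IsPoissonRandomMeasure ν P μ)
    {ℓ ℓ' : PredSpace hP.filtration → ℝ} (hℓ : Measurable ℓ) (hℓ' : Measurable ℓ') {I : Set ℝ}
    (hI : MeasurableSet I) (hI0 : I ⊆ Ioi 0) {g : ℝ → ℝ≥0∞} (hg : Measurable g) :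
    ∫⁻ ω, ∫⁻ z in symmDiff (accepted I (path ℓ ω)) (accepted I (path ℓ' ω)), g z.2.2 ∂(P ω) ∂μ
      ≤ (∫⁻ ω, ∫⁻ s in I, ‖path ℓ ω s - path ℓ' ω s‖ₑ ∂volume ∂μ) * ∫⁻ y, g y ∂ν := by
  have hpt : ∀ s : ℝ, 0 ≤ s → ∀ ω, ((PredSpace.mk hP.filtration s.toNNReal ω).time : ℝ) = s :=
    fun s hs _ => Real.coe_toNNReal s hs
  have hk : Measurable fun x : PredSpace hP.filtration × ℝ =>
      I.indicator (1 : ℝ → ℝ≥0∞) (x.1.time : ℝ) * ‖levelDiff (ℓ x.1) (ℓ' x.1) x.2‖ₑ :=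
    (((measurable_one.indicator hI).comp (measurable_time _)).comp measurable_fst).mul
      (measurable_levelDiff (hℓ.comp measurable_fst) (hℓ'.comp measurable_fst)
        measurable_snd).enorm
  have h := hP.lintegral_kernel_mul hk hg
  calc _ = ∫⁻ ω, ∫⁻ z in domain, (I.indicator (1 : ℝ → ℝ≥0∞)
          ((PredSpace.mk hP.filtration z.1.toNNReal ω).time : ℝ)
          * ‖levelDiff (ℓ (PredSpace.mk _ z.1.toNNReal ω)) (ℓ' (PredSpace.mk _ z.1.toNNReal ω))
              z.2.1‖ₑ) * g z.2.2 ∂(P ω) ∂μ := by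
        refine lintegral_congr fun ω => ?_
        rw [setLIntegral_symmDiff_accepted hI hI0 (measurable_path hℓ ω) (measurable_path hℓ' ω)]
        refine setLIntegral_congr_fun measurableSet_domain fun z hz => ?_
        simp only [hpt z.1 (le_of_lt hz.1), path]
    _ ≤ _ := by
        rw [h]
        refine mul_le_mul' (lintegral_mono fun ω => ?_) le_rfl
        calc _ ≤ ∫⁻ s in Ioi 0, I.indicator 1 s * ‖path ℓ ω s - path ℓ' ω s‖ₑ := by
              refine setLIntegral_mono' measurableSet_Ioi fun s hs => ?_
              simp only [hpt s (le_of_lt hs)]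
              rw [lintegral_const_mul']
              · exact mul_le_mul' le_rfl (lintegral_enorm_levelDiff_le _ _)
              · by_cases hs' : s ∈ I <;> simp [hs']
          _ = ∫⁻ s in I, ‖path ℓ ω s - path ℓ' ω s‖ₑ := by
              rw [← Measure.restrict_restrict_of_subset hI0, ← lintegral_indicator hI]
              refine setLIntegral_congr_fun measurableSet_Ioi fun s hs => ?_
              by_cases hs' : s ∈ I <;> simp [hs']

theorem IsPoissonRandomMeasure.measurable_setLIntegral_accepted
    (hP : IsPoissonRandomMeasure ν P μ)
    {ℓ : PredSpace hP.filtration → ℝ} (hℓ : Measurable ℓ) {I : Set ℝ}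
    (hI : MeasurableSet I) (hI0 : I ⊆ Ioi 0) {g : ℝ → ℝ≥0∞} (hg : Measurable g) :
    Measurable fun ω => ∫⁻ z in accepted I (path ℓ ω), g z.2.2 ∂(P ω) := by
  have e : (fun ω => ∫⁻ z in accepted I (path ℓ ω), g z.2.2 ∂(P ω))
      = fun ω => ∫⁻ z, (I.indicator 1 z.1 * (Iic (path ℓ ω z.1)).indicator 1 z.2.1) * g z.2.2
        ∂(hP.kernel ω) := by
    funext ω
    rw [HawkesRisk.setLIntegral_accepted hI hI0 (measurable_path hℓ ω)]
    rfl
  rw [e]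
  have hind : Measurable fun p : Ω × ℝ × ℝ × ℝ =>
      (Iic (path ℓ p.1 p.2.1)).indicator (1 : ℝ → ℝ≥0∞) p.2.2.1 := by
    have : (fun p : Ω × ℝ × ℝ × ℝ => (Iic (path ℓ p.1 p.2.1)).indicator (1 : ℝ → ℝ≥0∞) p.2.2.1)
        = {p : Ω × ℝ × ℝ × ℝ | p.2.2.1 ≤ path ℓ p.1 p.2.1}.indicator 1 := by
      ext x; simp [indicator]
    rw [this]
    exact measurable_one.indicator (measurableSet_le (by fun_prop)
      ((measurable_uncurry_path hℓ).comp (f := fun p : Ω × ℝ × ℝ × ℝ => (p.1, p.2.1))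
        (by fun_prop)))
  exact Measurable.lintegral_kernel_prod_right' (f := fun p : Ω × ℝ × ℝ × ℝ =>
    (I.indicator 1 p.2.1 * (Iic (path ℓ p.1 p.2.1)).indicator 1 p.2.2.1) * g p.2.2.2)
    ((((measurable_one.indicator hI).comp (measurable_fst.comp measurable_snd)).mul hind).mul
      (by fun_prop))

/-- Stability of self-exciting intensities with respect to their kernels, along one path. -/
theorem IsPoissonRandomMeasure.setLIntegral_path_sub_le (hP : IsPoissonRandomMeasure ν P μ) (ω : Ω)
    {f f' : ℝ → ℝ} (hf : Measurable f) (hf' : Measurable f') {k k' : ℝ × ℝ → ℝ}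
    (hk : Measurable k) (hk' : Measurable k') {ψ b : ℝ → ℝ} {L : ℝ≥0} (hψ : LipschitzWith L ψ)
    (hb : Measurable b) (hb0 : ∀ y, 0 ≤ b y) {T : ℝ} {C S : ℝ≥0∞}
    (hC : ∀ u ∈ Ioc 0 T, ∫⁻ t in Ioc u T, ‖k (t, u) - k' (t, u)‖ₑ ≤ C)
    (hS : ∀ u ∈ Ioc 0 T, ∫⁻ t in Ioc u T, ‖k' (t, u)‖ₑ ≤ S)
    (hfin : P ω (accepted (Ioc 0 T) f) < ∞) (hfin' : P ω (accepted (Ioc 0 T) f') < ∞)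
    (h1 : ∀ t ∈ Ioc 0 T, f t = ψ (∫ z in accepted (Ioo 0 t) f, k (t, z.1) * b z.2.2 ∂(P ω)))
    (h2 : ∀ t ∈ Ioc 0 T, f' t = ψ (∫ z in accepted (Ioo 0 t) f', k' (t, z.1) * b z.2.2 ∂(P ω))) :
    ∫⁻ t in Ioc 0 T, ‖f t - f' t‖ₑ
      ≤ L * (C * ∫⁻ z in accepted (Ioc 0 T) f, ENNReal.ofReal (b z.2.2) ∂(P ω)
        + S * ∫⁻ z in symmDiff (accepted (Ioc 0 T) f) (accepted (Ioc 0 T) f'),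
          ENNReal.ofReal (b z.2.2) ∂(P ω)) := by
  have mA : ∀ {I : Set ℝ} {f : ℝ → ℝ}, MeasurableSet I → Measurable f →
      MeasurableSet (accepted I f) := fun hI hf => measurableSet_accepted hI hf
  have hint : ∀ {f : ℝ → ℝ} {k : ℝ × ℝ → ℝ}, Measurable f → Measurable k →
      P ω (accepted (Ioc 0 T) f) < ∞ → ∀ {A : Set (ℝ × ℝ × ℝ)}, A ⊆ accepted (Ioc 0 T) f →
      ∀ t, IntegrableOn (fun z : ℝ × ℝ × ℝ => k (t, z.1) * b z.2.2) A (P ω) := by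
    intro f k hf hk hfin A hA t
    refine (hP.integrableOn_of_lt_top ω (mA measurableSet_Ioc hf) hfin ?_).mono_set hA
    exact (hk.comp (measurable_const.prodMk measurable_fst)).mul (by fun_prop)
  have hpt : ∀ t ∈ Ioc 0 T, ‖f t - f' t‖ₑ
      ≤ L * ((∫⁻ z in accepted (Ioo 0 t) f,
            ‖k (t, z.1) - k' (t, z.1)‖ₑ * ENNReal.ofReal (b z.2.2) ∂(P ω))
        + ∫⁻ z in symmDiff (accepted (Ioo 0 t) f) (accepted (Ioo 0 t) f'),
            ‖k' (t, z.1)‖ₑ * ENNReal.ofReal (b z.2.2) ∂(P ω)) := by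
    intro t ht
    have hsub : ∀ f, accepted (Ioo 0 t) f ⊆ accepted (Ioc 0 T) f := fun f =>
      accepted_mono (Ioo_subset_Ioc_self.trans (Ioc_subset_Ioc_right ht.2)) f
    rw [h1 t ht, h2 t ht, ← edist_eq_enorm_sub]
    refine (hψ.edist_le_mul _ _).trans (mul_le_mul' le_rfl ?_)
    -- The intermediate quantity uses the new kernel on the points accepted by the old intensity:
    -- one term then carries only the kernel error, the other only the points accepted by exactly
    -- one intensity.
    refine (edist_triangle _ (∫ z in accepted (Ioo 0 t) f, k' (t, z.1) * b z.2.2 ∂(P ω)) _).trans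
      (add_le_add ?_ ?_)
    · rw [edist_eq_enorm_sub, ← integral_sub (hint hf hk hfin (hsub f) t)
        (hint hf hk' hfin (hsub f) t)]
      refine (enorm_integral_le_lintegral_enorm _).trans (le_of_eq (lintegral_congr fun z => ?_))
      rw [← sub_mul, enorm_mul, Real.enorm_of_nonneg (hb0 _)]
    · rw [edist_eq_enorm_sub]
      refine (enorm_setIntegral_sub_le (mA measurableSet_Ioo hf) (mA measurableSet_Ioo hf')
        (hint hf hk' hfin (hsub f) t) (hint hf' hk' hfin' (hsub f') t)).trans
        (le_of_eq (lintegral_congr fun z => ?_))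
      rw [enorm_mul, Real.enorm_of_nonneg (hb0 _)]
  set E := accepted (Ioc 0 T) f
  set E' := accepted (Ioc 0 T) f'
  have mE : MeasurableSet E := mA measurableSet_Ioc hf
  have mE' : MeasurableSet E' := mA measurableSet_Ioc hf'
  have hfinD : P ω (symmDiff E E') < ∞ :=
    (measure_mono symmDiff_le_sup).trans_lt (measure_union_lt_top hfin hfin')
  have hβ := hb.ennreal_ofReal
  have hκ : Measurable fun p : ℝ × ℝ => ‖k p - k' p‖ₑ := (hk.sub hk').enorm
  calc ∫⁻ t in Ioc 0 T, ‖f t - f' t‖ₑ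
      ≤ ∫⁻ t in Ioc 0 T, L * ((∫⁻ z in E ∩ {z | z.1 < t},
            ‖k (t, z.1) - k' (t, z.1)‖ₑ * ENNReal.ofReal (b z.2.2) ∂(P ω))
          + ∫⁻ z in symmDiff E E' ∩ {z | z.1 < t},
            ‖k' (t, z.1)‖ₑ * ENNReal.ofReal (b z.2.2) ∂(P ω)) := by
        refine setLIntegral_mono' measurableSet_Ioc fun t ht => ?_
        rw [Set.inter_symmDiff_distrib_right, accepted_Ioc_inter_lt ht.2,
          accepted_Ioc_inter_lt ht.2]
        exact hpt t ht
    _ = L * ((∫⁻ t in Ioc 0 T, ∫⁻ z in E ∩ {z | z.1 < t},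
            ‖k (t, z.1) - k' (t, z.1)‖ₑ * ENNReal.ofReal (b z.2.2) ∂(P ω))
          + ∫⁻ t in Ioc 0 T, ∫⁻ z in symmDiff E E' ∩ {z | z.1 < t},
            ‖k' (t, z.1)‖ₑ * ENNReal.ofReal (b z.2.2) ∂(P ω)) := by
        rw [lintegral_const_mul' _ _ ENNReal.coe_ne_top,
          lintegral_add_left (measurable_sum_past hfin hκ hβ)]
    _ ≤ _ := by
        refine mul_le_mul' le_rfl (add_le_add ?_ ?_)
        · exact lintegral_sum_past_le mE (fun z hz => hz.1) hfin hκ hC hβ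
        · refine lintegral_sum_past_le (mE.symmDiff mE') ?_ hfinD hk'.enorm hS hβ
          rintro z (hz | hz)
          exacts [hz.1.1, hz.1.1]

/-- Stability of self-exciting intensities with respect to their kernels. -/
theorem IsPoissonRandomMeasure.lintegral_path_sub_le [IsProbabilityMeasure μ]
    [IsProbabilityMeasure ν] (hP : IsPoissonRandomMeasure ν P μ)
    {ℓ ℓ' : PredSpace hP.filtration → ℝ} (hℓ : Measurable ℓ) (hℓ' : Measurable ℓ')
    {k k' : ℝ × ℝ → ℝ}
    (hk : Measurable k) (hk' : Measurable k') {ψ b : ℝ → ℝ} {L : ℝ≥0} (hψ : LipschitzWith L ψ)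
    (hψ0 : ∀ x, 0 ≤ ψ x) (hb : Measurable b) (hb0 : ∀ y, 0 ≤ b y) {T : ℝ} {C S q : ℝ≥0∞}
    (hC : ∀ u ∈ Ioc 0 T, ∫⁻ t in Ioc u T, ‖k (t, u) - k' (t, u)‖ₑ ≤ C)
    (hS : ∀ u ∈ Ioc 0 T, ∫⁻ t in Ioc u T, ‖k' (t, u)‖ₑ ≤ S)
    (hC' : C ≠ ∞) (hS' : S ≠ ∞) (hq : L * S * ∫⁻ y, ENNReal.ofReal (b y) ∂ν ≤ q) (hq1 : q < 1)
    (hfin : ∀ᵐ ω ∂μ, P ω (accepted (Ioc 0 T) (path ℓ ω)) < ∞)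
    (hfin' : ∀ᵐ ω ∂μ, P ω (accepted (Ioc 0 T) (path ℓ' ω)) < ∞)
    (h1 : ∀ᵐ ω ∂μ, ∀ t ∈ Ioc 0 T, path ℓ ω t
      = ψ (∫ z in accepted (Ioo 0 t) (path ℓ ω), k (t, z.1) * b z.2.2 ∂(P ω)))
    (h2 : ∀ᵐ ω ∂μ, ∀ t ∈ Ioc 0 T, path ℓ' ω t
      = ψ (∫ z in accepted (Ioo 0 t) (path ℓ' ω), k' (t, z.1) * b z.2.2 ∂(P ω)))
    (hE : ∫⁻ ω, ∫⁻ t in Ioc 0 T, ENNReal.ofReal (path ℓ ω t) ∂volume ∂μ < ∞)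
    (hE' : ∫⁻ ω, ∫⁻ t in Ioc 0 T, ENNReal.ofReal (path ℓ' ω t) ∂volume ∂μ < ∞) :
    ∫⁻ ω, ∫⁻ t in Ioc 0 T, ‖path ℓ ω t - path ℓ' ω t‖ₑ ∂volume ∂μ
      ≤ L * (∫⁻ y, ENNReal.ofReal (b y) ∂ν) * C
        * (∫⁻ ω, ∫⁻ t in Ioc 0 T, ENNReal.ofReal (path ℓ ω t) ∂volume ∂μ) / (1 - q) := by
  set e := ∫⁻ ω, ∫⁻ t in Ioc 0 T, ‖path ℓ ω t - path ℓ' ω t‖ₑ ∂volume ∂μ with he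
  have hmass : ∀ {ℓ : PredSpace hP.filtration → ℝ}, Measurable ℓ → Measurable fun ω =>
      ∫⁻ t in Ioc 0 T, ENNReal.ofReal (path ℓ ω t) := fun hℓ =>
    (measurable_uncurry_path hℓ).ennreal_ofReal.lintegral_prod_right'
  -- Nonnegativity bounds the distance by the sum of the two masses. Finiteness is needed to absorb
  -- the term q·e at the end.
  have hefin : e ≠ ∞ := by
    refine (lt_of_le_of_lt ?_ (ENNReal.add_lt_top.2 ⟨hE, hE'⟩)).ne
    rw [← lintegral_add_left (hmass hℓ), he]
    refine lintegral_mono_ae ?_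
    filter_upwards [h1, h2] with ω hω1 hω2
    rw [← lintegral_add_left (measurable_path hℓ ω).ennreal_ofReal]
    refine setLIntegral_mono' measurableSet_Ioc fun t ht => ?_
    rw [← Real.enorm_of_nonneg (r := path ℓ ω t) (by rw [hω1 t ht]; exact hψ0 _),
      ← Real.enorm_of_nonneg (r := path ℓ' ω t) (by rw [hω2 t ht]; exact hψ0 _)]
    exact enorm_sub_le
  have hacc := hP.setLIntegral_accepted hℓ (measurableSet_Ioc (a := (0 : ℝ)) (b := T))
    Ioc_subset_Ioi_self (φ := fun _ => 1) measurable_const hb.ennreal_ofReal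
  simp only [path, one_mul] at hacc
  have hsym := hP.setLIntegral_symmDiff_accepted_le hℓ hℓ'
    (measurableSet_Ioc (a := (0 : ℝ)) (b := T)) Ioc_subset_Ioi_self hb.ennreal_ofReal
  have hrec : e ≤ L * (∫⁻ y, ENNReal.ofReal (b y) ∂ν) * C
        * (∫⁻ ω, ∫⁻ t in Ioc 0 T, ENNReal.ofReal (path ℓ ω t) ∂volume ∂μ) + q * e := by
    calc e ≤ ∫⁻ ω, L * (C * (∫⁻ z in accepted (Ioc 0 T) (path ℓ ω),
            ENNReal.ofReal (b z.2.2) ∂(P ω))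
          + S * ∫⁻ z in symmDiff (accepted (Ioc 0 T) (path ℓ ω)) (accepted (Ioc 0 T) (path ℓ' ω)),
          ENNReal.ofReal (b z.2.2) ∂(P ω)) ∂μ := by
          refine lintegral_mono_ae ?_
          filter_upwards [h1, h2, hfin, hfin'] with ω hω1 hω2 hω3 hω4
          exact hP.setLIntegral_path_sub_le ω (measurable_path hℓ ω) (measurable_path hℓ' ω) hk hk'
            hψ hb hb0 hC hS hω3 hω4 hω1 hω2
      _ = L * (C * (∫⁻ ω, ∫⁻ z in accepted (Ioc 0 T) (path ℓ ω),
            ENNReal.ofReal (b z.2.2) ∂(P ω) ∂μ)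
          + S * ∫⁻ ω, ∫⁻ z in symmDiff (accepted (Ioc 0 T) (path ℓ ω))
            (accepted (Ioc 0 T) (path ℓ' ω)), ENNReal.ofReal (b z.2.2) ∂(P ω) ∂μ) := by
          rw [lintegral_const_mul' _ _ ENNReal.coe_ne_top, lintegral_add_left,
            lintegral_const_mul' _ _ hC', lintegral_const_mul' _ _ hS']
          refine Measurable.const_mul ?_ _
          exact hP.measurable_setLIntegral_accepted hℓ measurableSet_Ioc Ioc_subset_Ioi_self
            hb.ennreal_ofReal
      _ ≤ L * (C * ((∫⁻ ω, ∫⁻ t in Ioc 0 T, ENNReal.ofReal (path ℓ ω t) ∂volume ∂μ)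
            * ∫⁻ y, ENNReal.ofReal (b y) ∂ν)
          + S * (e * ∫⁻ y, ENNReal.ofReal (b y) ∂ν)) :=
          mul_le_mul' le_rfl (add_le_add (mul_le_mul' le_rfl hacc.le) (mul_le_mul' le_rfl hsym))
      -- The disagreement points contribute in proportion to e itself, with the branching ratio of
      -- the new kernel as factor.
      _ = L * (∫⁻ y, ENNReal.ofReal (b y) ∂ν) * C
          * (∫⁻ ω, ∫⁻ t in Ioc 0 T, ENNReal.ofReal (path ℓ ω t) ∂volume ∂μ)
          + (L * S * ∫⁻ y, ENNReal.ofReal (b y) ∂ν) * e := by ring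
      _ ≤ _ := add_le_add le_rfl (mul_le_mul' hq le_rfl)
  rw [ENNReal.le_div_iff_mul_le (Or.inl (tsub_pos_of_lt hq1).ne')
    (Or.inl (ENNReal.sub_ne_top ENNReal.one_ne_top)), ENNReal.mul_sub (fun _ _ => hefin), mul_one,
    mul_comm e q]
  exact tsub_le_iff_right.2 hrec

end HawkesRisk

/-! ### The martingale property of the compensated risks -/

namespace HawkesRisk

variable {Ω : Type*} {mΩ : MeasurableSpace Ω} {μ : Measure Ω} {ν : Measure ℝ}
  {P : Ω → Measure (ℝ × ℝ × ℝ)}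

/-- The compensation formula for accepted points after time `s`, on an event of `ℱ_s`. -/
theorem IsPoissonRandomMeasure.setLIntegral_accepted_past [IsProbabilityMeasure μ]
    [IsProbabilityMeasure ν] (hP : IsPoissonRandomMeasure ν P μ)
    {ℓ : PredSpace hP.filtration → ℝ} (hℓ : Measurable ℓ) {s : ℝ≥0} (t : ℝ)
    {g : ℝ → ℝ≥0∞} (hg : Measurable g) {F : Set Ω} (hF : MeasurableSet[hP.filtration s] F) :
    ∫⁻ ω in F, ∫⁻ z in accepted (Ioc (s : ℝ) t) (path ℓ ω), g z.2.2 ∂(P ω) ∂μ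
      = (∫⁻ ω in F, ∫⁻ u in Ioc (s : ℝ) t, ENNReal.ofReal (path ℓ ω u) ∂volume ∂μ) * ∫⁻ y, g y ∂ν := by
  have hF' : MeasurableSet F := hP.filtration.le s F hF
  have hI0 : Ioc (s : ℝ) t ⊆ Ioi 0 := fun u hu => lt_of_le_of_lt s.coe_nonneg hu.1
  -- The indicator of (s,∞) × F is predictable, so the event can be included in the integrand of the
  -- compensation formula.
  have h := hP.setLIntegral_accepted hℓ measurableSet_Ioc hI0
    (φ := (PredSpace.box hP.filtration s F).indicator 1)
    (measurable_one.indicator (PredSpace.measurableSet_box hF)) hg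
  have hφ : ∀ ω, ∀ u ∈ Ioc (s : ℝ) t, path (E := ℝ≥0∞)
      ((PredSpace.box hP.filtration s F).indicator 1) ω u = F.indicator 1 ω := by
    intro ω u hu
    have hu' : s < u.toNNReal := by
      rw [← NNReal.coe_lt_coe, Real.coe_toNNReal u (s.coe_nonneg.trans hu.1.le)]
      exact hu.1
    have : PredSpace.mk hP.filtration u.toNNReal ω ∈ PredSpace.box hP.filtration s F ↔ ω ∈ F :=
      ⟨fun h => h.2, fun h => ⟨hu', h⟩⟩
    by_cases hω : ω ∈ F
    · rw [path, indicator_of_mem (this.2 hω), indicator_of_mem hω]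
      rfl
    · rw [path, indicator_of_notMem (fun h => hω (this.1 h)), indicator_of_notMem hω]
  rw [← lintegral_indicator hF', ← lintegral_indicator hF']
  convert! h using 2
  · funext ω
    have e : ∫⁻ z in accepted (Ioc (s : ℝ) t) (path ℓ ω), path (E := ℝ≥0∞)
        ((PredSpace.box hP.filtration s F).indicator 1) ω z.1 * g z.2.2 ∂(P ω)
        = ∫⁻ z in accepted (Ioc (s : ℝ) t) (path ℓ ω), F.indicator 1 ω * g z.2.2 ∂(P ω) :=
      setLIntegral_congr_fun (measurableSet_accepted measurableSet_Ioc (measurable_path hℓ ω))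
        fun z hz => by simp only [hφ ω z.1 hz.1]
    rw [e]
    by_cases hω : ω ∈ F <;> simp [hω]
  · refine lintegral_congr fun ω => ?_
    have e : ∫⁻ u in Ioc (s : ℝ) t, path (E := ℝ≥0∞)
        ((PredSpace.box hP.filtration s F).indicator 1) ω u * ENNReal.ofReal (path ℓ ω u)
        = ∫⁻ u in Ioc (s : ℝ) t, F.indicator 1 ω * ENNReal.ofReal (path ℓ ω u) :=
      setLIntegral_congr_fun measurableSet_Ioc fun u hu => by simp only [hφ ω u hu]
    rw [e]
    by_cases hω : ω ∈ F <;> simp [hω]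

/-- A predictable intensity on `(0,T]` which is nonnegative, has finite expected mass and accepts
finitely many points. -/
structure IsIntegrableIntensity (hP : IsPoissonRandomMeasure ν P μ)
    (ℓ : PredSpace hP.filtration → ℝ) (T : ℝ) : Prop where
  measurable : Measurable ℓ
  nonneg : ∀ᵐ ω ∂μ, ∀ t ∈ Ioc 0 T, 0 ≤ path ℓ ω t
  lintegral_lt_top :
    ∫⁻ ω, ∫⁻ t in Ioc 0 T, ENNReal.ofReal (path ℓ ω t) ∂volume ∂μ < ∞
  accepted_lt_top : ∀ᵐ ω ∂μ, P ω (accepted (Ioc 0 T) (path ℓ ω)) < ∞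

section intensity

variable {hP : IsPoissonRandomMeasure ν P μ} {ℓ : PredSpace hP.filtration → ℝ} {T : ℝ}

theorem IsIntegrableIntensity.measurable_mass (hI : IsIntegrableIntensity hP ℓ T) (s t : ℝ) :
    Measurable fun ω => ∫⁻ u in Ioc s t, ENNReal.ofReal (path ℓ ω u) :=
  (measurable_uncurry_path hI.measurable).ennreal_ofReal.lintegral_prod_right'

theorem IsIntegrableIntensity.lintegral_Ioc_lt_top (hI : IsIntegrableIntensity hP ℓ T) {s t : ℝ}
    (hs : 0 ≤ s) (ht : t ≤ T) :
    ∫⁻ ω, ∫⁻ u in Ioc s t, ENNReal.ofReal (path ℓ ω u) ∂volume ∂μ < ∞ :=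
  (lintegral_mono fun _ => lintegral_mono_set (Ioc_subset_Ioc hs ht)).trans_lt hI.lintegral_lt_top

theorem IsIntegrableIntensity.integrable_mass (hI : IsIntegrableIntensity hP ℓ T) {s t : ℝ}
    (hs : 0 ≤ s) (ht : t ≤ T) :
    Integrable (fun ω => (∫⁻ u in Ioc s t, ENNReal.ofReal (path ℓ ω u)).toReal) μ :=
  integrable_toReal_of_lintegral_ne_top (hI.measurable_mass s t).aemeasurable
    (hI.lintegral_Ioc_lt_top hs ht).ne

theorem IsIntegrableIntensity.integrableOn_path (hI : IsIntegrableIntensity hP ℓ T) :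
    ∀ᵐ ω ∂μ, IntegrableOn (path ℓ ω) (Ioc 0 T) := by
  filter_upwards [hI.nonneg, ae_lt_top (hI.measurable_mass 0 T) hI.lintegral_lt_top.ne]
    with ω h0 hfin
  refine ⟨(measurable_path hI.measurable ω).aestronglyMeasurable, lt_of_le_of_lt ?_ hfin⟩
  refine setLIntegral_mono' measurableSet_Ioc fun t ht => ?_
  rw [Real.enorm_of_nonneg (h0 t ht)]

theorem IsIntegrableIntensity.integral_path (hI : IsIntegrableIntensity hP ℓ T) :
    ∀ᵐ ω ∂μ, ∀ s t, 0 ≤ s → s ≤ t → t ≤ T → ∫ u in s..t, path ℓ ω u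
      = (∫⁻ u in Ioc s t, ENNReal.ofReal (path ℓ ω u)).toReal := by
  filter_upwards [hI.nonneg] with ω h0 s t hs hst ht
  rw [intervalIntegral.integral_of_le hst, integral_eq_lintegral_of_nonneg_ae]
  · exact (ae_restrict_mem measurableSet_Ioc).mono fun u hu =>
      h0 u ⟨hs.trans_lt hu.1, hu.2.trans ht⟩
  · exact (measurable_path hI.measurable ω).aestronglyMeasurable

/-- The expectation of a sum of marks over the accepted points after time `s`, on `ℱ_s`. -/
theorem IsIntegrableIntensity.integral_accepted [IsProbabilityMeasure μ] [IsProbabilityMeasure ν]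
    (hI : IsIntegrableIntensity hP ℓ T) {s : ℝ≥0} {t : ℝ} (ht : t ≤ T) {g : ℝ → ℝ}
    (hg : Measurable g) (hgi : Integrable g ν) :
    Integrable (fun ω => ∫ z in accepted (Ioc (s : ℝ) t) (path ℓ ω), g z.2.2 ∂(P ω)) μ ∧
    ∀ F, MeasurableSet[hP.filtration s] F →
      ∫ ω in F, ∫ z in accepted (Ioc (s : ℝ) t) (path ℓ ω), g z.2.2 ∂(P ω) ∂μ
        = (∫ ω in F, (∫⁻ u in Ioc (s : ℝ) t, ENNReal.ofReal (path ℓ ω u)).toReal ∂μ) * ∫ y, g y ∂ν := by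
  have hng : Measurable fun y => -g y := hg.neg
  have hngi : Integrable (fun y => -g y) ν := hgi.neg
  have hs0 : Ioc (s : ℝ) t ⊆ Ioc 0 T := Ioc_subset_Ioc s.coe_nonneg ht
  have hI0 : Ioc (s : ℝ) t ⊆ Ioi 0 := fun u hu => lt_of_le_of_lt s.coe_nonneg hu.1
  -- Compensation is available for nonnegative functions; it is applied to the positive and negative
  -- parts of g separately.
  let U : (ℝ → ℝ) → Ω → ℝ≥0∞ := fun g ω =>
    ∫⁻ z in accepted (Ioc (s : ℝ) t) (path ℓ ω), ENNReal.ofReal (g z.2.2) ∂(P ω)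
  have hU : ∀ {g : ℝ → ℝ}, Measurable g → Measurable (U g) := fun hg =>
    hP.measurable_setLIntegral_accepted hI.measurable measurableSet_Ioc hI0 hg.ennreal_ofReal
  have hUF : ∀ {g : ℝ → ℝ}, Measurable g → ∀ F, MeasurableSet[hP.filtration s] F →
      ∫⁻ ω in F, U g ω ∂μ = (∫⁻ ω in F, ∫⁻ u in Ioc (s : ℝ) t, ENNReal.ofReal (path ℓ ω u) ∂volume ∂μ)
        * ∫⁻ y, ENNReal.ofReal (g y) ∂ν := fun hg F hF =>
    hP.setLIntegral_accepted_past hI.measurable t hg.ennreal_ofReal hF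
  have hE := hI.lintegral_Ioc_lt_top s.coe_nonneg ht
  have hνfin : ∀ {g : ℝ → ℝ}, Integrable g ν → ∫⁻ y, ENNReal.ofReal (g y) ∂ν < ∞ := fun hgi =>
    (lintegral_mono fun y => Real.ofReal_le_enorm _).trans_lt hgi.2
  have hUtop : ∀ {g : ℝ → ℝ}, Measurable g → Integrable g ν → ∫⁻ ω, U g ω ∂μ < ∞ := by
    intro g hg hgi
    have := hUF hg univ .univ
    rw [Measure.restrict_univ] at this
    rw [this]
    exact ENNReal.mul_lt_top hE (hνfin hgi)
  have hZ : (fun ω => ∫ z in accepted (Ioc (s : ℝ) t) (path ℓ ω), g z.2.2 ∂(P ω))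
      =ᵐ[μ] fun ω => (U g ω).toReal - (U (fun y => -g y) ω).toReal := by
    filter_upwards [hI.accepted_lt_top] with ω hω
    refine integral_eq_lintegral_pos_part_sub_lintegral_neg_part ?_
    refine hP.integrableOn_of_lt_top ω (measurableSet_accepted measurableSet_Ioc
      (measurable_path hI.measurable ω)) ((measure_mono (accepted_mono hs0 _)).trans_lt hω) ?_
    fun_prop
  have hi : ∀ {g : ℝ → ℝ}, Measurable g → Integrable g ν →
      Integrable (fun ω => (U g ω).toReal) μ := fun hg hgi =>
    integrable_toReal_of_lintegral_ne_top (hU hg).aemeasurable (hUtop hg hgi).ne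
  refine ⟨((hi hg hgi).sub (hi hng hngi)).congr hZ.symm, fun F hF => ?_⟩
  have hval : ∀ {g : ℝ → ℝ}, Measurable g → Integrable g ν → ∫ ω in F, (U g ω).toReal ∂μ
      = (∫⁻ ω in F, ∫⁻ u in Ioc (s : ℝ) t, ENNReal.ofReal (path ℓ ω u) ∂volume ∂μ).toReal
        * (∫⁻ y, ENNReal.ofReal (g y) ∂ν).toReal := by
    intro g hg hgi
    rw [integral_toReal (hU hg).aemeasurable
      (ae_restrict_of_ae (ae_lt_top (hU hg) (hUtop hg hgi).ne)), hUF hg F hF, ENNReal.toReal_mul]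
  rw [integral_congr_ae (ae_restrict_of_ae hZ),
    integral_sub (hi hg hgi).integrableOn (hi hng hngi).integrableOn, hval hg hgi,
    hval hng hngi, integral_eq_lintegral_pos_part_sub_lintegral_neg_part hgi,
    integral_toReal (hI.measurable_mass _ _).aemeasurable
      (ae_restrict_of_ae (ae_lt_top (hI.measurable_mass _ _) hE.ne)), mul_sub]

theorem IsIntegrableIntensity.compensated_sub (hI : IsIntegrableIntensity hP ℓ T) {s t : ℝ}
    (hs : 0 ≤ s) (hst : s ≤ t) (ht : t ≤ T) :
    ∀ᵐ ω ∂μ, compensated ν P ℓ t ω - compensated ν P ℓ s ω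
      = (∫ z in accepted (Ioc s t) (path ℓ ω), z.2.2 ∂(P ω))
        - (∫ y, y ∂ν) * (∫⁻ u in Ioc s t, ENNReal.ofReal (path ℓ ω u)).toReal := by
  filter_upwards [hI.accepted_lt_top, hI.integrableOn_path, hI.integral_path] with ω h1 h2 h3
  have hm : ∀ {a c : ℝ}, MeasurableSet (accepted (Ioc a c) (path ℓ ω)) := fun {a c} =>
    measurableSet_accepted measurableSet_Ioc (measurable_path hI.measurable ω)
  have hint : ∀ {a c : ℝ}, 0 ≤ a → c ≤ T →
      IntegrableOn (fun z : ℝ × ℝ × ℝ => z.2.2) (accepted (Ioc a c) (path ℓ ω)) (P ω) :=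
    fun {a c} ha hc => hP.integrableOn_of_lt_top ω hm
      ((measure_mono (accepted_mono (Ioc_subset_Ioc ha hc) _)).trans_lt h1) (by fun_prop)
  have hu : accepted (Ioc 0 t) (path ℓ ω)
      = accepted (Ioc 0 s) (path ℓ ω) ∪ accepted (Ioc s t) (path ℓ ω) := by
    rw [← Ioc_union_Ioc_eq_Ioc hs hst]
    ext z
    simp only [accepted, mem_union, mem_ofPred_eq]
    tauto
  have hd : Disjoint (accepted (Ioc 0 s) (path ℓ ω)) (accepted (Ioc s t) (path ℓ ω)) :=
    disjoint_left.2 fun z hz hz' => absurd hz.1.2 (not_le.2 hz'.1.1)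
  have hii : ∀ {a c : ℝ}, 0 ≤ a → a ≤ c → c ≤ T → IntervalIntegrable (path ℓ ω) volume a c :=
    fun ha hac hc => (intervalIntegrable_iff_integrableOn_Ioc_of_le hac).2
      (h2.mono_set (Ioc_subset_Ioc ha hc))
  rw [compensated, compensated, hu, setIntegral_union hd hm (hint le_rfl (hst.trans ht))
    (hint hs ht), ← intervalIntegral.integral_add_adjacent_intervals (hii le_rfl hs (hst.trans ht))
    (hii hs hst ht), ← h3 s t hs hst ht]
  ring

theorem IsIntegrableIntensity.integrable_compensated [IsProbabilityMeasure μ]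
    [IsProbabilityMeasure ν] (hI : IsIntegrableIntensity hP ℓ T)
    (hν : Integrable (fun y : ℝ => y) ν) {t : ℝ} (ht0 : 0 ≤ t) (ht : t ≤ T) :
    Integrable (compensated ν P ℓ t) μ := by
  have h0 : ∀ ω, compensated ν P ℓ 0 ω = 0 := fun ω => by simp [compensated, accepted]
  have h1 := (hI.integral_accepted (s := 0) ht measurable_id hν).1
  rw [NNReal.coe_zero] at h1
  refine (h1.sub ((hI.integrable_mass le_rfl ht).const_mul (∫ y, y ∂ν))).congr ?_
  filter_upwards [hI.compensated_sub le_rfl ht0 ht] with ω hω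
  rw [h0, sub_zero] at hω
  exact hω.symm

/-- On an event of ℱ_s the marks accepted in (s,t] and their compensator have the same mean, so the
increment integrates to 0. -/
theorem IsIntegrableIntensity.setIntegral_compensated_eq [IsProbabilityMeasure μ]
    [IsProbabilityMeasure ν] (hI : IsIntegrableIntensity hP ℓ T)
    (hν : Integrable (fun y : ℝ => y) ν) {s : ℝ≥0} {t : ℝ} (hst : s ≤ t) (ht : t ≤ T) {F : Set Ω}
    (hF : MeasurableSet[hP.filtration s] F) :
    ∫ ω in F, compensated ν P ℓ s ω ∂μ = ∫ ω in F, compensated ν P ℓ t ω ∂μ := by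
  have h1 := hI.integral_accepted (s := s) ht (g := fun y => y) measurable_id hν
  have hs := hI.integrable_compensated hν s.coe_nonneg (hst.trans ht)
  have ht' := hI.integrable_compensated hν (s.coe_nonneg.trans hst) ht
  refine (sub_eq_zero.1 ?_).symm
  rw [← integral_sub ht'.integrableOn hs.integrableOn,
    integral_congr_ae (ae_restrict_of_ae (hI.compensated_sub s.coe_nonneg hst ht)),
    integral_sub h1.1.integrableOn
      ((hI.integrable_mass s.coe_nonneg ht).const_mul (∫ y, y ∂ν)).integrableOn, integral_const_mul]
  rw [h1.2 F hF]
  ring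

/-- Adapted versions of the compensated sums along a grid are martingales. -/
theorem IsIntegrableIntensity.martingale [IsProbabilityMeasure μ]
    [IsProbabilityMeasure ν] (hI : IsIntegrableIntensity hP ℓ T)
    (hν : Integrable (fun y : ℝ => y) ν) {Δ : ℝ} (hΔ : 0 ≤ Δ) {M : ℕ} (hMT : M * Δ ≤ T)
    {X : Fin (M + 1) → Ω → ℝ} (hX : StronglyAdapted (gridFiltration hP.filtration Δ M) X)
    (hXe : ∀ k : Fin (M + 1), X k =ᵐ[μ] compensated ν P ℓ ((k : ℕ) * Δ)) :
    Martingale X (gridFiltration hP.filtration Δ M) μ := by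
  have hle : ∀ k : Fin (M + 1), ((k : ℕ) : ℝ) * Δ ≤ T := fun k =>
    (mul_le_mul_of_nonneg_right (by exact_mod_cast k.is_le) hΔ).trans hMT
  have hint : ∀ k, Integrable (X k) μ := fun k =>
    (hI.integrable_compensated hν (by positivity) (hle k)).congr (hXe k).symm
  refine ⟨hX, fun i j hij => (ae_eq_condExp_of_forall_setIntegral_eq
    ((gridFiltration hP.filtration Δ M).le i) (hint j) (fun _ _ _ => (hint i).integrableOn)
    (fun F hF _ => ?_) (hX i).aestronglyMeasurable).symm⟩
  rw [integral_congr_ae (ae_restrict_of_ae (hXe i)), integral_congr_ae (ae_restrict_of_ae (hXe j)),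
    ← coe_gridTime hΔ]
  refine hI.setIntegral_compensated_eq hν ?_ (hle j) hF
  rw [coe_gridTime hΔ]
  exact mul_le_mul_of_nonneg_right (by exact_mod_cast hij) hΔ

end intensity

/-- The filtration is not completed and `compensated` agrees with Ξ only almost surely, so
adaptedness is shown for Ξ itself: R is adapted by assumption and the compensator is progressively
measurable. -/
theorem IsHawkesSolution.stronglyAdapted (hP : IsPoissonRandomMeasure ν P μ) {T : ℝ}
    {h ψ b : ℝ → ℝ} {R lam : ℝ → Ω → ℝ}
    (hsol : IsHawkesSolution μ P hP.measurable T h ψ b R lam) {Δ : ℝ} (hΔ : 0 ≤ Δ) {M : ℕ}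
    (hMT : M * Δ ≤ T) :
    StronglyAdapted (gridFiltration hP.filtration Δ M)
      fun k : Fin (M + 1) => compensatedRisk ν Δ R lam k := by
  intro k
  have h1 := hsol.adapted (gridTime Δ k) (by
    rw [coe_gridTime hΔ]
    exact (mul_le_mul_of_nonneg_right (by exact_mod_cast k.is_le) hΔ).trans hMT)
  have h2 := stronglyMeasurable_intervalIntegral_pred
    (measurable_toPred (𝓕 := hP.filtration) hsol.predictable) (gridTime Δ k)
  rw [coe_gridTime hΔ] at h1 h2
  refine h1.sub (StronglyMeasurable.const_mul ?_ _)
  convert h2 using 2 with ω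
  refine intervalIntegral.integral_congr fun s hs => ?_
  rw [uIcc_of_le (by positivity)] at hs
  exact (path_toPred hP.filtration lam ω hs.1).symm

theorem IsPoissonRandomMeasure.stronglyAdapted_discrete (hP : IsPoissonRandomMeasure ν P μ)
    {Δ : ℝ} (hΔ : 0 < Δ) {h ψ b : ℝ → ℝ} (hψ : Measurable ψ) (hb : Measurable b) (M : ℕ) :
    StronglyAdapted (gridFiltration hP.filtration Δ M)
      fun k : Fin (M + 1) => compensatedDiscreteRisk ν P Δ h ψ b k := by
  intro k
  have hlev : ∀ i ∈ Finset.Icc 1 (k : ℕ),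
      Measurable[hP.filtration (gridTime Δ k)] fun ω => discreteLevel (P ω) Δ h ψ b i :=
    fun i hi => (hP.measurable_discreteLevel hΔ.le hψ hb i).mono (hP.filtration.mono
      (gridTime_mono Δ (by have := (Finset.mem_Icc.1 hi).2; omega))) le_rfl
  refine Measurable.stronglyMeasurable ?_
  have e : (fun ω => compensatedDiscreteRisk ν P Δ h ψ b k ω) = fun ω =>
      (∑ i ∈ Finset.Icc 1 (k : ℕ), binSum (P ω) Δ i (discreteLevel (P ω) Δ h ψ b i) fun y => y)
        - (∫ y, y ∂ν) * ∑ i ∈ Finset.Icc 1 (k : ℕ), discreteLevel (P ω) Δ h ψ b i * Δ := by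
    funext ω
    simp only [compensatedDiscreteRisk, discreteRisk, mul_div_cancel_right₀ _ hΔ.ne',
      Nat.floor_natCast, discreteIntensity_mul hΔ]
  change Measurable[hP.filtration (gridTime Δ k)] fun ω => compensatedDiscreteRisk ν P Δ h ψ b k ω
  rw [e]
  refine Measurable.sub (Finset.measurable_sum _ fun i hi => ?_)
    (Measurable.const_mul (Finset.measurable_sum _ fun i hi => (hlev i hi).mul_const _) _)
  exact hP.measurable_binSum hΔ.le (Finset.mem_Icc.1 hi).1
    (gridTime_mono Δ (Finset.mem_Icc.1 hi).2) (hlev i hi) measurable_id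

end HawkesRisk

/-! ### Second moment of the difference of two compensated risks -/

namespace HawkesRisk

theorem integral_levelDiff {a c : ℝ} (ha : 0 ≤ a) (hc : 0 ≤ c) :
    ∫ θ in Ici (0 : ℝ), levelDiff a c θ = a - c := by
  have h1 : ∀ a : ℝ, Integrable ((Iic a).indicator (1 : ℝ → ℝ)) (volume.restrict (Ici 0)) := by
    intro a
    refine (integrable_indicator_iff measurableSet_Iic).2 ?_
    rw [IntegrableOn, Measure.restrict_restrict measurableSet_Iic, inter_comm, Ici_inter_Iic]
    exact integrableOn_const (by simp)
  have h2 : ∀ a : ℝ, 0 ≤ a → ∫ θ in Ici (0 : ℝ), (Iic a).indicator (1 : ℝ → ℝ) θ = a := by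
    intro a ha
    rw [integral_indicator_one measurableSet_Iic, measureReal_restrict_apply measurableSet_Iic,
      inter_comm, Ici_inter_Iic, Real.volume_real_Icc_of_le ha, sub_zero]
  unfold levelDiff
  rw [integral_sub (h1 a) (h1 c), h2 a ha, h2 c hc]

theorem lintegral_enorm_levelDiff_path_le {I : Set ℝ} (hI : MeasurableSet I) (hI0 : I ⊆ Ioi 0)
    (f g : ℝ → ℝ) :
    ∫⁻ s in Ioi (0 : ℝ), ∫⁻ θ in Ici (0 : ℝ), I.indicator 1 s * ‖levelDiff (f s) (g s) θ‖ₑ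
      ≤ ∫⁻ s in I, ‖f s - g s‖ₑ := by
  calc _ ≤ ∫⁻ s in Ioi 0, I.indicator 1 s * ‖f s - g s‖ₑ := by
        refine lintegral_mono fun s => ?_
        simp only
        rw [lintegral_const_mul']
        · exact mul_le_mul' le_rfl (lintegral_enorm_levelDiff_le _ _)
        · by_cases hs' : s ∈ I <;> simp [hs']
    _ = ∫⁻ s in I, ‖f s - g s‖ₑ := by
        rw [← Measure.restrict_restrict_of_subset hI0, ← lintegral_indicator hI]
        refine lintegral_congr fun s => ?_
        by_cases hs' : s ∈ I <;> simp [hs']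

/-- The mark `y` of a point with time in `(0,t]`, signed by which of two intensities accepts it. -/
noncomputable def markDiff (t : ℝ) (f g : ℝ → ℝ) (z : ℝ × ℝ × ℝ) : ℝ :=
  (Ioc 0 t).indicator 1 z.1 * levelDiff (f z.1) (g z.1) z.2.1 * z.2.2

theorem setIntegral_domain_markDiff {π : Measure (ℝ × ℝ × ℝ)} {t : ℝ} {f g : ℝ → ℝ}
    (hf : Measurable f) (hg : Measurable g)
    (hif : IntegrableOn (fun z : ℝ × ℝ × ℝ => z.2.2) (accepted (Ioc 0 t) f) π)
    (hig : IntegrableOn (fun z : ℝ × ℝ × ℝ => z.2.2) (accepted (Ioc 0 t) g) π) :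
    ∫ z in domain, markDiff t f g z ∂π
      = (∫ z in accepted (Ioc 0 t) f, z.2.2 ∂π) - ∫ z in accepted (Ioc 0 t) g, z.2.2 ∂π := by
  have hm : ∀ {f : ℝ → ℝ}, Measurable f → MeasurableSet (accepted (Ioc 0 t) f) := fun hf =>
    measurableSet_accepted measurableSet_Ioc hf
  have hind : ∀ {f : ℝ → ℝ}, Measurable f →
      ∫ z in accepted (Ioc 0 t) f, z.2.2 ∂π
        = ∫ z in domain, (accepted (Ioc 0 t) f).indicator (fun z => z.2.2) z ∂π := fun {f} hf => by
    rw [integral_indicator (hm hf), Measure.restrict_restrict_of_subset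
      (accepted_subset_domain Ioc_subset_Ioi_self f)]
  rw [hind hf, hind hg, ← integral_sub]
  · refine setIntegral_congr_fun measurableSet_domain fun z hz => ?_
    have h0 : 0 ≤ z.2.1 := hz.2.1
    by_cases h1 : 0 < z.1 <;> by_cases h2 : z.1 ≤ t <;> by_cases h3 : z.2.1 ≤ f z.1 <;>
      by_cases h4 : z.2.1 ≤ g z.1 <;>
      simp [markDiff, levelDiff, accepted, indicator, h0, h1, h2, h3, h4]
  · exact ((integrable_indicator_iff (hm hf)).2 hif).integrableOn
  · exact ((integrable_indicator_iff (hm hg)).2 hig).integrableOn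

theorem integral_intensity_markDiff {ν : Measure ℝ} [IsProbabilityMeasure ν] {t : ℝ} (ht : 0 ≤ t)
    {f g : ℝ → ℝ} (hf0 : ∀ s ∈ Ioc 0 t, 0 ≤ f s) (hg0 : ∀ s ∈ Ioc 0 t, 0 ≤ g s)
    (hif : IntegrableOn f (Ioc 0 t)) (hig : IntegrableOn g (Ioc 0 t))
    (hi : Integrable (markDiff t f g) ((pointIntensity ν).restrict domain)) :
    ∫ z, markDiff t f g z ∂((pointIntensity ν).restrict domain)
      = (∫ y, y ∂ν) * ((∫ s in (0 : ℝ)..t, f s) - ∫ s in (0 : ℝ)..t, g s) := by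
  rw [pointIntensity_restrict_domain] at hi ⊢
  rw [integral_prod _ hi, intervalIntegral.integral_of_le ht, intervalIntegral.integral_of_le ht,
    ← integral_sub hif hig, ← integral_const_mul,
    ← Measure.restrict_restrict_of_subset (Ioc_subset_Ioi_self : Ioc 0 t ⊆ Ioi 0),
    ← integral_indicator measurableSet_Ioc]
  refine integral_congr_ae (ae_of_all _ fun s => ?_)
  have h1 := integral_prod_mul (μ := volume.restrict (Ici (0 : ℝ))) (ν := ν)
    (fun θ => (Ioc 0 t).indicator 1 s * levelDiff (f s) (g s) θ) (fun y => y)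
  simp only [markDiff]
  refine h1.trans ?_
  by_cases hs : s ∈ Ioc 0 t
  · simp only [indicator_of_mem hs, Pi.one_apply, one_mul]
    rw [integral_levelDiff (hf0 s hs) (hg0 s hs), mul_comm]
  · simp [indicator_of_notMem hs]

variable {Ω : Type*} {mΩ : MeasurableSpace Ω} {μ : Measure Ω} {ν : Measure ℝ}
  {P : Ω → Measure (ℝ × ℝ × ℝ)} {hP : IsPoissonRandomMeasure ν P μ}

/-- The second moment of the difference of two compensated sums of marks. -/
theorem IsIntegrableIntensity.lintegral_sq_sub_le [IsProbabilityMeasure μ] [IsProbabilityMeasure ν]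
    {ℓ ℓ' : PredSpace hP.filtration → ℝ} {T : ℝ} (hI : IsIntegrableIntensity hP ℓ T)
    (hI' : IsIntegrableIntensity hP ℓ' T) (hν : Integrable (fun y : ℝ => y) ν) {t : ℝ}
    (ht0 : 0 ≤ t) (ht : t ≤ T)
    (he : ∫⁻ ω, ∫⁻ s in Ioc 0 T, ‖path ℓ ω s - path ℓ' ω s‖ₑ ∂volume ∂μ < ∞) :
    ∫⁻ ω, ENNReal.ofReal ((compensated ν P ℓ t ω - compensated ν P ℓ' t ω) ^ 2) ∂μ
      ≤ (∫⁻ ω, ∫⁻ s in Ioc 0 T, ‖path ℓ ω s - path ℓ' ω s‖ₑ ∂volume ∂μ)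
        * ∫⁻ y, ENNReal.ofReal (y ^ 2) ∂ν := by
  -- A predictable integrand whose integral against P minus its integral against the intensity is
  -- the difference of the two compensated sums.
  let F : PredSpace hP.filtration × ℝ × ℝ → ℝ := fun x =>
    (Ioc 0 t).indicator 1 (x.1.time : ℝ) * levelDiff (ℓ x.1) (ℓ' x.1) x.2.1 * x.2.2
  have hF : Measurable F :=
    (((measurable_one.indicator measurableSet_Ioc).comp
      ((measurable_time _).comp measurable_fst)).mul
      (measurable_levelDiff (hI.measurable.comp measurable_fst)
        (hI'.measurable.comp measurable_fst) measurable_snd.fst)).mul measurable_snd.snd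
  have hFz : ∀ ω, ∀ z ∈ domain, F (predPoint hP.filtration (ω, z))
      = markDiff t (path ℓ ω) (path ℓ' ω) z := by
    intro ω z hz
    have : ((PredSpace.mk hP.filtration z.1.toNNReal ω).time : ℝ) = z.1 :=
      Real.coe_toNNReal z.1 (le_of_lt hz.1)
    simp only [F, predPoint, this, markDiff, path]
  have hmk : ∀ ω, Measurable fun p : ℝ × ℝ => (Ioc 0 t).indicator (1 : ℝ → ℝ≥0∞) p.1
      * ‖levelDiff (path ℓ ω p.1) (path ℓ' ω p.1) p.2‖ₑ := fun ω =>
    ((measurable_one.indicator measurableSet_Ioc).comp measurable_fst).mul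
      (measurable_levelDiff ((measurable_path hI.measurable ω).comp measurable_fst)
        ((measurable_path hI'.measurable ω).comp measurable_fst) measurable_snd).enorm
  have hbound : ∀ {G : PredSpace hP.filtration × ℝ × ℝ → ℝ≥0∞} {g : ℝ → ℝ≥0∞}, Measurable g →
      (∀ ω, ∀ z ∈ domain, G (predPoint hP.filtration (ω, z))
        = (Ioc 0 t).indicator 1 z.1 * ‖levelDiff (path ℓ ω z.1) (path ℓ' ω z.1) z.2.1‖ₑ
          * g z.2.2) →
      ∫⁻ ω, ∫⁻ z, G (predPoint _ (ω, z)) ∂((pointIntensity ν).restrict domain) ∂μ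
        ≤ (∫⁻ ω, ∫⁻ s in Ioc 0 T, ‖path ℓ ω s - path ℓ' ω s‖ₑ ∂volume ∂μ) * ∫⁻ y, g y ∂ν := by
    intro G g hg hG
    calc _ ≤ ∫⁻ ω, (∫⁻ s in Ioc 0 T, ‖path ℓ ω s - path ℓ' ω s‖ₑ) * (∫⁻ y, g y ∂ν) ∂μ := by
          refine lintegral_mono fun ω => ?_
          rw [setLIntegral_congr_fun measurableSet_domain (hG ω), lintegral_domain_mul (hmk ω) hg]
          refine mul_le_mul' ?_ le_rfl
          exact (lintegral_enorm_levelDiff_path_le measurableSet_Ioc Ioc_subset_Ioi_self _ _).trans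
            (lintegral_mono_set (Ioc_subset_Ioc_right ht))
      _ = _ := lintegral_mul_const _ (((measurable_uncurry_path hI.measurable).sub
          (measurable_uncurry_path hI'.measurable)).enorm.lintegral_prod_right')
  have hfin : ∫⁻ ω, ∫⁻ z, ‖F (predPoint _ (ω, z))‖ₑ ∂((pointIntensity ν).restrict domain) ∂μ
      < ∞ := by
    refine (hbound (G := fun x => ‖F x‖ₑ) (g := fun y => ‖y‖ₑ) measurable_enorm
      fun ω z hz => ?_).trans_lt (ENNReal.mul_lt_top he hν.2)
    rw [hFz ω z hz, markDiff, enorm_mul, enorm_mul]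
    congr 2
    by_cases hs : z.1 ∈ Ioc 0 t <;> simp [hs]
  have hae : ∀ᵐ ω ∂μ, Integrable (markDiff t (path ℓ ω) (path ℓ' ω))
      ((pointIntensity ν).restrict domain) := by
    have hm : Measurable fun p : Ω × ℝ × ℝ × ℝ => F (predPoint hP.filtration p) :=
      hF.comp (measurable_predPoint _)
    have hms : SFinite ((pointIntensity ν).restrict domain) := by
      rw [pointIntensity_restrict_domain]
      infer_instance
    filter_upwards [ae_lt_top hm.enorm.lintegral_prod_right' hfin.ne] with ω hω
    refine Integrable.congr (f := fun z => F (predPoint hP.filtration (ω, z)))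
      ⟨(hm.comp measurable_prodMk_left).aestronglyMeasurable, hω⟩ ?_
    exact (ae_restrict_mem measurableSet_domain).mono fun z hz => hFz ω z hz
  calc _ = ∫⁻ ω, ENNReal.ofReal ((∫ z, F (predPoint _ (ω, z)) ∂((P ω).restrict domain)
        - ∫ z, F (predPoint _ (ω, z)) ∂((pointIntensity ν).restrict domain)) ^ 2) ∂μ := by
        refine lintegral_congr_ae ?_
        filter_upwards [hae, hI.accepted_lt_top, hI'.accepted_lt_top, hI.nonneg, hI'.nonneg,
          hI.integrableOn_path, hI'.integrableOn_path] with ω h1 h2 h3 h4 h5 h6 h7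
        have hsub : Ioc 0 t ⊆ Ioc 0 T := Ioc_subset_Ioc_right ht
        have hi : ∀ {ℓ : PredSpace hP.filtration → ℝ}, Measurable ℓ →
            P ω (accepted (Ioc 0 T) (path ℓ ω)) < ∞ →
            IntegrableOn (fun z : ℝ × ℝ × ℝ => z.2.2) (accepted (Ioc 0 t) (path ℓ ω)) (P ω) :=
          fun hℓ hfin => hP.integrableOn_of_lt_top ω (measurableSet_accepted measurableSet_Ioc
            (measurable_path hℓ ω)) ((measure_mono (accepted_mono hsub _)).trans_lt hfin)
            (by fun_prop)
        rw [setIntegral_congr_fun measurableSet_domain (hFz ω),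
          setIntegral_congr_fun measurableSet_domain (hFz ω),
          setIntegral_domain_markDiff (measurable_path hI.measurable ω)
            (measurable_path hI'.measurable ω) (hi hI.measurable h2) (hi hI'.measurable h3),
          integral_intensity_markDiff ht0 (fun s hs => h4 s (hsub hs)) (fun s hs => h5 s (hsub hs))
            (h6.mono_set hsub) (h7.mono_set hsub) h1, compensated, compensated]
        congr 2
        ring
    _ ≤ _ := hP.lintegral_sq_le hF hfin
    _ ≤ _ := by
        -- The squared difference of indicators equals its absolute value, so the bound used for
        -- integrability applies again with weight y² in place of |y|.
        refine hbound (G := fun x => ENNReal.ofReal (F x ^ 2))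
          (g := fun y => ENNReal.ofReal (y ^ 2)) (by fun_prop) fun ω z hz => ?_
        rw [hFz ω z hz, markDiff, mul_pow, mul_pow, ENNReal.ofReal_mul (by positivity),
          ENNReal.ofReal_mul (by positivity), ofReal_levelDiff_sq]
        congr 2
        by_cases hs : z.1 ∈ Ioc 0 t <;> simp [hs]

end HawkesRisk

/-! ### Maximal inequality and final estimates -/

namespace HawkesRisk

variable {Ω : Type*} {mΩ : MeasurableSpace Ω} {μ : Measure Ω} {ν : Measure ℝ}
  {P : Ω → Measure (ℝ × ℝ × ℝ)}

/-- The index `min n M` of `Fin (M + 1)`. -/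
def clampIndex (M n : ℕ) : Fin (M + 1) := ⟨min n M, by omega⟩

/-- A filtration indexed by `Fin (M + 1)`, continued as constant after `M`. -/
def clampFiltration {M : ℕ} (𝒢 : Filtration (Fin (M + 1)) mΩ) : Filtration ℕ mΩ where
  seq n := 𝒢 (clampIndex M n)
  mono' _ _ hij := 𝒢.mono (show min _ M ≤ min _ M from min_le_min_right M hij)
  le' _ := 𝒢.le _

/-- Conditional Jensen for x ↦ x². Clamping the index at M extends the grid process to ℕ, where the
maximal inequality is stated, without changing its maximum up to time M. -/
theorem submartingale_sq_clamp [IsFiniteMeasure μ] {M : ℕ} {D : ℕ → Ω → ℝ}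
    {𝒢 : Filtration (Fin (M + 1)) mΩ} (hD : Martingale (fun k : Fin (M + 1) => D k) 𝒢 μ)
    (h2 : ∀ k ≤ M, Integrable (fun ω => D k ω ^ 2) μ) :
    Submartingale (fun n ω => D (min n M) ω ^ 2) (clampFiltration 𝒢) μ := by
  refine ⟨fun n => (hD.stronglyAdapted (clampIndex M n)).pow 2, fun i j hij => ?_,
    fun n => h2 _ (min_le_right _ _)⟩
  have h1 := hD.2 (clampIndex M i) (clampIndex M j)
    (show min _ M ≤ min _ M from min_le_min_right M hij)
  have h3 := ConvexOn.map_condExp_le_univ (φ := fun x : ℝ => x ^ 2) (𝒢.le (clampIndex M i))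
    (even_two.convexOn_pow) (continuous_pow 2).lowerSemicontinuous
    (hD.integrable (clampIndex M j)) (h2 _ (min_le_right _ _))
  filter_upwards [h1, h3] with ω hω1 hω3
  simp only [Function.comp_apply, hω1] at hω3
  exact hω3

theorem lintegral_Ioi_mul_rpow {V c : ℝ} (hV : 0 ≤ V) (hc : 0 < c) :
    ∫⁻ t in Ioi c, ENNReal.ofReal (V * t ^ (-2 : ℝ)) = ENNReal.ofReal (V / c) := by
  have hi : IntegrableOn (fun t : ℝ => t ^ (-2 : ℝ)) (Ioi c) :=
    integrableOn_Ioi_rpow_of_lt (by norm_num) hc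
  rw [← ofReal_integral_eq_lintegral_ofReal (hi.const_mul V), integral_const_mul,
    integral_Ioi_rpow_of_lt (by norm_num) hc]
  · norm_num [Real.rpow_neg_one, div_eq_mul_inv]
  · refine (ae_restrict_mem measurableSet_Ioi).mono fun t ht => ?_
    exact mul_nonneg hV (Real.rpow_nonneg (hc.trans ht).le _)

/-- An `L¹` maximal inequality for square integrable martingales in finite discrete time. -/
theorem integral_sup_abs_le [IsProbabilityMeasure μ] {M : ℕ} (hM : 1 ≤ M) {D : ℕ → Ω → ℝ}
    {𝒢 : Filtration (Fin (M + 1)) mΩ} (hD : Martingale (fun k : Fin (M + 1) => D k) 𝒢 μ)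
    (h2 : ∀ k ≤ M, Integrable (fun ω => D k ω ^ 2) μ) {V : ℝ} (hV : ∫ ω, D M ω ^ 2 ∂μ ≤ V)
    {c : ℝ} (hc : 0 < c) :
    ∫ ω, (Finset.Icc 1 M).sup' (Finset.nonempty_Icc.2 hM) (fun k => |D k ω|) ∂μ ≤ c + V / c := by
  have hV0 : 0 ≤ V := (integral_nonneg fun _ => sq_nonneg _).trans hV
  set f : Ω → ℝ := fun ω => (Finset.Icc 1 M).sup' (Finset.nonempty_Icc.2 hM) fun k => |D k ω|
    with hf
  have hmeas : ∀ k ≤ M, Measurable (D k) := fun k hk =>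
    ((hD.stronglyAdapted ⟨k, Nat.lt_succ_of_le hk⟩).mono (𝒢.le _)).measurable
  have hfm : Measurable f := by
    have e : f = (Finset.Icc 1 M).sup' (Finset.nonempty_Icc.2 hM) fun k ω => |D k ω| := by
      ext ω
      simp only [hf, Finset.sup'_apply]
    rw [e]
    exact Finset.measurable_sup' _ fun k hk => (hmeas k (Finset.mem_Icc.1 hk).2).abs
  have hf0 : ∀ ω, 0 ≤ f ω := fun ω =>
    (abs_nonneg _).trans (Finset.le_sup' (fun k => |D k ω|) (Finset.mem_Icc.2 ⟨le_rfl, hM⟩))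
  have hsub := submartingale_sq_clamp hD h2
  -- Doob's weak inequality for the squared martingale: the maximum of |D| reaches t exactly when
  -- the maximum of D² reaches t².
  have htail : ∀ t : ℝ, 0 < t → μ {ω | t ≤ f ω} ≤ ENNReal.ofReal (V * t ^ (-2 : ℝ)) := by
    intro t ht
    have h := maximal_ineq hsub (fun _ _ => sq_nonneg _) (ε := (t ^ 2).toNNReal) M
    rw [Real.coe_toNNReal _ (sq_nonneg t)] at h
    have hle : ∫ ω in {ω | t ^ 2 ≤ (Finset.range (M + 1)).sup' Finset.nonempty_range_add_one
        fun k => D (min k M) ω ^ 2}, D (min M M) ω ^ 2 ∂μ ≤ V := by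
      rw [min_self]
      exact (setIntegral_le_integral (h2 M le_rfl) (ae_of_all _ fun _ => sq_nonneg _)).trans hV
    have hincl : {ω | t ≤ f ω} ⊆ {ω | t ^ 2 ≤ (Finset.range (M + 1)).sup'
        Finset.nonempty_range_add_one fun k => D (min k M) ω ^ 2} := by
      intro ω hω
      obtain ⟨k, hk, hkt⟩ := (Finset.le_sup'_iff _).1 (show t ≤ f ω from hω)
      have hkM := (Finset.mem_Icc.1 hk).2
      change t ^ 2 ≤ (Finset.range (M + 1)).sup' Finset.nonempty_range_add_one _
      refine (Finset.le_sup'_iff _).2 ⟨k, Finset.mem_range.2 (Nat.lt_succ_of_le hkM), ?_⟩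
      rw [min_eq_left hkM, ← sq_abs (D k ω)]
      exact pow_le_pow_left₀ ht.le hkt 2
    have h3 : ENNReal.ofReal (t ^ 2) * μ {ω | t ≤ f ω} ≤ ENNReal.ofReal V :=
      (mul_le_mul' le_rfl (measure_mono hincl)).trans (h.trans (ENNReal.ofReal_le_ofReal hle))
    have ht2 : 0 < t ^ 2 := by positivity
    rw [Real.rpow_neg ht.le, Real.rpow_two, ← div_eq_mul_inv, ENNReal.ofReal_div_of_pos ht2,
      ENNReal.le_div_iff_mul_le (Or.inl (ENNReal.ofReal_pos.2 ht2).ne')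
        (Or.inl ENNReal.ofReal_ne_top), mul_comm]
    exact h3
  -- Integrate the tail over t: bound it by 1 up to c and by V/t² beyond, which gives c + V/c.
  have hl : ∫⁻ ω, ENNReal.ofReal (f ω) ∂μ ≤ ENNReal.ofReal (c + V / c) := by
    rw [lintegral_eq_lintegral_meas_le μ (ae_of_all _ hf0) hfm.aemeasurable,
      ← Ioc_union_Ioi_eq_Ioi hc.le, ENNReal.ofReal_add hc.le (by positivity)]
    refine (lintegral_union_le _ _ _).trans (add_le_add ?_ ?_)
    · refine (setLIntegral_mono' measurableSet_Ioc fun t _ => prob_le_one).trans (le_of_eq ?_)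
      simp
    · refine (setLIntegral_mono' measurableSet_Ioi fun t ht => htail t (hc.trans ht)).trans ?_
      exact (lintegral_Ioi_mul_rpow hV0 hc).le
  rw [integral_eq_lintegral_of_nonneg_ae (ae_of_all _ hf0) hfm.aestronglyMeasurable]
  exact ENNReal.toReal_le_of_le_ofReal (by positivity) hl

theorem regularityConst_nonneg (h : ℝ → ℝ) {T Δ : ℝ} (hΔ : 0 ≤ Δ) (hΔT : Δ ≤ T) :
    0 ≤ regularityConst h T Δ := by
  have h0 : ∀ {a : ℝ} (g : ℝ → ℝ), 0 ≤ a → 0 ≤ ∫ y in (0 : ℝ)..a, |g y| := fun g ha =>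
    intervalIntegral.integral_nonneg ha fun _ _ => abs_nonneg _
  exact add_nonneg (add_nonneg (h0 _ hΔ) (Real.iSup_nonneg fun ε => h0 _ (sub_nonneg.2 hΔT)))
    (h0 _ (sub_nonneg.2 hΔT))

section

variable {T Δ : ℝ} {h ψ b : ℝ → ℝ} {R lam : ℝ → Ω → ℝ} {L : ℝ≥0}

theorem IsHawkesSolution.isIntegrableIntensity [IsProbabilityMeasure μ] [IsProbabilityMeasure ν]
    {hP : IsPoissonRandomMeasure ν P μ}
    (hsol : IsHawkesSolution μ P hP.measurable T h ψ b R lam) (hT : 0 ≤ T)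
    (hψ : LipschitzWith L ψ) (hψ0 : ∀ x, 0 ≤ ψ x) (hh : Measurable h)
    (hi : IntegrableOn h (Icc 0 T)) (hb : Measurable b) (hb0 : ∀ y, 0 ≤ b y)
    (hbi : Integrable b ν) {r : ℝ} (hr : rho L ν h b T ≤ r) (hr1 : r < 1) :
    IsIntegrableIntensity hP (toPred hP.filtration lam) T where
  measurable := measurable_toPred hsol.predictable
  nonneg := by
    filter_upwards [hsol.path_eq hP] with ω hω t ht
    rw [hω t (Ioc_subset_Icc_self ht)]
    exact hψ0 _
  lintegral_lt_top := (hsol.lintegral_path_le hP hT hψ hh hi hb hb0 hbi hr hr1).trans_lt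
    (ENNReal.div_lt_top (ENNReal.mul_ne_top ENNReal.ofReal_ne_top ENNReal.ofReal_ne_top)
      (tsub_pos_of_lt (ENNReal.ofReal_lt_one.2 hr1)).ne')
  accepted_lt_top := hsol.accepted_lt_top hP

theorem IsPoissonRandomMeasure.isIntegrableIntensity_step [IsProbabilityMeasure μ]
    [IsProbabilityMeasure ν] (hP : IsPoissonRandomMeasure ν P μ) (hΔ : 0 < Δ)
    (hψ : LipschitzWith L ψ) (hψ0 : ∀ x, 0 ≤ ψ x) (h : ℝ → ℝ) (hb : Measurable b)
    (hb0 : ∀ y, 0 ≤ b y) (hbi : Integrable b ν) (M : ℕ) :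
    IsIntegrableIntensity hP (stepIntensity hP Δ h ψ b) (M * Δ) where
  measurable := measurable_stepIntensity hP hΔ hψ.continuous.measurable hb
  nonneg := ae_of_all _ fun ω t ht => by
    rw [hP.path_step_eq hΔ hψ.continuous.measurable hb ω ht.1]
    exact hψ0 _
  lintegral_lt_top := hP.lintegral_path_step_lt_top hΔ hψ hb hb0 hbi M
  accepted_lt_top := ae_of_all _ fun ω => hP.accepted_step_lt_top hΔ ω M

theorem IsHawkesSolution.martingale [IsProbabilityMeasure μ] [IsProbabilityMeasure ν]
    {hP : IsPoissonRandomMeasure ν P μ}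
    (hsol : IsHawkesSolution μ P hP.measurable T h ψ b R lam)
    (hI : IsIntegrableIntensity hP (toPred hP.filtration lam) T)
    (hν : Integrable (fun y : ℝ => y) ν) (hΔ : 0 ≤ Δ) {M : ℕ} (hMT : M * Δ ≤ T) :
    Martingale (fun k : Fin (M + 1) => compensatedRisk ν Δ R lam k)
      (gridFiltration hP.filtration Δ M) μ := by
  refine hI.martingale hν hΔ hMT (hsol.stronglyAdapted hP hΔ hMT) fun k => ?_
  filter_upwards [hsol.compensatedRisk_ae_eq hP hΔ] with ω hω
  exact hω k ((mul_le_mul_of_nonneg_right (by exact_mod_cast k.is_le) hΔ).trans hMT)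

theorem IsPoissonRandomMeasure.martingale_discrete [IsProbabilityMeasure μ]
    [IsProbabilityMeasure ν] (hP : IsPoissonRandomMeasure ν P μ) (hΔ : 0 < Δ)
    (hψ : LipschitzWith L ψ) (hψ0 : ∀ x, 0 ≤ ψ x) (h : ℝ → ℝ) (hb : Measurable b)
    (hb0 : ∀ y, 0 ≤ b y) (hbi : Integrable b ν) (hν : Integrable (fun y : ℝ => y) ν) (M : ℕ) :
    Martingale (fun k : Fin (M + 1) => compensatedDiscreteRisk ν P Δ h ψ b k)
      (gridFiltration hP.filtration Δ M) μ :=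
  (hP.isIntegrableIntensity_step hΔ hψ hψ0 h hb hb0 hbi M).martingale hν hΔ.le le_rfl
    (hP.stronglyAdapted_discrete hΔ hψ.continuous.measurable hb M) fun k =>
    ae_of_all _ (hP.compensatedDiscreteRisk_eq hΔ hψ.continuous.measurable hb k)

/-- The constant in the estimate of the `L¹` distance between the two intensities. -/
noncomputable def intensityConst (L : ℝ≥0) (ν : Measure ℝ) (ψ b : ℝ → ℝ) (r : ℝ) : ℝ :=
  L * (∫ y, b y ∂ν) * (ψ 0 / (1 - r)) / ((1 - r) / 2)

/-- The `L¹` distance between the continuous-time and the discrete-time intensities. -/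
theorem IsHawkesSolution.lintegral_sub_step_le [IsProbabilityMeasure μ] [IsProbabilityMeasure ν]
    {hP : IsPoissonRandomMeasure ν P μ}
    (hsol : IsHawkesSolution μ P hP.measurable T h ψ b R lam) (hΔ : 0 < Δ) {M : ℕ} (hM : 1 ≤ M)
    (hT : T = M * Δ) (hψ : LipschitzWith L ψ) (hψ0 : ∀ x, 0 ≤ ψ x) (hh : Measurable h)
    (hi : IntegrableOn h (Icc 0 T)) (hb : Measurable b) (hb0 : ∀ y, 0 ≤ b y)
    (hbi : Integrable b ν) {r : ℝ} (hr0 : 0 ≤ r) (hr : rho L ν h b T ≤ r) (hr1 : r < 1)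
    (hq : L * (∑ j ∈ Finset.Icc 1 (M - 1), ‖h (j * Δ)‖ₑ * ENNReal.ofReal Δ)
      * ∫⁻ y, ENNReal.ofReal (b y) ∂ν ≤ ENNReal.ofReal ((1 + r) / 2)) :
    ∫⁻ ω, ∫⁻ t in Ioc 0 T, ‖path (toPred hP.filtration lam) ω t
        - path (stepIntensity hP Δ h ψ b) ω t‖ₑ ∂volume ∂μ
      ≤ ENNReal.ofReal (intensityConst L ν ψ b r * (T * regularityConst h T Δ)) := by
  have hM' : (1 : ℝ) ≤ M := by exact_mod_cast hM
  have hΔT : Δ ≤ T := by rw [hT]; nlinarith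
  have hT0 : 0 ≤ T := hΔ.le.trans hΔT
  have hI := hsol.isIntegrableIntensity (hP := hP) hT0 hψ hψ0 hh hi hb hb0 hbi hr hr1
  have hI' := hP.isIntegrableIntensity_step hΔ hψ hψ0 h hb hb0 hbi M
  rw [← hT] at hI'
  -- The ratio used is (1+r)/2, strictly between r and 1. This leaves room for the grid ratio to
  -- exceed ρ_h in case (c), and produces the divisor (1-r)/2 of `intensityConst`.
  have key := hP.lintegral_path_sub_le hI.measurable hI'.measurable
    (k := fun p => h (p.1 - p.2)) (k' := fun p => gridKernel h Δ p.1 p.2) (by fun_prop)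
    (measurable_uncurry_gridKernel hh Δ) hψ hψ0 hb hb0
    (fun u hu => setLIntegral_sub_gridKernel_le hh hi hΔ hM hT hu)
    (fun u hu => (lintegral_mono_set (Ioc_subset_Ioc hu.1.le hT.le)).trans
      (setLIntegral_gridKernel_le h hΔ M hu.1)) ENNReal.ofReal_ne_top
    (ENNReal.sum_ne_top.2 fun _ _ => ENNReal.mul_ne_top enorm_ne_top ENNReal.ofReal_ne_top) hq
    (ENNReal.ofReal_lt_one.2 (by linarith)) hI.accepted_lt_top hI'.accepted_lt_top
    (by
      filter_upwards [hsol.path_eq hP] with ω hω t ht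
      exact hω t (Ioc_subset_Icc_self ht))
    (ae_of_all _ fun ω t ht => hP.path_step_eq hΔ hψ.continuous.measurable hb ω ht.1)
    hI.lintegral_lt_top hI'.lintegral_lt_top
  have hmass := hsol.lintegral_path_le hP hT0 hψ hh hi hb hb0 hbi hr hr1
  have hB : 0 ≤ ∫ y, b y ∂ν := integral_nonneg hb0
  have hC := regularityConst_nonneg h hΔ.le hΔT
  have e1 : 1 - ENNReal.ofReal r = ENNReal.ofReal (1 - r) := by
    rw [ENNReal.ofReal_sub _ hr0, ENNReal.ofReal_one]
  have e2 : 1 - ENNReal.ofReal ((1 + r) / 2) = ENNReal.ofReal ((1 - r) / 2) := by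
    rw [← ENNReal.ofReal_one, ← ENNReal.ofReal_sub _ (by linarith)]
    congr 1
    ring
  rw [e1, ← ENNReal.ofReal_mul (hψ0 0), ← ENNReal.ofReal_div_of_pos (by linarith)] at hmass
  rw [e2] at key
  refine key.trans ?_
  rw [← ofReal_integral_eq_lintegral_ofReal hbi (ae_of_all _ hb0)]
  refine (ENNReal.div_le_div_right (mul_le_mul' le_rfl hmass) _).trans (le_of_eq ?_)
  rw [← ENNReal.ofReal_coe_nnreal, ← ENNReal.ofReal_mul L.coe_nonneg,
    ← ENNReal.ofReal_mul (by positivity), ← ENNReal.ofReal_mul (by positivity),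
    ← ENNReal.ofReal_div_of_pos (by linarith), intensityConst]
  congr 1
  ring

/-- The distance between the compensated continuous-time and discrete-time risks. -/
theorem IsHawkesSolution.integral_sup_le [IsProbabilityMeasure μ] [IsProbabilityMeasure ν]
    {hP : IsPoissonRandomMeasure ν P μ}
    (hsol : IsHawkesSolution μ P hP.measurable T h ψ b R lam) (hΔ : 0 < Δ) {M : ℕ} (hM : 1 ≤ M)
    (hT : T = M * Δ) (hν : MemLp (fun y : ℝ => y) 2 ν)
    (hψ : LipschitzWith L ψ) (hψ0 : ∀ x, 0 ≤ ψ x) (hh : Measurable h)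
    (hi : IntegrableOn h (Icc 0 T)) (hb : Measurable b) (hb0 : ∀ y, 0 ≤ b y)
    (hbi : Integrable b ν) {r : ℝ} (hr0 : 0 ≤ r) (hr : rho L ν h b T ≤ r) (hr1 : r < 1)
    (hq : L * (∑ j ∈ Finset.Icc 1 (M - 1), ‖h (j * Δ)‖ₑ * ENNReal.ofReal Δ)
      * ∫⁻ y, ENNReal.ofReal (b y) ∂ν ≤ ENNReal.ofReal ((1 + r) / 2)) :
    ∫ ω, (Finset.Icc 1 M).sup' (Finset.nonempty_Icc.2 hM) (fun k =>
        |compensatedRisk ν Δ R lam k ω - compensatedDiscreteRisk ν P Δ h ψ b k ω|) ∂μ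
      ≤ (1 + intensityConst L ν ψ b r * ∫ y, y ^ 2 ∂ν) * √(T * regularityConst h T Δ) := by
  have hM' : (1 : ℝ) ≤ M := by exact_mod_cast hM
  have hΔT : Δ ≤ T := by rw [hT]; nlinarith
  have hT0 : 0 ≤ T := hΔ.le.trans hΔT
  have hν1 : Integrable (fun y : ℝ => y) ν := hν.integrable one_le_two
  have hν2 : Integrable (fun y : ℝ => y ^ 2) ν := hν.integrable_sq
  have hI := hsol.isIntegrableIntensity (hP := hP) hT0 hψ hψ0 hh hi hb hb0 hbi hr hr1
  have hI' := hP.isIntegrableIntensity_step hΔ hψ hψ0 h hb hb0 hbi M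
  rw [← hT] at hI'
  have he := hsol.lintegral_sub_step_le (hP := hP) hΔ hM hT hψ hψ0 hh hi hb hb0 hbi hr0 hr hr1 hq
  set X := T * regularityConst h T Δ with hX
  have hX0 : 0 ≤ X := mul_nonneg hT0 (regularityConst_nonneg h hΔ.le hΔT)
  have hA : 0 ≤ intensityConst L ν ψ b r := by
    have hB : 0 ≤ ∫ y, b y ∂ν := integral_nonneg hb0
    have h1 : 0 ≤ 1 - r := by linarith
    have h2 := hψ0 0
    unfold intensityConst
    positivity
  set V := intensityConst L ν ψ b r * X * ∫ y, y ^ 2 ∂ν with hV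
  have hV0 : 0 ≤ V := mul_nonneg (mul_nonneg hA hX0) (integral_nonneg fun _ => sq_nonneg _)
  let D : ℕ → Ω → ℝ := fun k ω =>
    compensatedRisk ν Δ R lam k ω - compensatedDiscreteRisk ν P Δ h ψ b k ω
  have hD : Martingale (fun k : Fin (M + 1) => D k) (gridFiltration hP.filtration Δ M) μ :=
    (hsol.martingale hI hν1 hΔ.le hT.ge).sub
      (hP.martingale_discrete hΔ hψ hψ0 h hb hb0 hbi hν1 M)
  have hsq : ∀ k ≤ M, ∫⁻ ω, ENNReal.ofReal (D k ω ^ 2) ∂μ ≤ ENNReal.ofReal V := by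
    intro k hk
    have hkT : k * Δ ≤ T := by
      rw [hT]
      exact mul_le_mul_of_nonneg_right (by exact_mod_cast hk) hΔ.le
    calc ∫⁻ ω, ENNReal.ofReal (D k ω ^ 2) ∂μ
        = ∫⁻ ω, ENNReal.ofReal ((compensated ν P (toPred hP.filtration lam) (k * Δ) ω
            - compensated ν P (stepIntensity hP Δ h ψ b) (k * Δ) ω) ^ 2) ∂μ := by
          refine lintegral_congr_ae ?_
          filter_upwards [hsol.compensatedRisk_ae_eq hP hΔ.le] with ω hω
          simp only [D]
          rw [hω k hkT, hP.compensatedDiscreteRisk_eq hΔ hψ.continuous.measurable hb]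
      _ ≤ _ := hI.lintegral_sq_sub_le hI' hν1 (by positivity) hkT
          (he.trans_lt ENNReal.ofReal_lt_top)
      _ ≤ ENNReal.ofReal (intensityConst L ν ψ b r * X) * ∫⁻ y, ENNReal.ofReal (y ^ 2) ∂ν :=
          mul_le_mul' he le_rfl
      _ = _ := by
          rw [← ofReal_integral_eq_lintegral_ofReal hν2 (ae_of_all _ fun _ => sq_nonneg _),
            ← ENNReal.ofReal_mul (mul_nonneg hA hX0)]
  have hmeas : ∀ k ≤ M, Measurable (D k) := fun k hk =>
    ((hD.stronglyAdapted ⟨k, Nat.lt_succ_of_le hk⟩).mono (Filtration.le _ _)).measurable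
  have h2 : ∀ k ≤ M, Integrable (fun ω => D k ω ^ 2) μ := fun k hk =>
    ⟨((hmeas k hk).pow_const 2).aestronglyMeasurable, by
      rw [hasFiniteIntegral_iff_ofReal (ae_of_all _ fun _ => sq_nonneg _)]
      exact (hsq k hk).trans_lt ENNReal.ofReal_lt_top⟩
  have hV1 : ∫ ω, D M ω ^ 2 ∂μ ≤ V := by
    rw [integral_eq_lintegral_of_nonneg_ae (ae_of_all _ fun _ => sq_nonneg _)
      ((hmeas M le_rfl).pow_const 2).aestronglyMeasurable]
    exact ENNReal.toReal_le_of_le_ofReal hV0 (hsq M le_rfl)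
  have hdoob : ∀ c : ℝ, 0 < c → _ ≤ c + V / c := fun c hc => integral_sup_abs_le hM hD h2 hV1 hc
  -- If T·C_R = 0 then c = √(T·C_R) is not admissible, but V = 0 as well and c may be taken
  -- arbitrarily small. Otherwise this c makes both terms multiples of √(T·C_R).
  rcases hX0.eq_or_lt with hX' | hX'
  · rw [← hX', Real.sqrt_zero, mul_zero]
    refine le_of_forall_pos_le_add fun c hc => (hdoob c hc).trans (le_of_eq ?_)
    rw [hV, ← hX', mul_zero, zero_mul, zero_div, add_comm]
  · refine (hdoob (√X) (Real.sqrt_pos.2 hX')).trans (le_of_eq ?_)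
    have e : X / √X = √X := Real.div_sqrt
    calc √X + V / √X = √X + intensityConst L ν ψ b r * (∫ y, y ^ 2 ∂ν) * (X / √X) := by
          rw [hV]
          ring
      _ = _ := by
          rw [e]
          ring

end

theorem ofReal_sum_grid (h : ℝ → ℝ) {Δ : ℝ} (hΔ : 0 ≤ Δ) (M : ℕ) :
    ∑ j ∈ Finset.Icc 1 M, ‖h (j * Δ)‖ₑ * ENNReal.ofReal Δ
      = ENNReal.ofReal (∑ k ∈ Finset.Icc 1 M, |h (k * Δ)| * Δ) := by
  rw [ENNReal.ofReal_sum_of_nonneg fun _ _ => by positivity]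
  refine Finset.sum_congr rfl fun k _ => ?_
  rw [ENNReal.ofReal_mul (abs_nonneg _), Real.enorm_eq_ofReal_abs]

/-- The branching ratio of the discrete-time intensity is controlled by `rhoDisc`. -/
theorem mul_sum_grid_le_rhoDisc {ν : Measure ℝ} (L : ℝ≥0) {h b : ℝ → ℝ} {Δ : ℝ} (hΔ : 0 ≤ Δ)
    (M : ℕ) (hb0 : ∀ y, 0 ≤ b y) (hbi : Integrable b ν) :
    L * (∑ j ∈ Finset.Icc 1 (M - 1), ‖h (j * Δ)‖ₑ * ENNReal.ofReal Δ)
      * ∫⁻ y, ENNReal.ofReal (b y) ∂ν ≤ ENNReal.ofReal (rhoDisc L ν h b Δ M) := by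
  have h0 : 0 ≤ ∑ k ∈ Finset.Icc 1 M, |h (k * Δ)| * Δ :=
    Finset.sum_nonneg fun _ _ => by positivity
  rw [rhoDisc, ENNReal.ofReal_mul (by positivity), ENNReal.ofReal_mul (by positivity),
    ENNReal.ofReal_coe_nnreal, ofReal_integral_eq_lintegral_ofReal hbi (ae_of_all _ hb0),
    ← ofReal_sum_grid h hΔ]
  gcongr
  exact Nat.sub_le M 1

/-- The branching ratio of the discrete-time intensity is controlled by `rho`. -/
theorem mul_sum_grid_le_rho {ν : Measure ℝ} (L : ℝ≥0) {h b : ℝ → ℝ} {T Δ : ℝ} (hh : Measurable h)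
    (hi : IntegrableOn h (Icc 0 T)) (hΔ : 0 < Δ) {M : ℕ} (hM : 1 ≤ M) (hT : T = M * Δ)
    (hb0 : ∀ y, 0 ≤ b y) (hbi : Integrable b ν) :
    L * (∑ j ∈ Finset.Icc 1 (M - 1), ‖h (j * Δ)‖ₑ * ENNReal.ofReal Δ)
      * ∫⁻ y, ENNReal.ofReal (b y) ∂ν ≤ ENNReal.ofReal (rho L ν h b T
        + L * (∫ y, b y ∂ν) * ∫ t in (0 : ℝ)..(T - Δ), |h t - h (gridFloor Δ t + Δ)|) := by
  have hM' : (1 : ℝ) ≤ M := by exact_mod_cast hM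
  have hΔT : Δ ≤ T := by rw [hT]; nlinarith
  have hT0 : 0 ≤ T := hΔ.le.trans hΔT
  have h1 : 0 ≤ ∫ t in (0 : ℝ)..(T - Δ), |h t - h (gridFloor Δ t + Δ)| :=
    intervalIntegral.integral_nonneg (sub_nonneg.2 hΔT) fun _ _ => abs_nonneg _
  have h2 : 0 ≤ ∫ t in (0 : ℝ)..T, |h t| :=
    intervalIntegral.integral_nonneg hT0 fun _ _ => abs_nonneg _
  have hB : 0 ≤ ∫ y, b y ∂ν := integral_nonneg hb0
  refine (mul_le_mul' (mul_le_mul' le_rfl (sum_enorm_grid_le hh hi hΔ hM hT)) le_rfl).trans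
    (le_of_eq ?_)
  rw [mul_add, add_mul, mul_lintegral_eq_ofReal_rho L hT0 hi hb0 hbi,
    ENNReal.ofReal_add (by unfold rho; positivity) (by positivity),
    ENNReal.ofReal_mul (by positivity), ENNReal.ofReal_mul (by positivity),
    ENNReal.ofReal_coe_nnreal, ofReal_integral_eq_lintegral_ofReal hbi (ae_of_all _ hb0)]
  ring

/-- The discretisation error of `h` is eventually small along the grids. -/
theorem exists_grid_bound {h : ℝ → ℝ} {T : ℝ} (hlim : LimitAssumption h T) {B r : ℝ} (hr : r < 1) :
    ∃ N : ℕ, 1 ≤ N ∧ ∀ M : ℕ, N ≤ M →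
      B * ∫ t in (0 : ℝ)..(T - T / M), |h t - h (gridFloor (T / M) t + T / M)| ≤ (1 - r) / 2 := by
  have h1 := hlim.const_mul B
  rw [mul_zero] at h1
  obtain ⟨N, hN⟩ := eventually_atTop.1
    (h1.eventually (eventually_le_nhds (show (0 : ℝ) < (1 - r) / 2 by linarith)))
  exact ⟨max N 1, le_max_right _ _, fun M hM => hN M ((le_max_left _ _).trans hM)⟩

end HawkesRisk

/-! ### The proposition -/

theorem mainTheorem6
    (ν : Measure ℝ) [IsProbabilityMeasure ν] (hν : MemLp (fun y : ℝ => y) 2 ν)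
    (L : ℝ≥0) (ψ : ℝ → ℝ) (hψ : LipschitzWith L ψ) (hψ_nonneg : ∀ x, 0 ≤ ψ x)
    (b : ℝ → ℝ) (hb : Measurable b) (hb_nonneg : ∀ y, 0 ≤ b y) (hb_int : Integrable b ν)
    (r : ℝ) (hr : r < 1) :
    ∃ K : ℝ, 0 < K ∧
      ∀ (T : ℝ) (h : ℝ → ℝ), 0 < T → Measurable h → IntegrableOn h (Icc 0 T) →
        HawkesRisk.rho L ν h b T ≤ r →
      ∃ Δ₀ : ℝ, 0 < Δ₀ ∧
        ∀ {Ω : Type*} [MeasurableSpace Ω] (μ : Measure Ω) [IsProbabilityMeasure μ]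
          (P : Ω → Measure (ℝ × ℝ × ℝ)) (hP : HawkesRisk.IsPoissonRandomMeasure ν P μ)
          (R lam : ℝ → Ω → ℝ),
          HawkesRisk.IsHawkesSolution μ P hP.measurable T h ψ b R lam →
        ∀ (M : ℕ) (hM : 1 ≤ M) (Δ : ℝ), Δ = T / M →
          Martingale
            (fun k : Fin (M + 1) => HawkesRisk.compensatedRisk ν Δ R lam k)
            (HawkesRisk.gridFiltration (HawkesRisk.poissonFiltration P hP.measurable) Δ M) μ ∧
          Martingale
            (fun k : Fin (M + 1) => HawkesRisk.compensatedDiscreteRisk ν P Δ h ψ b k)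
            (HawkesRisk.gridFiltration (HawkesRisk.poissonFiltration P hP.measurable) Δ M) μ ∧
          ((HawkesRisk.rhoDisc L ν h b Δ M ≤ r ∨ (HawkesRisk.LimitAssumption h T ∧ Δ ≤ Δ₀)) →
            ∫ ω, (Finset.Icc 1 M).sup' (Finset.nonempty_Icc.2 hM) (fun k =>
                |HawkesRisk.compensatedRisk ν Δ R lam k ω
                  - HawkesRisk.compensatedDiscreteRisk ν P Δ h ψ b k ω|) ∂μ
              ≤ K * √(T * HawkesRisk.regularityConst h T Δ)) := by
  have hA : 0 ≤ HawkesRisk.intensityConst L ν ψ b r * ∫ y, y ^ 2 ∂ν := by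
    have hB : 0 ≤ ∫ y, b y ∂ν := integral_nonneg hb_nonneg
    have h1 : 0 ≤ 1 - r := by linarith
    have h2 := hψ_nonneg 0
    have h3 : 0 ≤ ∫ y, y ^ 2 ∂ν := integral_nonneg fun _ => sq_nonneg _
    unfold HawkesRisk.intensityConst
    positivity
  refine ⟨1 + HawkesRisk.intensityConst L ν ψ b r * ∫ y, y ^ 2 ∂ν, by linarith,
    fun T h hT hh hi hr' => ?_⟩
  -- Forced by 0 ≤ ρ_h ≤ r; it is needed once T and h are given, not for the choice of K.
  have hr0 : 0 ≤ r := by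
    refine le_trans ?_ hr'
    have hB : 0 ≤ ∫ y, b y ∂ν := integral_nonneg hb_nonneg
    have h2 : 0 ≤ ∫ t in (0 : ℝ)..T, |h t| :=
      intervalIntegral.integral_nonneg hT.le fun _ _ => abs_nonneg _
    unfold HawkesRisk.rho
    positivity
  have hν1 : Integrable (fun y : ℝ => y) ν := hν.integrable one_le_two
  -- The threshold depends on h and T alone. If the limit assumption fails, the small-step
  -- alternative never occurs and any N serves.
  obtain ⟨N, hN1, hN⟩ : ∃ N : ℕ, 1 ≤ N ∧ (HawkesRisk.LimitAssumption h T → ∀ M : ℕ, N ≤ M →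
      L * (∫ y, b y ∂ν) * ∫ t in (0 : ℝ)..(T - T / M),
        |h t - h (HawkesRisk.gridFloor (T / M) t + T / M)| ≤ (1 - r) / 2) := by
    by_cases hlim : HawkesRisk.LimitAssumption h T
    · obtain ⟨N, hN1, hN⟩ := HawkesRisk.exists_grid_bound hlim (B := L * ∫ y, b y ∂ν) hr
      exact ⟨N, hN1, fun _ => hN⟩
    · exact ⟨1, le_rfl, fun hl => absurd hl hlim⟩
  have hN0 : (0 : ℝ) < N := by exact_mod_cast hN1
  -- With Δ₀ = T/N, the condition Δ ≤ Δ₀ says exactly N ≤ M.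
  refine ⟨T / N, div_pos hT hN0, fun μ _ P hP R lam hsol M hM Δ hΔ => ?_⟩
  have hM0 : (0 : ℝ) < M := by exact_mod_cast hM
  have hΔ0 : 0 < Δ := hΔ ▸ div_pos hT hM0
  have hTM : T = M * Δ := by
    rw [hΔ]
    field_simp
  refine ⟨?_, hP.martingale_discrete hΔ0 hψ hψ_nonneg h hb hb_nonneg hb_int hν1 M, fun hcase => ?_⟩
  · exact hsol.martingale (hP := hP) (hsol.isIntegrableIntensity (hP := hP) hT.le hψ hψ_nonneg hh hi
      hb hb_nonneg hb_int hr' hr) hν1 hΔ0.le hTM.ge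
  · refine hsol.integral_sup_le (hP := hP) hΔ0 hM hTM hν hψ hψ_nonneg hh hi hb hb_nonneg hb_int hr0
      hr' hr ?_
    -- Both cases reduce to the grid ratio being at most (1+r)/2: in the first it is at most r, in
    -- the second at most r + (1-r)/2.
    rcases hcase with hd | ⟨hlim, hsmall⟩
    · refine (HawkesRisk.mul_sum_grid_le_rhoDisc L hΔ0.le M hb_nonneg hb_int).trans
        (ENNReal.ofReal_le_ofReal ?_)
      linarith
    · have hNM : N ≤ M := by
        rw [hΔ, div_le_div_iff_of_pos_left hT hM0 hN0] at hsmall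
        exact_mod_cast hsmall
      have hb' := hN hlim M hNM
      rw [← hΔ] at hb'
      refine (HawkesRisk.mul_sum_grid_le_rho L hh hi hΔ0 hM hTM hb_nonneg hb_int).trans
        (ENNReal.ofReal_le_ofReal ?_)
      linarith
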